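/- Let $D\subseteq\mathbb R^n$ be open and consider the control-affine system $$\dot x=g(t,x)+\sum_{i=1}^m f_i(x)u_i,\qquad x\in D,$$ with $f_i\in C^3(D;\mathbb R^n)$ and a drift $g:[0,\infty)\times D\to\mathbb R^n$ that is measurable in $t$ and continuous in $x$. Write $[V,W](x)=DW(x)V(x)-DV(x)W(x)$; norms are Euclidean, respectively the induced operator norm. Assume: 1. (Rank condition) $S_1\subseteq\{1,\dots,m\}$, $S_2\subseteq\{1,\dots,m\}^2$, $S_3\subseteq\{1,\dots,m\}^3$ satisfy $|S_1|+|S_2|+|S_3|=n$, and for every $x\in D$ the vectors $f_i(x)$ ($i\in S_1$), $[f_{j_1},f_{j_2}](x)$ ($(j_1,j_2)\in S_2$), $[[f_{\ell_1},f_{\ell_2}],f_{\ell_3}](x)$ ($(\ell_1,\ell_2,\ell_3)\in S_3$) span $\mathbb R^n$. Let $\mathcal F(x)$ be the $n\times n$ matrix with these columns. 2. (Bounded drift) For each compact $\xi\subseteq D$ there are $\tau>0$, $M_g\ge0$ such that for all $t_0\ge0$: $\|g(t,x)\|\le M_g$ for $t\in[t_0,t_0+\tau]$, $x\in\xi$.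 3. There is $\alpha>0$ with $\|\mathcal F^{-1}(x)\|\le\alpha$ for all $x\in D$. 4. (Absence of resonances) The integers $\kappa_j$ ($j\in S_2$) and, for $\ell\in S_3$, $\kappa_{1\ell}$, $\kappa_{2\ell}$, $\kappa_{3\ell}=\kappa_{1\ell}+\kappa_{2\ell}$, $\kappa_{4\ell}=\kappa_{2\ell}-\kappa_{1\ell}$ are positive and all pairwise distinct. Moreover, if $c_{s\ell}$ ($s=1,\dots,4$, $\ell\in S_3$) are relatively prime integers with $\sum|c_{s\ell}|=3$ and $\sum c_{s\ell}\kappa_{s\ell}=0$, then this relation is, up to sign, $\kappa_{1\ell}+\kappa_{2\ell}-\kappa_{3\ell}=0$ or $\kappa_{2\ell}-\kappa_{1\ell}-\kappa_{4\ell}=0$ for some $\ell\in S_3$. For $\gamma,\varepsilon>0$ let $a(x)=-\gamma\mathcal F^{-1}(x)x\in\mathbb R^n$, with coordinates $a_i,a_j,a_\ell$ indexed by $i\in S_1$, $j=(j_1,j_2)\in S_2$, $\ell=(\ell_1,\ell_2,\ell_3)\in S_3$, and let, with the Kronecker delta $\delta_{ki}$ and the real cube root, $$\begin{aligned}h^\varepsilon_k(t,x)=&\sum_{i\in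 S_1}a_i(x)\delta_{ki}+\varepsilon^{-1/2}\sum_{j\in S_2}\sqrt{|a_j(x)|}\,2\sqrt{\pi\kappa_j}\Big(\delta_{kj_1}\operatorname{sign}(a_j(x))\cos\tfrac{2\pi\kappa_jt}{\varepsilon}+\delta_{kj_2}\sin\tfrac{2\pi\kappa_jt}{\varepsilon}\Big)\\&+\varepsilon^{-2/3}\sum_{\ell\in S_3}\sqrt[3]{a_\ell(x)}\,2\sqrt[3]{2\pi^2\kappa_{3\ell}\kappa_{4\ell}}\Big(\delta_{k\ell_1}\cos\tfrac{2\pi\kappa_{1\ell}t}{\varepsilon}+\delta_{k\ell_2}\sin\tfrac{2\pi\kappa_{2\ell}t}{\varepsilon}+\delta_{k\ell_3}\cos\tfrac{2\pi\kappa_{1\ell}t}{\varepsilon}\sin\tfrac{2\pi\kappa_{2\ell}t}{\varepsilon}\Big).\end{aligned}$$ A $\pi_\varepsilon$-solution from $x^0$ on $I=[0,T)$, $0<T\le\infty$, is a locally absolutely continuous $x:I\to D$ with $x(0)=x^0$ such that for every $j=0,1,2,\dots$, with $t_j=\varepsilon j$, the equation $\dot x(t)=g(t,x(t))+\sum_k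 f_k(x(t))h^\varepsilon_k(t,x(t_j))$ holds for almost every $t\in[t_j,t_{j+1})\cap I$. Then for any $\delta,\rho>0$ with $\overline{B_\delta(0)}\subset D$ there exist $\gamma,\bar\varepsilon,\lambda,t_1>0$ such that for every $\varepsilon\in(0,\bar\varepsilon]$ and every $x^0\in B_\delta(0)$: a $\pi_\varepsilon$-solution from $x^0$ on $[0,\infty)$ exists; every $\pi_\varepsilon$-solution from $x^0$ on some $[0,T)$ with $T<\infty$ extends to one on $[0,\infty)$; the $\pi_\varepsilon$-solution on $[0,\infty)$ is unique if $g$ is Lipschitz in $x$ on each compact subset of $D$, uniformly in $t\ge0$; and every $\pi_\varepsilon$-solution from $x^0$ on $[0,\infty)$ satisfies $$\|x(t)\|\le\|x^0\|e^{-\lambda t}+\rho\ \text{ for all }t\in[0,t_1),\qquad\|x(t)\|\le\rho\ \text{ for all }t\in[t_1,\infty).$$ -/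

import Mathlib

open MeasureTheory Set

noncomputable section

/-- `ℝⁿ` with the Euclidean norm. -/
abbrev StateSpace (n : ℕ) := EuclideanSpace ℝ (Fin n)

/-- The real cube root, odd on the whole real line. -/
def cbrt (x : ℝ) : ℝ := Real.sign x * |x| ^ ((1 : ℝ) / 3)

theorem cbrt_pow_three (x : ℝ) : cbrt x ^ 3 = x := by
  have h : (|x| ^ ((1 : ℝ) / 3)) ^ 3 = |x| := by
    rw [← Real.rpow_natCast, ← Real.rpow_mul (abs_nonneg x)]
    norm_num
  unfold cbrt
  rw [mul_pow, h]
  rcases lt_trichotomy x 0 with hx | hx | hx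
  · rw [Real.sign_of_neg hx, abs_of_neg hx]; ring
  · simp [hx]
  · rw [Real.sign_of_pos hx, abs_of_pos hx]; ring

/-! ### The index sets, the bracket fields and the matrix `𝓕` -/

section Brackets

variable {n m : ℕ}

/-- The disjoint union of the index sets `S₁`, `S₂`, `S₃`; it indexes the columns of `𝓕(x)` and
the coordinates of `a(x)`. -/
abbrev BracketIndex (S₁ : Finset (Fin m)) (S₂ : Finset (Fin m × Fin m))
    (S₃ : Finset (Fin m × Fin m × Fin m)) :=
  ↥S₁ ⊕ ↥S₂ ⊕ ↥S₃

/-- The fields `f_i`, `[f_{j₁}, f_{j₂}]` and `[[f_{ℓ₁}, f_{ℓ₂}], f_{ℓ₃}]`, where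
`[V, W](x) = DW(x) V(x) - DV(x) W(x)`. -/
def bracketField (f : Fin m → StateSpace n → StateSpace n) (S₁ : Finset (Fin m))
    (S₂ : Finset (Fin m × Fin m)) (S₃ : Finset (Fin m × Fin m × Fin m)) :
    BracketIndex S₁ S₂ S₃ → StateSpace n → StateSpace n
  | .inl i => f i
  | .inr (.inl j) => VectorField.lieBracket ℝ (f j.1.1) (f j.1.2)
  | .inr (.inr l) =>
      VectorField.lieBracket ℝ (VectorField.lieBracket ℝ (f l.1.1) (f l.1.2.1)) (f l.1.2.2)

/-- The rank condition: there are `n` indices in total and, at each point of `D`, the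
corresponding fields span `ℝⁿ`. -/
def BracketRankCondition (D : Set (StateSpace n)) (f : Fin m → StateSpace n → StateSpace n)
    (S₁ : Finset (Fin m)) (S₂ : Finset (Fin m × Fin m))
    (S₃ : Finset (Fin m × Fin m × Fin m)) : Prop :=
  S₁.card + S₂.card + S₃.card = n ∧
    ∀ x ∈ D, Submodule.span ℝ (range fun i => bracketField f S₁ S₂ S₃ i x) = ⊤

/-- The matrix `𝓕(x)`, whose columns are the bracket fields at `x`, as the linear map
`c ↦ ∑ cᵢ 𝓕ᵢ(x)` between Euclidean spaces; its norm is the spectral norm. -/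
def bracketMap (f : Fin m → StateSpace n → StateSpace n) (S₁ : Finset (Fin m))
    (S₂ : Finset (Fin m × Fin m)) (S₃ : Finset (Fin m × Fin m × Fin m)) (x : StateSpace n) :
    EuclideanSpace ℝ (BracketIndex S₁ S₂ S₃) →L[ℝ] StateSpace n :=
  ∑ i, (EuclideanSpace.proj i : EuclideanSpace ℝ (BracketIndex S₁ S₂ S₃) →L[ℝ] ℝ).smulRight
    (bracketField f S₁ S₂ S₃ i x)

/-- Under the rank condition `𝓕(x)` is invertible for `x ∈ D`, so that its inverse below is the
genuine one. -/
theorem BracketRankCondition.isInvertible {D : Set (StateSpace n)}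
    {f : Fin m → StateSpace n → StateSpace n} {S₁ : Finset (Fin m)}
    {S₂ : Finset (Fin m × Fin m)} {S₃ : Finset (Fin m × Fin m × Fin m)}
    (h : BracketRankCondition D f S₁ S₂ S₃) {x : StateSpace n} (hx : x ∈ D) :
    (bracketMap f S₁ S₂ S₃ x).IsInvertible := by
  have hsurj : Function.Surjective (bracketMap f S₁ S₂ S₃ x) := by
    intro y
    have hy : y ∈ Submodule.span ℝ (range fun i => bracketField f S₁ S₂ S₃ i x) := by
      rw [h.2 x hx]; trivial
    obtain ⟨c, hc⟩ := (Submodule.mem_span_range_iff_exists_fun ℝ).1 hy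
    refine ⟨WithLp.toLp 2 c, ?_⟩
    simpa [bracketMap] using hc
  have hdim : Module.finrank ℝ (EuclideanSpace ℝ (BracketIndex S₁ S₂ S₃)) =
      Module.finrank ℝ (StateSpace n) := by
    have := h.1
    simp only [finrank_euclideanSpace, Fintype.card_sum, Fintype.card_coe, Fintype.card_fin]
    omega
  have hinj : Function.Injective (bracketMap f S₁ S₂ S₃ x) :=
    (LinearMap.injective_iff_surjective_of_finrank_eq_finrank
      (f := (bracketMap f S₁ S₂ S₃ x).toLinearMap) hdim).2 hsurj
  refine ⟨(LinearEquiv.ofBijective (bracketMap f S₁ S₂ S₃ x).toLinearMap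
    ⟨hinj, hsurj⟩).toContinuousLinearEquiv, ?_⟩
  ext v
  rfl

/-- The coefficient vector `a(x) = -γ 𝓕(x)⁻¹ x`. -/
def coeffVector (f : Fin m → StateSpace n → StateSpace n) (S₁ : Finset (Fin m))
    (S₂ : Finset (Fin m × Fin m)) (S₃ : Finset (Fin m × Fin m × Fin m)) (γ : ℝ)
    (x : StateSpace n) : EuclideanSpace ℝ (BracketIndex S₁ S₂ S₃) :=
  -(γ • (bracketMap f S₁ S₂ S₃ x).inverse x)

end Brackets

/-! ### Resonances and the frequency parameters -/

section Frequencies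

/-- `c` is a resonance of order `N` between the numbers `kᵢ`: the integers `cᵢ` are relatively
prime, `∑ |cᵢ| = N` and `∑ cᵢ kᵢ = 0`. -/
def IsResonance {ι : Type} [Fintype ι] (N : ℕ) (k c : ι → ℤ) : Prop :=
  Finset.univ.gcd c = 1 ∧ ∑ i, |c i| = (N : ℤ) ∧ ∑ i, c i * k i = 0

variable {m : ℕ} {S₂ : Finset (Fin m × Fin m)} {S₃ : Finset (Fin m × Fin m × Fin m)}

/-- The four numbers `κ₁`, `κ₂`, `κ₃ = κ₁ + κ₂`, `κ₄ = κ₂ - κ₁` attached to each `ℓ ∈ S₃`. -/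
def thirdOrderFreq (κ₁ κ₂ : ↥S₃ → ℤ) (p : ↥S₃ × Fin 4) : ℤ :=
  ![κ₁ p.1, κ₂ p.1, κ₁ p.1 + κ₂ p.1, κ₂ p.1 - κ₁ p.1] p.2

/-- The coefficients of the relation `w₀ κ₁ + w₁ κ₂ + w₂ κ₃ + w₃ κ₄` at the single index `ℓ`. -/
def relationAt (l : ↥S₃) (w : Fin 4 → ℤ) (p : ↥S₃ × Fin 4) : ℤ :=
  if p.1 = l then w p.2 else 0

/-- The third-order relations imposed by the definitions of `κ₃` and `κ₄`, up to sign: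
`κ₁ + κ₂ - κ₃ = 0` and `κ₂ - κ₁ - κ₄ = 0`, for one `ℓ ∈ S₃`. -/
def IsImposedRelation (c : ↥S₃ × Fin 4 → ℤ) : Prop :=
  ∃ l : ↥S₃, c = relationAt l ![1, 1, -1, 0] ∨ c = -relationAt l ![1, 1, -1, 0] ∨
    c = relationAt l ![-1, 1, 0, -1] ∨ c = -relationAt l ![-1, 1, 0, -1]

/-- Absence of resonances: all the parameters are positive and pairwise distinct, and the only
third-order resonances between the numbers `κ_{s,ℓ}` are the imposed ones. -/
structure NonResonant (κ : ↥S₂ → ℤ) (κ₁ κ₂ : ↥S₃ → ℤ) : Prop where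
  pos : ∀ i, 0 < Sum.elim κ (thirdOrderFreq κ₁ κ₂) i
  distinct : Function.Injective (Sum.elim κ (thirdOrderFreq κ₁ κ₂))
  noResonance : ∀ c : ↥S₃ × Fin 4 → ℤ,
    IsResonance 3 (thirdOrderFreq κ₁ κ₂) c → IsImposedRelation c

end Frequencies

/-! ### The controls -/

section Controls

variable {n m : ℕ}

/-- The Kronecker delta. -/
def kron (k i : Fin m) : ℝ := if k = i then 1 else 0

/-- `φ^{(k,ε)}_{j₁j₂}(t, x)`, where `a` is the value `a_{j₁j₂}(x)` and `κ` is `κ_{j₁j₂}`. -/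
def phiTwo (k : Fin m) (ε : ℝ) (j : Fin m × Fin m) (κ : ℤ) (a t : ℝ) : ℝ :=
  2 * √(Real.pi * κ) *
    (kron k j.1 * Real.sign a * Real.cos (2 * Real.pi * κ / ε * t) +
      kron k j.2 * Real.sin (2 * Real.pi * κ / ε * t))

/-- `φ^{(k,ε)}_{ℓ₁ℓ₂ℓ₃}(t)`, where `κ₁, κ₂` are `κ_{1ℓ₁ℓ₂ℓ₃}, κ_{2ℓ₁ℓ₂ℓ₃}`. -/
def phiThree (k : Fin m) (ε : ℝ) (l : Fin m × Fin m × Fin m) (κ₁ κ₂ : ℤ) (t : ℝ) : ℝ :=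
  2 * cbrt (2 * Real.pi ^ 2 * ((κ₁ + κ₂ : ℤ) : ℝ) * ((κ₂ - κ₁ : ℤ) : ℝ)) *
    (kron k l.1 * Real.cos (2 * Real.pi * κ₁ * t / ε) +
      kron k l.2.1 * Real.sin (2 * Real.pi * κ₂ * t / ε) +
      kron k l.2.2 * (Real.cos (2 * Real.pi * κ₁ * t / ε) * Real.sin (2 * Real.pi * κ₂ * t / ε)))

/-- The feedback `h^ε_k(t, x)` with gain `γ`. -/
def feedback (f : Fin m → StateSpace n → StateSpace n) (S₁ : Finset (Fin m))
    (S₂ : Finset (Fin m × Fin m)) (S₃ : Finset (Fin m × Fin m × Fin m))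
    (κ : ↥S₂ → ℤ) (κ₁ κ₂ : ↥S₃ → ℤ) (γ ε t : ℝ) (x : StateSpace n) (k : Fin m) : ℝ :=
  let a := coeffVector f S₁ S₂ S₃ γ x
  ∑ i : ↥S₁, a (.inl i) * kron k i +
    ε ^ (-(1 / 2 : ℝ)) *
      ∑ j : ↥S₂, √|a (.inr (.inl j))| * phiTwo k ε j (κ j) (a (.inr (.inl j))) t +
    ε ^ (-(2 / 3 : ℝ)) *
      ∑ l : ↥S₃, cbrt (a (.inr (.inr l))) * phiThree k ε l (κ₁ l) (κ₂ l) t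

end Controls

/-! ### The drift and the sampled solutions -/

section Dynamics

variable {n m : ℕ}

/-- Carathéodory regularity of the drift on `[0, ∞) × D`: measurable in `t`, continuous in `x`. -/
structure CaratheodoryDrift (D : Set (StateSpace n)) (g : ℝ → StateSpace n → StateSpace n) :
    Prop where
  measurable_time : ∀ x ∈ D, AEMeasurable (fun t => g t x) (volume.restrict (Ici 0))
  continuous_state : ∀ t, 0 ≤ t → ContinuousOn (g t) D

/-- Boundedness of the drift. -/
def BoundedDrift (D : Set (StateSpace n)) (g : ℝ → StateSpace n → StateSpace n) : Prop :=
  ∀ ξ ⊆ D, IsCompact ξ → ∃ τ > 0, ∃ M ≥ 0, ∀ t₀ ≥ 0, ∀ t ∈ Icc t₀ (t₀ + τ), ∀ x ∈ ξ, ‖g t x‖ ≤ M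

/-- The drift is Lipschitz in the state on compact subsets of `D`, uniformly in `t ≥ 0`. -/
def LipschitzDrift (D : Set (StateSpace n)) (g : ℝ → StateSpace n → StateSpace n) : Prop :=
  ∀ ξ ⊆ D, IsCompact ξ → ∃ L ≥ 0, ∀ t ≥ 0, ∀ x ∈ ξ, ∀ y ∈ ξ, ‖g t x - g t y‖ ≤ L * ‖x - y‖

/-- `x` is, on the interval `I ∋ 0` of nonnegative times, a `π_ε`-solution in `D` of
`ẋ = g(t,x) + ∑ fᵢ(x) uᵢ` under the feedback `u = h(t,x)`, with `x(0) = x₀`: it is (locally)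
absolutely continuous, and on each sampling interval `[t_j, t_{j+1})`, `t_j = ε j`, it satisfies
almost everywhere the equation with `u = h(t, x(t_j))`. A `π_ε`-solution proper has
`I = [0, ∞)`. -/
structure IsPiSolutionOn (D : Set (StateSpace n)) (g : ℝ → StateSpace n → StateSpace n)
    (f : Fin m → StateSpace n → StateSpace n) (h : ℝ → StateSpace n → Fin m → ℝ) (ε : ℝ)
    (x₀ : StateSpace n) (I : Set ℝ) (x : ℝ → StateSpace n) : Prop where
  init : x 0 = x₀
  mem : ∀ t ∈ I, x t ∈ D
  absCont : ∀ a ∈ I, ∀ b ∈ I, AbsolutelyContinuousOnInterval x a b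
  ode : ∀ j : ℕ, ∀ᵐ t, t ∈ I → t ∈ Ico (ε * j) (ε * (j + 1)) →
    HasDerivAt x (g t (x t) + ∑ i, h t (x (ε * j)) i • f i (x t)) t

end Dynamics

end

/-! One sampling period acts, to leading order, like an Euler step of `ẋ = -γ x`. Put `ε = θ ^ 6`
and rescale the period to `[0, 1]`. The feedback becomes a finite sum of cosine waves (`Atom`) with
amplitudes of order `θ ^ 6` for `S₁`, `θ ^ 3` for `S₂` and `θ ^ 2` for `S₃`. The third-order
Volterra expansion (`norm_sub_volterra_le`) describes the displacement up to the drift, at most `θ ^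
6 * M`, and terms of order `θ ^ 8`.

The iterated integrals of waves over a period are explicit. At first order only constants survive.
At second order two waves interact only if they have equal frequency and different phase, which
leaves the cosine-sine pair of a single index of `S₂` and yields the bracket of its two fields. At
third order the frequencies must satisfy `κ_p + κ_q = κ_r`; absence of resonances allows this only
inside one index of `S₃`, and the surviving terms assemble into its double bracket. The amplitudes
are normalised so that the coefficients are the coordinates of `a`; every other product vanishes or
is `O(θ ^ 7)` (`norm_sum_primitive_atomInput_sub_le`). Since `𝓕(x) a(x) = -γ x`, the state at the
end of the period differs from `1 - γ ε` times the sample by at most `ε * M + C * θ ^ 7`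
(`exists_norm_step_sub_le`).

For small `ε` the remainder is at most `ε`, so the samples contract towards the ball of radius `(M +
1) / γ`, which a high gain makes small. Between samples the state moves by `O(ε ^ (1/3))`. Hence `γ`
is fixed first, from `M`, `δ` and `ρ`, and `ε` afterwards. The samples stay in the `δ`-ball and the
whole trajectory in a slightly larger compact ball inside `D`, so all constants are uniform and
solutions cannot escape. Existence, continuation and uniqueness then follow period by period
(`SampledRegime`). -/

/-! ### Calculus along absolutely continuous curves -/

/-- The scalar fundamental theorem applies to each coordinate. Integrability of the velocity is a
conclusion, which lets an equation valid almost everywhere be rewritten in integral form. -/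
theorem AbsolutelyContinuousOnInterval.intervalIntegrable_and_integral_eq_sub {n : ℕ}
    {x φ : ℝ → StateSpace n} {a b : ℝ} (hx : AbsolutelyContinuousOnInterval x a b)
    (hd : ∀ᵐ t, t ∈ uIcc a b → HasDerivAt x (φ t) t) :
    IntervalIntegrable φ volume a b ∧ ∫ t in a..b, φ t = x b - x a := by
  have hac : ∀ i, AbsolutelyContinuousOnInterval (fun t => x t i) a b := by
    intro i
    rw [absolutelyContinuousOnInterval_iff] at hx ⊢
    intro ε hε
    obtain ⟨δ, hδ, h⟩ := hx ε hε
    refine ⟨δ, hδ, fun E hE hE' => lt_of_le_of_lt (Finset.sum_le_sum fun k _ => ?_) (h E hE hE')⟩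
    rw [dist_eq_norm, dist_eq_norm]
    simpa using PiLp.norm_apply_le (x (E.2 k).1 - x (E.2 k).2) i
  have hder : ∀ i, ∀ᵐ t, t ∈ uIcc a b → deriv (fun t => x t i) t = φ t i := by
    intro i
    filter_upwards [hd] with t ht hmem
    exact ((EuclideanSpace.proj i : StateSpace n →L[ℝ] ℝ).hasFDerivAt.comp_hasDerivAt t
      (ht hmem)).deriv
  have hder' : ∀ i, (fun t => deriv (fun t => x t i) t) =ᵐ[volume.restrict (uIoc a b)]
      fun t => φ t i := by
    intro i
    rw [Filter.EventuallyEq, ae_restrict_iff' measurableSet_uIoc]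
    filter_upwards [hder i] with t ht hmem using ht (uIoc_subset_uIcc hmem)
  have hint : IntervalIntegrable φ volume a b := by
    rw [intervalIntegrable_iff, IntegrableOn]
    refine Integrable.of_eval_piLp fun i => ?_
    exact (intervalIntegrable_iff.1 (hac i).intervalIntegrable_deriv).congr (hder' i)
  refine ⟨hint, ?_⟩
  ext i
  have h1 := (EuclideanSpace.proj i : StateSpace n →L[ℝ] ℝ).intervalIntegral_comp_comm hint
  have h2 := (hac i).integral_deriv_eq_sub
  rw [intervalIntegral.integral_congr_ae_restrict (hder' i)] at h2
  simp only [EuclideanSpace.coe_proj] at h1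
  rw [← h1, h2]
  simp

/-- A primitive of a bounded function is Lipschitz. -/
theorem lipschitzOnWith_of_eq_integral {n : ℕ} {z F : ℝ → StateSpace n} {a b c : ℝ} (hc : 0 ≤ c)
    (hF : ∀ r ∈ Icc a b, ‖F r‖ ≤ c) (hint : IntervalIntegrable F volume a b)
    (hz : ∀ s ∈ Icc a b, z s = z a + ∫ r in a..s, F r) :
    LipschitzOnWith c.toNNReal z (Icc a b) := by
  refine LipschitzOnWith.of_dist_le_mul fun s hs t ht => ?_
  have hab : a ≤ b := hs.1.trans hs.2
  have hsub : ∀ r ∈ Icc a b, IntervalIntegrable F volume a r := fun r hr =>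
    hint.mono_set (by rw [uIcc_of_le hr.1, uIcc_of_le hab]; exact Icc_subset_Icc_right hr.2)
  rw [hz s hs, hz t ht, dist_add_left, dist_eq_norm,
    intervalIntegral.integral_interval_sub_left (hsub s hs) (hsub t ht), Real.coe_toNNReal _ hc,
    Real.dist_eq]
  refine intervalIntegral.norm_integral_le_of_norm_le_const fun r hr => hF r ?_
  have := uIoc_subset_uIcc hr
  exact (uIcc_subset_Icc ht hs) this

theorem ae_hasDerivAt_of_eq_integral {n : ℕ} {z F : ℝ → StateSpace n} {a b : ℝ} 
    (hint : IntervalIntegrable F volume a b)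
    (hz : ∀ s ∈ Icc a b, z s = z a + ∫ r in a..s, F r) :
    ∀ᵐ t, t ∈ Icc a b → HasDerivAt z (F t) t := by
  -- The endpoints are discarded: the integral formula for `z` holds only on `[a, b]`, while a
  -- two-sided derivative needs a neighbourhood.
  filter_upwards [hint.ae_hasDerivAt_integral, compl_mem_ae_iff.2 (measure_singleton a),
    compl_mem_ae_iff.2 (measure_singleton b)] with t ht hta htb hmem
  have hab : a ≤ b := hmem.1.trans hmem.2
  have h1 := ht (by rwa [uIcc_of_le hab]) a left_mem_uIcc
  refine (h1.const_add (z a)).congr_of_eventuallyEq ?_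
  filter_upwards [Icc_mem_nhds (lt_of_le_of_ne hmem.1 (Ne.symm hta)) (lt_of_le_of_ne hmem.2 htb)]
    with s hs using hz s hs

/-- The chain rule in integral form along a primitive of a bounded function. -/
theorem comp_sub_eq_integral_fderiv {n : ℕ} {z F : ℝ → StateSpace n} {a b c : ℝ} (hc : 0 ≤ c)
    (hab : a ≤ b)
    (hF : ∀ r ∈ Icc a b, ‖F r‖ ≤ c) (hint : IntervalIntegrable F volume a b)
    (hz : ∀ s ∈ Icc a b, z s = z a + ∫ r in a..s, F r)
    {K : Set (StateSpace n)} (hzK : ∀ s ∈ Icc a b, z s ∈ K)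
    {φ : StateSpace n → StateSpace n} {L : NNReal} (hφL : LipschitzOnWith L φ K)
    (hφ : ∀ y ∈ K, DifferentiableAt ℝ φ y) :
    IntervalIntegrable (fun r => fderiv ℝ φ (z r) (F r)) volume a b ∧
      ∫ r in a..b, fderiv ℝ φ (z r) (F r) = φ (z b) - φ (z a) := by
  refine AbsolutelyContinuousOnInterval.intervalIntegrable_and_integral_eq_sub
    (x := fun t => φ (z t)) ?_ ?_
  · rw [← uIcc_of_le hab] at *
    exact (hφL.comp (lipschitzOnWith_of_eq_integral hc (by rwa [uIcc_of_le hab] at hF) hint 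
      (by rwa [uIcc_of_le hab] at hz)) (by rwa [uIcc_of_le hab] at hzK)
      |>.mono (by rw [uIcc_of_le hab])).absolutelyContinuousOnInterval
  · rw [uIcc_of_le hab]
    filter_upwards [ae_hasDerivAt_of_eq_integral hint hz] with t ht hmem
    exact (hφ _ (hzK t hmem)).hasFDerivAt.comp_hasDerivAt t (ht hmem)

/-- If the speed is at most `c` as long as the curve is closer than `η` to its start, and the
time is too short to reach distance `η`, then the curve stays close. -/
theorem norm_sub_le_of_speed_le {n : ℕ} {z F : ℝ → StateSpace n} {a b c η : ℝ}
    (hz : ∀ s ∈ Icc a b, z s = z a + ∫ r in a..s, F r) (hcont : ContinuousOn z (Icc a b))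
    (hc : 0 ≤ c) (hη : c * (b - a) < η)
    (hF : ∀ r ∈ Ico a b, ‖z r - z a‖ < η → ‖F r‖ ≤ c) :
    ∀ s ∈ Icc a b, ‖z s - z a‖ ≤ c * (s - a) := by
  have key : ∀ s ∈ Icc a b, (∀ r ∈ Ico a s, ‖z r - z a‖ < η) → ‖z s - z a‖ ≤ c * (s - a) := by
    intro s hs h
    rw [hz s hs, add_sub_cancel_left]
    have := intervalIntegral.norm_integral_le_of_norm_le_const_ae (a := a) (b := s) (C := c)
      (f := F) ?_
    · rwa [abs_of_nonneg (sub_nonneg.2 hs.1)] at this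
    filter_upwards [compl_mem_ae_iff.2 (measure_singleton s)] with r hr hmem
    rw [uIoc_of_le hs.1] at hmem
    have hlt : r < s := lt_of_le_of_ne hmem.2 hr
    exact hF r ⟨hmem.1.le, hlt.trans_le hs.2⟩ (h r ⟨hmem.1.le, hlt⟩)
  have hlt : ∀ s ∈ Icc a b, ‖z s - z a‖ < η := by
    by_contra! hcon
    -- By compactness there is a first time at which distance `η` is reached. The speed bound holds
    -- before it, so the distance there is at most `c * (b - a) < η`.
    set S := {s ∈ Icc a b | η ≤ ‖z s - z a‖} with hS
    have hne : S.Nonempty := hcon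
    have hcl : IsClosed S := by
      have := (hcont.sub (continuousOn_const (c := z a))).norm.preimage_isClosed_of_isClosed
        isClosed_Icc (isClosed_Ici (a := η))
      exact this
    have hcomp : IsCompact S := isCompact_Icc.of_isClosed_subset hcl (fun s hs => hs.1)
    obtain ⟨s, hs, hmin⟩ := hcomp.exists_isLeast hne
    have := key s hs.1 fun r hr => by
      by_contra! h
      have := hmin ⟨⟨hr.1, hr.2.le.trans hs.1.2⟩, h⟩
      linarith [hr.2]
    have h2 := hs.2
    have h3 : c * (s - a) ≤ c * (b - a) := by
      have := hs.1.2
      gcongr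
    linarith
  exact fun s hs => key s hs fun r hr => hlt r ⟨hr.1, hr.2.le.trans hs.2⟩

/-! ### Carathéodory existence and measurability -/

/-- Existence of solutions for a bounded right-hand side that is continuous in the state
(Carathéodory), by Tonelli's delayed approximations. -/
theorem exists_integral_solution {n : ℕ} {F : ℝ → StateSpace n → StateSpace n} {a b c : ℝ}
    (hab : a ≤ b) (hc : 0 ≤ c) (hF : ∀ t ∈ Icc a b, ∀ y, ‖F t y‖ ≤ c)
    (hcont : ∀ t ∈ Icc a b, Continuous (F t))
    (hmeas : ∀ z : ℝ → StateSpace n, Continuous z →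
      AEStronglyMeasurable (fun t => F t (z t)) (volume.restrict (Icc a b)))
    (y₀ : StateSpace n) :
    ∃ z : ℝ → StateSpace n, Continuous z ∧ z a = y₀ ∧
      IntervalIntegrable (fun t => F t (z t)) volume a b ∧
      ∀ s ∈ Icc a b, z s = y₀ + ∫ t in a..s, F t (z t) := by
  have hint : ∀ z : ℝ → StateSpace n, Continuous z →
      IntervalIntegrable (fun t => F t (z t)) volume a b := by
    intro z hz
    rw [intervalIntegrable_iff_integrableOn_Icc_of_le hab]
    refine Integrable.of_bound (hmeas z hz) c ?_
    rw [ae_restrict_iff' measurableSet_Icc]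
    exact Filter.Eventually.of_forall fun t ht => hF t ht _
  have hint' : ∀ z : ℝ → StateSpace n, Continuous z → ∀ s ∈ Icc a b, ∀ t ∈ Icc a b,
      IntervalIntegrable (fun t => F t (z t)) volume s t := fun z hz s hs t ht =>
    (hint z hz).mono_set (by rw [uIcc_of_le hab]; exact uIcc_subset_Icc hs ht)
  have hbd : ∀ z : ℝ → StateSpace n, ∀ s ∈ Icc a b, ∀ t ∈ Icc a b,
      ‖∫ r in s..t, F r (z r)‖ ≤ c * |t - s| := by
    intro z s hs t ht
    exact intervalIntegral.norm_integral_le_of_norm_le_const fun r hr =>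
      hF r (uIcc_subset_Icc hs ht (uIoc_subset_uIcc hr)) _
  -- the projection to `[a, b]`
  set π : ℝ → ℝ := fun t => max a (min b t) with hπ
  have hπmem : ∀ t, π t ∈ Icc a b := fun t => ⟨le_max_left _ _, max_le hab (min_le_left _ _)⟩
  have hπlip : ∀ s t, |π s - π t| ≤ |s - t| := by
    intro s t
    have := ((LipschitzWith.id.const_min b).const_max a).dist_le_mul s t
    simpa [Real.dist_eq] using this
  have hπid : ∀ t ∈ Icc a b, π t = t := fun t ht => by
    simp only [hπ]; rw [min_eq_right ht.2, max_eq_right ht.1]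
  -- the delayed Picard operator
  set Φ : ℝ → (ℝ → StateSpace n) → ℝ → StateSpace n :=
    fun h z t => y₀ + ∫ r in a..π (t - h), F r (z r) with hΦ
  have haI : a ∈ Icc a b := left_mem_Icc.2 hab
  have hΦlip : ∀ h z, Continuous z → ∀ s t, ‖Φ h z s - Φ h z t‖ ≤ c * |s - t| := by
    intro h z hz s t
    simp only [hΦ, add_sub_add_left_eq_sub]
    rw [intervalIntegral.integral_interval_sub_left (hint' z hz a haI _ (hπmem _))
      (hint' z hz a haI _ (hπmem _))]
    refine (hbd z _ (hπmem _) _ (hπmem _)).trans ?_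
    exact mul_le_mul_of_nonneg_left (by simpa using hπlip (s - h) (t - h)) hc
  have hΦcont : ∀ h z, Continuous z → Continuous (Φ h z) := by
    intro h z hz
    refine (LipschitzWith.of_dist_le_mul (K := c.toNNReal) fun s t => ?_).continuous
    rw [dist_eq_norm, Real.coe_toNNReal _ hc, Real.dist_eq]
    exact hΦlip h z hz s t
  -- With delay `h` the value at `t` depends on `z` only up to `t - h`. Each iteration of `Φ`
  -- therefore settles one more interval of length `h`, and finitely many reach `b`. Removing the
  -- delay changes the integral by at most `c * h`.
  have hfix : ∀ k : ℕ, ∃ z : ℝ → StateSpace n, Continuous z ∧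
      (∀ s t, ‖z s - z t‖ ≤ c * |s - t|) ∧ z a = y₀ ∧
      ∀ s ∈ Icc a b, ‖z s - (y₀ + ∫ t in a..s, F t (z t))‖ ≤ c * (1 / ((k : ℝ) + 1)) := by
    intro k
    set h : ℝ := 1 / ((k : ℝ) + 1) with hh
    have hpos : 0 < h := by positivity
    set w : ℕ → ℝ → StateSpace n := fun i => (Φ h)^[i] (fun _ => y₀) with hw
    have hw1 : ∀ i, w (i + 1) = Φ h (w i) := fun i => Function.iterate_succ_apply' _ _ _
    have he : ∀ i t, w (i + 1) t = y₀ + ∫ r in a..π (t - h), F r (w i r) := fun i t => by rw [hw1]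
    have hwc : ∀ i, Continuous (w i) := by
      intro i
      induction i with
      | zero => exact continuous_const
      | succ i ih => rw [hw1]; exact hΦcont h _ ih
    have hstab : ∀ i : ℕ, ∀ t ≤ a + i * h, w (i + 1) t = w i t := by
      intro i
      induction i with
      | zero =>
        intro t ht
        have : π (t - h) = a := by
          simp only [hπ]
          refine max_eq_left ((min_le_right _ _).trans ?_)
          simp at ht; linarith
        rw [hw1]
        simp [hΦ, this, hw]
      | succ i ih =>
        intro t ht
        rw [he (i + 1), he i]
        congr 1
        refine intervalIntegral.integral_congr fun r hr => ?_
        rw [uIcc_of_le (hπmem _).1] at hr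
        have : r ≤ a + i * h := by
          refine hr.2.trans (max_le ?_ ((min_le_right _ _).trans ?_))
          · have : 0 ≤ (i : ℝ) * h := by positivity
            linarith
          · push_cast at ht; linarith
        simp only [ih r this]
    obtain ⟨N, hN⟩ := exists_nat_ge ((b - a) / h)
    rw [div_le_iff₀ hpos] at hN
    refine ⟨w (N + 1), hwc _, ?_, ?_, ?_⟩
    · rw [hw1]; exact hΦlip h _ (hwc N)
    · have : π (a - h) = a := by
        simp only [hπ]
        exact max_eq_left ((min_le_right _ _).trans (by linarith))
      rw [hw1]
      simp [hΦ, this]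
    · intro s hs
      have heq : w (N + 1) s = y₀ + ∫ r in a..π (s - h), F r (w (N + 1) r) := by
        rw [he N s]
        congr 1
        refine intervalIntegral.integral_congr fun r hr => ?_
        rw [uIcc_of_le (hπmem _).1] at hr
        simp only [hstab N r (by linarith [hr.2, (hπmem (s - h)).2])]
      rw [heq, add_sub_add_left_eq_sub, intervalIntegral.integral_interval_sub_left
        (hint' _ (hwc _) a haI _ (hπmem _)) (hint' _ (hwc _) a haI s hs)]
      refine (hbd _ _ hs _ (hπmem _)).trans ?_
      gcongr
      have := hπlip (s - h) s
      rw [hπid s hs] at this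
      simpa [abs_of_pos hpos] using this
  choose z hzc hzlip hza hzerr using hfix
  have : CompactSpace (Icc a b) := isCompact_iff_compactSpace.1 isCompact_Icc
  -- The approximations share the Lipschitz constant `c` and the value at `a`, so Arzelà–Ascoli
  -- gives a convergent subsequence; dominated convergence handles the integral.
  set A : Set (BoundedContinuousFunction (Icc a b) (StateSpace n)) :=
    {u | (∀ s t, ‖u s - u t‖ ≤ c * |(s : ℝ) - t|) ∧ u ⟨a, haI⟩ = y₀} with hA
  have hAc : IsCompact A := by
    refine BoundedContinuousFunction.arzela_ascoli₂ (Metric.closedBall y₀ (c * (b - a)))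
      (isCompact_closedBall _ _) A ?_ ?_ ?_
    · have hev : ∀ s, Continuous fun u : BoundedContinuousFunction (Icc a b) (StateSpace n) => u s :=
        fun s => continuous_eval_const _
      rw [hA, ofPred_and]
      refine IsClosed.inter ?_ (isClosed_eq (hev _) continuous_const)
      simp only [ofPred_forall]
      exact isClosed_iInter fun s => isClosed_iInter fun t =>
        isClosed_le ((hev s).sub (hev t)).norm continuous_const
    · intro u s hu
      rw [mem_closedBall_iff_norm, ← hu.2]
      refine (hu.1 _ _).trans ?_
      gcongr
      rw [abs_of_nonneg (by linarith [s.2.1] : (0 : ℝ) ≤ (s : ℝ) - (⟨a, haI⟩ : Icc a b))]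
      have := s.2.2
      simp only
      linarith
    · refine (LipschitzWith.uniformEquicontinuous _ c.toNNReal fun u => ?_).equicontinuous
      refine LipschitzWith.of_dist_le_mul fun s t => ?_
      rw [dist_eq_norm, Real.coe_toNNReal _ hc, Subtype.dist_eq, Real.dist_eq]
      exact u.2.1 s t
  set u : ℕ → BoundedContinuousFunction (Icc a b) (StateSpace n) := fun k =>
    BoundedContinuousFunction.mkOfCompact ⟨fun s => z k s, (hzc k).comp continuous_subtype_val⟩
    with hu
  have huA : ∀ k, u k ∈ A := fun k => ⟨fun s t => hzlip k s t, hza k⟩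
  obtain ⟨v, hv, ψ, hψ, hlim⟩ := hAc.tendsto_subseq huA
  have hpt : ∀ t ∈ Icc a b, Filter.Tendsto (fun k => z (ψ k) t) Filter.atTop
      (nhds (v ⟨π t, hπmem t⟩)) := by
    intro t ht
    have : Continuous fun u : BoundedContinuousFunction (Icc a b) (StateSpace n) =>
      u ⟨π t, hπmem t⟩ := continuous_eval_const _
    refine ((this.tendsto v).comp hlim).congr fun k => ?_
    simp [hu, hπid t ht]
  have hπc : Continuous π := continuous_const.max (continuous_const.min continuous_id)
  set y : ℝ → StateSpace n := fun t => v ⟨π t, hπmem t⟩ with hy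
  have hyc : Continuous y := v.continuous.comp (hπc.subtype_mk _)
  refine ⟨y, hyc, ?_, hint y hyc, ?_⟩
  · simp only [hy, hπid a haI]; exact hv.2
  · intro s hs
    have h1 : Filter.Tendsto (fun k => y₀ + ∫ t in a..s, F t (z (ψ k) t)) Filter.atTop
        (nhds (y₀ + ∫ t in a..s, F t (y t))) := by
      refine Filter.Tendsto.const_add _ ?_
      refine intervalIntegral.tendsto_integral_filter_of_dominated_convergence (fun _ => c)
        (Filter.Eventually.of_forall fun k => ?_) (Filter.Eventually.of_forall fun k => ?_)
        intervalIntegrable_const ?_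
      · exact (intervalIntegrable_iff.1 (hint' _ (hzc _) a haI s hs)).aestronglyMeasurable
      · exact Filter.Eventually.of_forall fun t ht =>
          hF t (uIcc_subset_Icc haI hs (uIoc_subset_uIcc ht)) _
      · refine Filter.Eventually.of_forall fun t ht => ?_
        have htI := uIcc_subset_Icc haI hs (uIoc_subset_uIcc ht)
        exact ((hcont t htI).tendsto _).comp (hpt t htI)
    have h2 := (hpt s hs).sub h1
    have h3 : Filter.Tendsto (fun k => z (ψ k) s - (y₀ + ∫ t in a..s, F t (z (ψ k) t)))
        Filter.atTop (nhds 0) := by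
      refine squeeze_zero_norm (fun k => hzerr (ψ k) s hs) ?_
      have := (tendsto_one_div_add_atTop_nhds_zero_nat (𝕜 := ℝ)).comp hψ.tendsto_atTop
      simpa using this.const_mul c
    exact sub_eq_zero.1 (tendsto_nhds_unique h2 h3)

/-- Superposition: a drift that is measurable in time and continuous in the state is measurable
along continuous curves. -/
theorem CaratheodoryDrift.aestronglyMeasurable_comp {n : ℕ} {D : Set (StateSpace n)}
    {g : ℝ → StateSpace n → StateSpace n} (hg : CaratheodoryDrift D g) {z : ℝ → StateSpace n}
    (hz : Continuous z) (hzD : ∀ t, z t ∈ D) :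
    AEStronglyMeasurable (fun t => g t (z t)) (volume.restrict (Ici 0)) := by
  refine AEMeasurable.aestronglyMeasurable ?_
  -- Freezing the curve on the grid of mesh `1 / (k + 1)` leaves countably many measurable functions
  -- of time, selected by a measurable floor. Continuity in the state gives the pointwise limit.
  have key : ∀ k : ℕ, AEMeasurable
      (fun t => g t (z (⌊((k : ℝ) + 1) * t⌋₊ / ((k : ℝ) + 1)))) (volume.restrict (Ici 0)) := by
    intro k
    have hm : ∀ i : ℕ, AEMeasurable (fun t => g t (z (i / ((k : ℝ) + 1))))
        (volume.restrict (Ici 0)) := fun i => hg.measurable_time _ (hzD _)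
    choose G hGm hG using hm
    have h1 : Measurable (Function.uncurry G) := measurable_from_prod_countable_right hGm
    have h2 : Measurable fun t : ℝ => (⌊((k : ℝ) + 1) * t⌋₊, t) :=
      (Nat.measurable_floor.comp (measurable_const_mul _)).prodMk measurable_id
    refine ⟨fun t => G ⌊((k : ℝ) + 1) * t⌋₊ t, h1.comp h2, ?_⟩
    filter_upwards [ae_all_iff.2 hG] with t ht using ht _
  refine aemeasurable_of_tendsto_metrizable_ae' key ?_
  rw [ae_restrict_iff' measurableSet_Ici]
  refine Filter.Eventually.of_forall fun t ht => ?_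
  have ht0 : 0 ≤ t := ht
  have hlim : Filter.Tendsto (fun k : ℕ => (⌊((k : ℝ) + 1) * t⌋₊ : ℝ) / ((k : ℝ) + 1))
      Filter.atTop (nhds t) := by
    have h1 := (tendsto_nat_floor_mul_div_atTop ht0).comp
      (tendsto_natCast_atTop_atTop (R := ℝ) |>.comp (Filter.tendsto_add_atTop_nat 1))
    refine h1.congr fun k => ?_
    simp [mul_comm t]
  have h2 := (hg.continuous_state t ht0).continuousWithinAt (hzD t)
  refine h2.tendsto.comp (tendsto_nhdsWithin_iff.2 ⟨(hz.tendsto t).comp hlim, ?_⟩)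
  exact Filter.Eventually.of_forall fun k => hzD _

/-! ### Volterra expansion -/

/-- The derivative of `φ` along the field `X`. -/
noncomputable def dirDeriv {n : ℕ} (X φ : StateSpace n → StateSpace n) (y : StateSpace n) : StateSpace n :=
  fderiv ℝ φ y (X y)

/-- The primitive of `v` that vanishes at `0`. -/
noncomputable def primitive (v : ℝ → ℝ) (s : ℝ) : ℝ := ∫ r in (0 : ℝ)..s, v r

theorem Continuous.primitive {v : ℝ → ℝ} (hv : Continuous v) : Continuous (primitive v) :=
  intervalIntegral.continuous_primitive (fun a b => hv.intervalIntegrable a b) 0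

theorem norm_integral_smul_sub_le {n : ℕ} {v : ℝ → ℝ} {ψ χ : ℝ → StateSpace n} {U C : ℝ}
    (hv : Continuous v) (hU : ∀ r ∈ Icc (0 : ℝ) 1, |v r| ≤ U)
    (hψ : ContinuousOn ψ (Icc 0 1)) (hχ : ContinuousOn χ (Icc 0 1))
    (h : ∀ r ∈ Icc (0 : ℝ) 1, ‖ψ r - χ r‖ ≤ C) {s : ℝ} (hs : s ∈ Icc (0 : ℝ) 1) :
    ‖(∫ r in (0 : ℝ)..s, v r • ψ r) - ∫ r in (0 : ℝ)..s, v r • χ r‖ ≤ U * C := by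
  have hU0 : 0 ≤ U := (abs_nonneg _).trans (hU 0 (by simp))
  have hC0 : 0 ≤ C := (norm_nonneg _).trans (h 0 (by simp))
  have hsub : uIcc 0 s ⊆ Icc (0 : ℝ) 1 := by
    rw [uIcc_of_le hs.1]; exact Icc_subset_Icc_right hs.2
  rw [← intervalIntegral.integral_sub
    (ContinuousOn.intervalIntegrable (u := fun r => v r • ψ r) (hv.continuousOn.smul (hψ.mono hsub)))
    (ContinuousOn.intervalIntegrable (u := fun r => v r • χ r) (hv.continuousOn.smul (hχ.mono hsub)))]
  have := intervalIntegral.norm_integral_le_of_norm_le_const (a := 0) (b := s) (C := U * C)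
    (f := fun r => v r • ψ r - v r • χ r) fun r hr => by
      have hr' := hsub (uIoc_subset_uIcc hr)
      rw [← smul_sub, norm_smul]
      exact mul_le_mul (hU r hr') (h r hr') (norm_nonneg _) hU0
  refine this.trans ?_
  rw [sub_zero, abs_of_nonneg hs.1]
  exact mul_le_of_le_one_right (by positivity) hs.2

section Expansion

variable {n : ℕ} {P : Type*} [Fintype P]

/-- The chain rule along the full velocity, with only the drift part dropped. Used for `X p` and
then for its derivatives along the `X q`, it produces the successive levels of the Volterra series.
-/
theorem norm_comp_sub_sub_integral_le {X : P → StateSpace n → StateSpace n}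
    {v : P → ℝ → ℝ} {z G : ℝ → StateSpace n} {K : Set (StateSpace n)} {B M c : ℝ}
    (hK : Convex ℝ K) (hv : ∀ p, Continuous (v p)) 
    (hG : ∀ r ∈ Icc (0 : ℝ) 1, ‖G r‖ ≤ M)
    (hc0 : 0 ≤ c) (hc : ∀ r ∈ Icc (0 : ℝ) 1, ‖G r + ∑ p, v p r • X p (z r)‖ ≤ c)
    (hzK : ∀ s ∈ Icc (0 : ℝ) 1, z s ∈ K) (hzc : ContinuousOn z (Icc 0 1))
    (hint : IntervalIntegrable (fun r => G r + ∑ p, v p r • X p (z r)) volume 0 1)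
    (hz : ∀ s ∈ Icc (0 : ℝ) 1, z s = z 0 + ∫ r in (0 : ℝ)..s, (G r + ∑ p, v p r • X p (z r)))
    {φ : StateSpace n → StateSpace n} (hφd : ∀ y ∈ K, DifferentiableAt ℝ φ y)
    (hφB : ∀ y ∈ K, ‖fderiv ℝ φ y‖ ≤ B) (hφc : ∀ p, ContinuousOn (dirDeriv (X p) φ) K)
    {s : ℝ} (hs : s ∈ Icc (0 : ℝ) 1) :
    ‖φ (z s) - (φ (z 0) + ∑ p, ∫ r in (0 : ℝ)..s, v p r • dirDeriv (X p) φ (z r))‖ ≤ B * M := by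
  have hM0 : 0 ≤ M := (norm_nonneg _).trans (hG 0 (by simp))
  have hB0 : 0 ≤ B := (norm_nonneg _).trans (hφB _ (hzK 0 (by simp)))
  have hsub : Icc 0 s ⊆ Icc (0 : ℝ) 1 := Icc_subset_Icc_right hs.2
  have hL : LipschitzOnWith B.toNNReal φ K :=
    hK.lipschitzOnWith_of_nnnorm_fderiv_le hφd fun y hy => by
      rw [← NNReal.coe_le_coe, Real.coe_toNNReal _ hB0]; exact hφB y hy
  obtain ⟨h1, h2⟩ := comp_sub_eq_integral_fderiv hc0 hs.1 (fun r hr => hc r (hsub hr))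
    (hint.mono_set (by rwa [uIcc_of_le hs.1, uIcc_of_le zero_le_one]))
    (fun r hr => hz r (hsub hr)) (fun r hr => hzK r (hsub hr)) hL hφd
  have h3 : ∀ p ∈ Finset.univ,
      IntervalIntegrable (fun r => v p r • dirDeriv (X p) φ (z r)) volume 0 s := fun p _ => by
    refine ContinuousOn.intervalIntegrable ?_
    rw [uIcc_of_le hs.1]
    exact (hv p).continuousOn.smul ((hφc p).comp (hzc.mono hsub) fun r hr => hzK r (hsub hr))
  rw [← sub_sub, ← h2, ← intervalIntegral.integral_finsetSum h3,
    ← intervalIntegral.integral_sub h1 (by simpa only [Finset.sum_fn] using IntervalIntegrable.sum _ h3)]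
  have := intervalIntegral.norm_integral_le_of_norm_le_const (a := 0) (b := s) (C := B * M)
    (f := fun r => fderiv ℝ φ (z r) (G r + ∑ p, v p r • X p (z r)) -
      ∑ p, v p r • dirDeriv (X p) φ (z r)) fun r hr => by
      rw [uIoc_of_le hs.1] at hr
      have hr' := hsub ⟨hr.1.le, hr.2⟩
      have : fderiv ℝ φ (z r) (G r + ∑ p, v p r • X p (z r)) -
          ∑ p, v p r • dirDeriv (X p) φ (z r) = fderiv ℝ φ (z r) (G r) := by
        simp [dirDeriv, map_sum]
      rw [this]
      exact ((fderiv ℝ φ (z r)).le_opNorm _).trans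
        (mul_le_mul (hφB _ (hzK r hr')) (hG r hr') (norm_nonneg _) hB0)
  refine this.trans ?_
  rw [sub_zero, abs_of_nonneg hs.1]
  exact mul_le_of_le_one_right (by positivity) hs.2

/-- The third-order Volterra expansion of a control-affine system with bounded drift on the unit
time interval. -/
theorem norm_sub_volterra_le {X : P → StateSpace n → StateSpace n}
    {v : P → ℝ → ℝ} {z G : ℝ → StateSpace n} {K : Set (StateSpace n)} {U B M : ℝ}
    (hK : Convex ℝ K) (hv : ∀ p, Continuous (v p)) (hU : ∀ p, ∀ r ∈ Icc (0 : ℝ) 1, |v p r| ≤ U)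
    (hU0 : 0 ≤ U)
    (hG : ∀ r ∈ Icc (0 : ℝ) 1, ‖G r‖ ≤ M)
    (hzK : ∀ s ∈ Icc (0 : ℝ) 1, z s ∈ K) (hzc : ContinuousOn z (Icc 0 1))
    (hint : IntervalIntegrable (fun r => G r + ∑ p, v p r • X p (z r)) volume 0 1)
    (hz : ∀ s ∈ Icc (0 : ℝ) 1, z s = z 0 + ∫ r in (0 : ℝ)..s, (G r + ∑ p, v p r • X p (z r)))
    (hB0 : 0 ≤ B) (hXB : ∀ p, ∀ y ∈ K, ‖X p y‖ ≤ B)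
    (hd1 : ∀ p, ∀ y ∈ K, DifferentiableAt ℝ (X p) y)
    (hB1 : ∀ p, ∀ y ∈ K, ‖fderiv ℝ (X p) y‖ ≤ B)
    (hd2 : ∀ p q, ∀ y ∈ K, DifferentiableAt ℝ (dirDeriv (X q) (X p)) y)
    (hB2 : ∀ p q, ∀ y ∈ K, ‖fderiv ℝ (dirDeriv (X q) (X p)) y‖ ≤ B)
    (hd3 : ∀ p q r, ∀ y ∈ K, DifferentiableAt ℝ (dirDeriv (X r) (dirDeriv (X q) (X p))) y)
    (hB3 : ∀ p q r, ∀ y ∈ K, ‖fderiv ℝ (dirDeriv (X r) (dirDeriv (X q) (X p))) y‖ ≤ B) :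
    ‖z 1 - (z 0 + ∑ p, primitive (v p) 1 • X p (z 0) +
      ∑ p, ∑ q, primitive (v p * primitive (v q)) 1 • dirDeriv (X q) (X p) (z 0) +
      ∑ p, ∑ q, ∑ r, primitive (v p * primitive (v q * primitive (v r))) 1 •
        dirDeriv (X r) (dirDeriv (X q) (X p)) (z 0))‖ ≤
      M + Fintype.card P * (U * (B * M + Fintype.card P * (U * (B * M + Fintype.card P *
        (U * (B * (M + Fintype.card P * (U * B)))))))) := by
  set N : ℝ := (Fintype.card P : ℝ) with hN
  have hM0 : 0 ≤ M := (norm_nonneg _).trans (hG 0 (by simp))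
  set c : ℝ := M + N * (U * B) with hcdef
  have hc0 : 0 ≤ c := by positivity
  have hsum : ∀ {w : P → StateSpace n} {C : ℝ}, (∀ p, ‖w p‖ ≤ C) → ‖∑ p, w p‖ ≤ N * C := by
    intro w C h
    refine (norm_sum_le_of_le _ fun p _ => h p).trans ?_
    simp [hN]
  have hc : ∀ r ∈ Icc (0 : ℝ) 1, ‖G r + ∑ p, v p r • X p (z r)‖ ≤ c := by
    intro r hr
    refine (norm_add_le _ _).trans (add_le_add (hG r hr) (hsum fun p => ?_))
    rw [norm_smul]
    exact mul_le_mul (hU p r hr) (hXB p _ (hzK r hr)) (norm_nonneg _) hU0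
  have hlip : LipschitzOnWith c.toNNReal z (Icc 0 1) :=
    lipschitzOnWith_of_eq_integral hc0 hc hint hz
  have hcomp : ∀ {φ : StateSpace n → StateSpace n}, (∀ y ∈ K, DifferentiableAt ℝ φ y) →
      ContinuousOn (fun s => φ (z s)) (Icc 0 1) := fun {φ} h =>
    ContinuousOn.comp (g := φ) (t := K)
      (fun y hy => (h y hy).continuousAt.continuousWithinAt) hzc hzK
  have hd0 : ∀ {φ : StateSpace n → StateSpace n}, (∀ y ∈ K, DifferentiableAt ℝ φ y) →
      ContinuousOn φ K := fun h y hy => (h y hy).continuousAt.continuousWithinAt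
  have h01 : (1 : ℝ) ∈ Icc (0 : ℝ) 1 := by simp
  have hpc : ∀ {w : ℝ → ℝ}, Continuous w → ∀ e : StateSpace n, ∀ S : Set ℝ,
      ContinuousOn (fun s => primitive w s • e) S := fun hw e S =>
    (hw.primitive.smul continuous_const).continuousOn
  -- the innermost level
  have e3 : ∀ p q r, ∀ s ∈ Icc (0 : ℝ) 1,
      ‖dirDeriv (X r) (dirDeriv (X q) (X p)) (z s) - dirDeriv (X r) (dirDeriv (X q) (X p)) (z 0)‖
        ≤ B * c := by
    intro p q r s hs
    refine (hK.norm_image_sub_le_of_norm_fderiv_le (hd3 p q r) (hB3 p q r)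
      (hzK 0 (by simp)) (hzK s hs)).trans ?_
    gcongr
    have := hlip.dist_le_mul s hs 0 (by simp)
    rw [dist_eq_norm, Real.coe_toNNReal _ hc0, Real.dist_eq, sub_zero, abs_of_nonneg hs.1] at this
    exact this.trans (mul_le_of_le_one_right hc0 hs.2)
  -- `A2`, and `A1` below, are truncated expansions along `z` of the second- and first-level fields.
  -- Inserting one level into the next multiplies the error by `N * U` and adds a drift error `B *
  -- M`.
  set A2 : P → P → ℝ → StateSpace n := fun p q s => dirDeriv (X q) (X p) (z 0) +
    ∑ r, primitive (v r) s • dirDeriv (X r) (dirDeriv (X q) (X p)) (z 0) with hA2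
  have hA2c : ∀ p q, ContinuousOn (A2 p q) (Icc 0 1) := fun p q =>
    continuousOn_const.add (continuousOn_finsetSum _ fun r _ => hpc (hv r) _ _)
  have e2 : ∀ p q, ∀ s ∈ Icc (0 : ℝ) 1, ‖dirDeriv (X q) (X p) (z s) - A2 p q s‖ ≤
      B * M + N * (U * (B * c)) := by
    intro p q s hs
    have h1 := norm_comp_sub_sub_integral_le hK hv hG hc0 hc hzK hzc hint hz (hd2 p q) (hB2 p q)
      (fun r => hd0 (hd3 p q r)) hs
    have h2 : ‖∑ r, (∫ t in (0 : ℝ)..s, v r t • dirDeriv (X r) (dirDeriv (X q) (X p)) (z t)) -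
        ∑ r, primitive (v r) s • dirDeriv (X r) (dirDeriv (X q) (X p)) (z 0)‖
        ≤ N * (U * (B * c)) := by
      rw [← Finset.sum_sub_distrib]
      refine hsum fun r => ?_
      have := norm_integral_smul_sub_le (hv r) (hU r) (hcomp (hd3 p q r)) continuousOn_const
        (e3 p q r) hs
      rwa [intervalIntegral.integral_smul_const] at this
    refine le_trans (le_of_eq ?_) ((norm_add_le _ _).trans (add_le_add h1 h2))
    congr 1
    simp only [hA2]
    abel
  set A1 : P → ℝ → StateSpace n := fun p s => X p (z 0) +
    ∑ q, (primitive (v q) s • dirDeriv (X q) (X p) (z 0) +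
      ∑ r, primitive (v q * primitive (v r)) s •
        dirDeriv (X r) (dirDeriv (X q) (X p)) (z 0)) with hA1
  have hvv : ∀ q r, Continuous (v q * primitive (v r)) := fun q r => (hv q).mul (hv r).primitive
  have hA1c : ∀ p, ContinuousOn (A1 p) (Icc 0 1) := fun p =>
    continuousOn_const.add (continuousOn_finsetSum _ fun q _ => (hpc (hv q) _ _).add
      (continuousOn_finsetSum _ fun r _ => hpc (hvv q r) _ _))
  have i2 : ∀ p q s, ∫ t in (0 : ℝ)..s, v q t • A2 p q t =
      primitive (v q) s • dirDeriv (X q) (X p) (z 0) +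
      ∑ r, primitive (v q * primitive (v r)) s •
        dirDeriv (X r) (dirDeriv (X q) (X p)) (z 0) := by
    intro p q s
    have hc1 : Continuous fun t => v q t • dirDeriv (X q) (X p) (z 0) :=
      (hv q).smul continuous_const
    have hc2 : ∀ r, Continuous fun t => (v q t * primitive (v r) t) •
        dirDeriv (X r) (dirDeriv (X q) (X p)) (z 0) := fun r => (hvv q r).smul continuous_const
    simp only [hA2, smul_add, Finset.smul_sum, smul_smul]
    rw [intervalIntegral.integral_add (hc1.intervalIntegrable _ _)
      ((continuous_finsetSum _ fun r _ => hc2 r).intervalIntegrable _ _),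
      intervalIntegral.integral_finsetSum fun r _ => (hc2 r).intervalIntegrable _ _]
    simp only [intervalIntegral.integral_smul_const]
    rfl
  have e1 : ∀ p, ∀ s ∈ Icc (0 : ℝ) 1, ‖X p (z s) - A1 p s‖ ≤
      B * M + N * (U * (B * M + N * (U * (B * c)))) := by
    intro p s hs
    have h1 := norm_comp_sub_sub_integral_le hK hv hG hc0 hc hzK hzc hint hz (hd1 p) (hB1 p)
      (fun r => hd0 (hd2 p r)) hs
    have h2 : ‖∑ q, (∫ t in (0 : ℝ)..s, v q t • dirDeriv (X q) (X p) (z t)) -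
        ∑ q, (primitive (v q) s • dirDeriv (X q) (X p) (z 0) +
      ∑ r, primitive (v q * primitive (v r)) s •
        dirDeriv (X r) (dirDeriv (X q) (X p)) (z 0))‖
        ≤ N * (U * (B * M + N * (U * (B * c)))) := by
      rw [← Finset.sum_sub_distrib]
      refine hsum fun q => ?_
      rw [← i2]
      exact norm_integral_smul_sub_le (hv q) (hU q) (hcomp (hd2 p q)) (hA2c p q) (e2 p q) hs
    refine le_trans (le_of_eq ?_) ((norm_add_le _ _).trans (add_le_add h1 h2))
    congr 1
    simp only [hA1]
    abel
  have hvvv : ∀ p q r, Continuous (v p * primitive (v q * primitive (v r))) :=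
    fun p q r => (hv p).mul (hvv q r).primitive
  have i1 : ∀ p s, ∫ t in (0 : ℝ)..s, v p t • A1 p t =
      primitive (v p) s • X p (z 0) +
      (∑ q, primitive (v p * primitive (v q)) s • dirDeriv (X q) (X p) (z 0) +
      ∑ q, ∑ r, primitive (v p * primitive (v q * primitive (v r))) s •
        dirDeriv (X r) (dirDeriv (X q) (X p)) (z 0)) := by
    intro p s
    have hc0 : Continuous fun t => v p t • X p (z 0) := (hv p).smul continuous_const
    have hc1 : ∀ q, Continuous fun t => (v p t * primitive (v q) t) •
        dirDeriv (X q) (X p) (z 0) := fun q => (hvv p q).smul continuous_const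
    have hc2 : ∀ q r, Continuous fun t => (v p t * primitive (v q * primitive (v r)) t) •
        dirDeriv (X r) (dirDeriv (X q) (X p)) (z 0) := fun q r =>
      (hvvv p q r).smul continuous_const
    simp only [hA1, smul_add, Finset.smul_sum, smul_smul, Finset.sum_add_distrib]
    rw [intervalIntegral.integral_add (hc0.intervalIntegrable _ _)
      (((continuous_finsetSum _ fun q _ => hc1 q).intervalIntegrable _ _).add
        ((continuous_finsetSum _ fun q _ =>
          continuous_finsetSum _ fun r _ => hc2 q r).intervalIntegrable _ _)),
      intervalIntegral.integral_add
        ((continuous_finsetSum _ fun q _ => hc1 q).intervalIntegrable _ _)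
        ((continuous_finsetSum _ fun q _ =>
        continuous_finsetSum _ fun r _ => hc2 q r).intervalIntegrable _ _),
      intervalIntegral.integral_finsetSum fun q _ => (hc1 q).intervalIntegrable _ _,
      intervalIntegral.integral_finsetSum fun q _ =>
        (continuous_finsetSum _ fun r _ => hc2 q r).intervalIntegrable _ _]
    simp only [intervalIntegral.integral_finsetSum fun r _ => (hc2 _ r).intervalIntegrable _ _,
      intervalIntegral.integral_smul_const]
    rfl
  -- the outermost level
  have hXc : ∀ p, ContinuousOn (fun r => v p r • X p (z r)) (Icc 0 1) := fun p =>
    (hv p).continuousOn.smul (hcomp (hd1 p))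
  have hXi : ∀ p ∈ Finset.univ, IntervalIntegrable (fun r => v p r • X p (z r)) volume 0 1 :=
    fun p _ => ContinuousOn.intervalIntegrable (by rw [uIcc_of_le zero_le_one]; exact hXc p)
  have h1 : ‖z 1 - (z 0 + ∑ p, ∫ t in (0 : ℝ)..1, v p t • X p (z t))‖ ≤ M := by
    rw [hz 1 h01, add_sub_add_left_eq_sub, ← intervalIntegral.integral_finsetSum hXi,
      ← intervalIntegral.integral_sub hint (by simpa only [Finset.sum_fn] using IntervalIntegrable.sum _ hXi)]
    have := intervalIntegral.norm_integral_le_of_norm_le_const (a := 0) (b := 1) (C := M)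
      (f := fun r => (G r + ∑ p, v p r • X p (z r)) - ∑ p, v p r • X p (z r)) fun r hr => by
        rw [uIoc_of_le zero_le_one] at hr
        rw [add_sub_cancel_right]
        exact hG r ⟨hr.1.le, hr.2⟩
    simpa using this
  have h2 : ‖∑ p, (∫ t in (0 : ℝ)..1, v p t • X p (z t)) -
      ∑ p, ∫ t in (0 : ℝ)..1, v p t • A1 p t‖ ≤
      N * (U * (B * M + N * (U * (B * M + N * (U * (B * c)))))) := by
    rw [← Finset.sum_sub_distrib]
    exact hsum fun p =>
      norm_integral_smul_sub_le (hv p) (hU p) (hcomp (hd1 p)) (hA1c p) (e1 p) h01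
  refine le_trans (le_of_eq ?_) ((norm_add_le _ _).trans (add_le_add h1 h2))
  congr 1
  simp only [i1, Finset.sum_add_distrib]
  abel

end Expansion

/-! ### Iterated integrals of cosine waves over a period -/

/-- The cosine wave with frequency `k` and phase `φ` on the unit interval. -/
noncomputable def wave (k : ℤ) (φ t : ℝ) : ℝ := Real.cos (2 * Real.pi * k * t + φ)

@[fun_prop]
theorem continuous_wave (k : ℤ) (φ : ℝ) : Continuous (wave k φ) := by
  unfold wave; fun_prop

theorem abs_wave_le (k : ℤ) (φ t : ℝ) : |wave k φ t| ≤ 1 := Real.abs_cos_le_one _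

theorem primitive_wave {k : ℤ} (hk : k ≠ 0) (φ s : ℝ) :
    primitive (wave k φ) s =
      (Real.sin (2 * Real.pi * k * s + φ) - Real.sin φ) / (2 * Real.pi * k) := by
  have hc : 2 * Real.pi * (k : ℝ) ≠ 0 := by
    have : (k : ℝ) ≠ 0 := by exact_mod_cast hk
    have := Real.pi_ne_zero
    positivity
  unfold primitive wave
  have := intervalIntegral.integral_comp_mul_add (a := 0) (b := s) Real.cos hc φ
  rw [this, integral_cos, smul_eq_mul]
  simp
  ring

theorem primitive_wave_one (k : ℤ) (φ : ℝ) :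
    primitive (wave k φ) 1 = if k = 0 then Real.cos φ else 0 := by
  split_ifs with h
  · subst h; simp [primitive, wave]
  · have := Real.sin_add_int_mul_two_pi φ k
    rw [primitive_wave h, div_eq_zero_iff]
    left
    rw [← this, sub_eq_zero]
    ring_nf

/-- Product-to-sum leaves waves of frequency `k + l`, `l - k` and `k`, and only frequency zero has a
mean. So a cosine-sine pair generates a bracket, while waves in phase generate nothing. -/
theorem primitive_wave_mul_primitive_wave_one {k l : ℤ} (hk : 0 < k) (hl : 0 < l) (φ ψ : ℝ) :
    primitive (wave k φ * primitive (wave l ψ)) 1 =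
      (if k = l then Real.sin (ψ - φ) else 0) / (4 * Real.pi * l) := by
  have e : wave k φ * primitive (wave l ψ) = fun t => 1 / (4 * Real.pi * l) *
      (wave (k + l) (φ + ψ - Real.pi / 2) t + wave (l - k) (ψ - φ - Real.pi / 2) t -
        2 * Real.sin ψ * wave k φ t) := by
    have hl' : (l : ℝ) ≠ 0 := by exact_mod_cast hl.ne'
    funext t
    simp only [Pi.mul_apply, primitive_wave hl.ne', wave]
    have h1 : Real.cos (2 * Real.pi * ((k + l : ℤ) : ℝ) * t + (φ + ψ - Real.pi / 2)) =
        Real.sin ((2 * Real.pi * k * t + φ) + (2 * Real.pi * l * t + ψ)) := by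
      rw [← Real.cos_sub_pi_div_two]; push_cast; ring_nf
    have h2 : Real.cos (2 * Real.pi * ((l - k : ℤ) : ℝ) * t + (ψ - φ - Real.pi / 2)) =
        Real.sin ((2 * Real.pi * l * t + ψ) - (2 * Real.pi * k * t + φ)) := by
      rw [← Real.cos_sub_pi_div_two]; push_cast; ring_nf
    rw [h1, h2]
    generalize 2 * Real.pi * (k : ℝ) * t + φ = A
    generalize 2 * Real.pi * (l : ℝ) * t + ψ = B
    rw [Real.sin_add, Real.sin_sub]
    field_simp
    ring
  have h : ∀ k φ, IntervalIntegrable (wave k φ) volume 0 1 := fun k φ =>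
    (continuous_wave k φ).intervalIntegrable _ _
  have h1 := primitive_wave_one (k + l) (φ + ψ - Real.pi / 2)
  have h2 := primitive_wave_one (l - k) (ψ - φ - Real.pi / 2)
  have h3 := primitive_wave_one k φ
  unfold primitive at h1 h2 h3
  rw [e, primitive, intervalIntegral.integral_const_mul,
    intervalIntegral.integral_sub ((h _ _).add (h _ _)) ((h _ _).const_mul _),
    intervalIntegral.integral_add (h _ _) (h _ _), intervalIntegral.integral_const_mul, h1, h2, h3,
    if_neg (by omega), if_neg (by omega : k ≠ 0), Real.cos_sub_pi_div_two]
  by_cases hkl : k = l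
  · subst hkl; simp; ring
  · rw [if_neg (by omega), if_neg hkl]; simp

/-- Integration by parts leaves the mean of a wave times two primitives of waves; products of three
oscillating factors have a mean only at a resonance. The primitives also carry the constants `sin φ`
and `sin χ`, whose cofactors are double integrals that vanish by the phase hypotheses. -/
theorem primitive_wave_mul_primitive_wave_mul_primitive_wave_one {k l m : ℤ} (hk : 0 < k)
    (hl : 0 < l) (hm : 0 < m) {φ ψ χ : ℝ} (h₁ : k = l → φ = ψ) (h₂ : l = m → ψ = χ) :
    primitive (wave k φ * primitive (wave l ψ * primitive (wave m χ))) 1 =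
      -(1 / (16 * Real.pi ^ 2 * k * m) *
        ((if k + l = m then Real.cos (φ + ψ - χ) else 0) +
          (if l + m = k then Real.cos (φ - ψ - χ) else 0) -
          if k + m = l then Real.cos (φ - ψ + χ) else 0)) := by
  have hk' : (k : ℝ) ≠ 0 := by exact_mod_cast hk.ne'
  have hm' : (m : ℝ) ≠ 0 := by exact_mod_cast hm.ne'
  have hcont : Continuous (wave l ψ * primitive (wave m χ)) :=
    (continuous_wave l ψ).mul (continuous_wave m χ).primitive
  have hder : ∀ {v : ℝ → ℝ}, Continuous v → ∀ t, HasDerivAt (primitive v) (v t) t := fun hv t =>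
    intervalIntegral.integral_hasDerivAt_right (hv.intervalIntegrable _ _)
      (hv.stronglyMeasurableAtFilter _ _) hv.continuousAt
  -- No boundary terms remain: the primitive of the wave of frequency `k` vanishes at both ends of
  -- the period.
  have parts := intervalIntegral.integral_mul_deriv_eq_deriv_mul (a := 0) (b := 1)
    (fun t _ => hder hcont t) (fun t _ => hder (continuous_wave k φ) t)
    (hcont.intervalIntegrable _ _) ((continuous_wave k φ).intervalIntegrable _ _)
  have hcomm : primitive (wave k φ * primitive (wave l ψ * primitive (wave m χ))) 1 =
      ∫ t in (0 : ℝ)..1, primitive (wave l ψ * primitive (wave m χ)) t * wave k φ t := by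
    unfold primitive
    simp only [Pi.mul_apply, mul_comm]
  have hzero : ∀ v, primitive v 0 = 0 := fun v => by simp [primitive]
  rw [hcomm, parts, primitive_wave_one k φ, if_neg hk.ne', hzero, hzero, mul_zero, mul_zero,
    sub_zero, zero_sub]
  have e : ∀ t, (wave l ψ * primitive (wave m χ)) t * primitive (wave k φ) t =
      1 / (16 * Real.pi ^ 2 * k * m) *
        (wave (k + l - m) (φ + ψ - χ) t + wave (k - (l + m)) (φ - ψ - χ) t -
          wave (k + l + m) (φ + ψ + χ) t - wave (k + m - l) (φ - ψ + χ) t) -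
      Real.sin φ / (2 * Real.pi * k) * (wave l ψ * primitive (wave m χ)) t -
      Real.sin χ / (2 * Real.pi * m) * ((wave l ψ * primitive (wave k φ)) t +
        Real.sin φ / (2 * Real.pi * k) * wave l ψ t)
       := by
    intro t
    simp only [Pi.mul_apply, primitive_wave hm.ne', primitive_wave hk.ne', wave]
    push_cast
    set A := 2 * Real.pi * k * t + φ with hA
    set B := 2 * Real.pi * l * t + ψ with hB
    set C := 2 * Real.pi * m * t + χ with hC
    have h1 : 2 * Real.pi * ((k : ℝ) + l - m) * t + (φ + ψ - χ) = A + B - C := by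
      rw [hA, hB, hC]; ring
    have h2 : 2 * Real.pi * ((k : ℝ) - (l + m)) * t + (φ - ψ - χ) = A - B - C := by
      rw [hA, hB, hC]; ring
    have h3 : 2 * Real.pi * ((k : ℝ) + l + m) * t + (φ + ψ + χ) = A + B + C := by
      rw [hA, hB, hC]; ring
    have h4 : 2 * Real.pi * ((k : ℝ) + m - l) * t + (φ - ψ + χ) = A - B + C := by
      rw [hA, hB, hC]; ring
    rw [h1, h2, h3, h4]
    simp only [Real.cos_add, Real.cos_sub, Real.sin_add, Real.sin_sub]
    field_simp
    ring
  have hw : ∀ k φ, IntervalIntegrable (wave k φ) volume 0 1 := fun k φ =>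
    (continuous_wave k φ).intervalIntegrable _ _
  have hwp : ∀ k φ, IntervalIntegrable (wave l ψ * primitive (wave k φ)) volume 0 1 := fun k φ =>
    ((continuous_wave l ψ).mul (continuous_wave k φ).primitive).intervalIntegrable _ _
  have i1 := primitive_wave_one (k + l - m) (φ + ψ - χ)
  have i2 := primitive_wave_one (k - (l + m)) (φ - ψ - χ)
  have i3 := primitive_wave_one (k + l + m) (φ + ψ + χ)
  have i4 := primitive_wave_one (k + m - l) (φ - ψ + χ)
  have i5 := primitive_wave_mul_primitive_wave_one hl hm ψ χ
  have i6 := primitive_wave_mul_primitive_wave_one hl hk ψ φ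
  have i7 := primitive_wave_one l ψ
  have z5 : (if l = m then Real.sin (χ - ψ) else 0) = 0 := by
    split_ifs with h
    · rw [h₂ h, sub_self, Real.sin_zero]
    · rfl
  have z6 : (if l = k then Real.sin (φ - ψ) else 0) = 0 := by
    split_ifs with h
    · rw [h₁ h.symm, sub_self, Real.sin_zero]
    · rfl
  rw [z5, zero_div] at i5
  rw [z6, zero_div] at i6
  rw [if_neg hl.ne'] at i7
  rw [if_neg (by omega)] at i3
  have j5 : ∫ t in (0 : ℝ)..1, (wave l ψ * primitive (wave m χ)) t = 0 := i5
  have j6 : ∫ t in (0 : ℝ)..1, (wave l ψ * primitive (wave k φ)) t = 0 := i6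
  rw [primitive] at i1 i2 i3 i4 i7
  rw [intervalIntegral.integral_congr fun t _ => e t,
    intervalIntegral.integral_sub
      (((((hw _ _).add (hw _ _)).sub (hw _ _)).sub (hw _ _)).const_mul _ |>.sub
        ((hwp _ _).const_mul _)) (((hwp _ _).add ((hw _ _).const_mul _)).const_mul _),
    intervalIntegral.integral_sub
      ((((((hw _ _).add (hw _ _)).sub (hw _ _)).sub (hw _ _)).const_mul _))
        ((hwp _ _).const_mul _),
    intervalIntegral.integral_const_mul, intervalIntegral.integral_const_mul,
    intervalIntegral.integral_const_mul,
    intervalIntegral.integral_sub ((((hw _ _).add (hw _ _)).sub (hw _ _))) (hw _ _),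
    intervalIntegral.integral_sub ((hw _ _).add (hw _ _)) (hw _ _),
    intervalIntegral.integral_add (hw _ _) (hw _ _),
    intervalIntegral.integral_add (hwp _ _) ((hw _ _).const_mul _),
    intervalIntegral.integral_const_mul, i1, i2, i3, i4, i7, j5, j6]
  have c1 : (k + l - m = 0) = (k + l = m) := by rw [sub_eq_zero]
  have c2 : (k - (l + m) = 0) = (l + m = k) := by rw [sub_eq_zero]; exact propext eq_comm
  have c4 : (k + m - l = 0) = (k + m = l) := by rw [sub_eq_zero]
  simp only [c1, c2, c4]
  ring

theorem abs_primitive_le {v : ℝ → ℝ} {C : ℝ} (hC : 0 ≤ C) (h : ∀ t ∈ Icc (0 : ℝ) 1, |v t| ≤ C) :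
    ∀ s ∈ Icc (0 : ℝ) 1, |primitive v s| ≤ C := by
  intro s hs
  have := intervalIntegral.norm_integral_le_of_norm_le_const (a := 0) (b := s) (C := C)
    (f := v) fun r hr => by
      rw [uIoc_of_le hs.1] at hr
      exact h r ⟨hr.1.le, hr.2.trans hs.2⟩
  refine this.trans ?_
  rw [sub_zero, abs_of_nonneg hs.1]
  exact mul_le_of_le_one_right hC hs.2

theorem abs_mul_primitive_le {v w : ℝ → ℝ} {A C : ℝ} (hA : 0 ≤ A) (hC : 0 ≤ C)
    (hv : ∀ t ∈ Icc (0 : ℝ) 1, |v t| ≤ A) (hw : ∀ t ∈ Icc (0 : ℝ) 1, |w t| ≤ C) :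
    ∀ t ∈ Icc (0 : ℝ) 1, |(v * primitive w) t| ≤ A * C := by
  intro t ht
  rw [Pi.mul_apply, abs_mul]
  exact mul_le_mul (hv t ht) (abs_primitive_le hC hw t ht) (abs_nonneg _) hA

theorem primitive_const_mul (c : ℝ) (v : ℝ → ℝ) (s : ℝ) :
    primitive (fun t => c * v t) s = c * primitive v s :=
  intervalIntegral.integral_const_mul _ _

/-! ### Resonances among the third-order frequencies -/

section Resonance

variable {m : ℕ} {S₂ : Finset (Fin m × Fin m)} {S₃ : Finset (Fin m × Fin m × Fin m)}

/-- The positions `(p, q, r)` of the imposed relations `κ_p + κ_q = κ_r`. -/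
def IsSumPosition (p q r : Fin 4) : Prop :=
  (p, q, r) ∈ ({(0, 1, 2), (1, 0, 2), (0, 3, 1), (3, 0, 1)} : Finset (Fin 4 × Fin 4 × Fin 4))

instance (p q r : Fin 4) : Decidable (IsSumPosition p q r) := by
  unfold IsSumPosition; infer_instance

/-- A coincidence of this kind is itself a third-order resonance, hence an imposed relation;
comparing signs identifies the positions. -/
theorem NonResonant.add_eq_iff {κ : ↥S₂ → ℤ} {κ₁ κ₂ : ↥S₃ → ℤ} (h : NonResonant κ κ₁ κ₂)
    (p q r : ↥S₃ × Fin 4) :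
    thirdOrderFreq κ₁ κ₂ p + thirdOrderFreq κ₁ κ₂ q = thirdOrderFreq κ₁ κ₂ r ↔
      q.1 = p.1 ∧ r.1 = p.1 ∧ IsSumPosition p.2 q.2 r.2 := by
  constructor
  · intro hpq
    have hpos : ∀ i, 0 < thirdOrderFreq κ₁ κ₂ i := fun i => h.pos (.inr i)
    have hpr : p ≠ r := by rintro rfl; have := hpos q; omega
    have hqr : q ≠ r := by rintro rfl; have := hpos p; omega
    -- If `p = q` the coefficient there is `2`, and the absolute values still sum to `3`. The entry
    -- `-1` at `r` makes the gcd `1`. Imposed relations have no entry `2`, so this case disappears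
    -- in `pair`.
    set c : ↥S₃ × Fin 4 → ℤ := fun i =>
      (if i = p then 1 else 0) + (if i = q then 1 else 0) - if i = r then 1 else 0 with hc
    have hres : IsResonance 3 (thirdOrderFreq κ₁ κ₂) c := by
      refine ⟨?_, ?_, ?_⟩
      · have h1 : Finset.univ.gcd c ∣ c r := Finset.gcd_dvd (Finset.mem_univ r)
        have h2 : c r = -1 := by simp [hc, hpr.symm, hqr.symm]
        rw [h2] at h1
        have h3 : IsUnit (Finset.univ.gcd c) := isUnit_of_dvd_unit h1 (by decide)
        rw [← Finset.normalize_gcd, normalize_eq_one]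
        exact h3
      · have : ∀ i, |c i| =
            (if i = p then 1 else 0) + (if i = q then 1 else 0) + if i = r then 1 else 0 := by
          intro i
          simp only [hc]
          split_ifs <;> simp_all
        simp [this, Finset.sum_add_distrib]
      · simp [hc, add_mul, sub_mul, Finset.sum_add_distrib, Finset.sum_sub_distrib, hpq]
    obtain ⟨l, hl⟩ := h.noResonance c hres
    have one : ∀ s, c (l, s) = 1 → (l, s) = p ∨ (l, s) = q := by
      intro s h
      by_contra! hne
      simp only [hc, if_neg hne.1, if_neg hne.2] at h
      split_ifs at h <;> omega
    have neg : ∀ s, c (l, s) = -1 → (l, s) = r := by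
      intro s h
      by_contra hne
      simp only [hc, if_neg hne] at h
      split_ifs at h <;> omega
    have two : ∀ s t, s ≠ t → c (l, s) = -1 → c (l, t) = -1 → False := by
      intro s t hst hs ht
      exact hst (Prod.ext_iff.1 ((neg s hs).trans (neg t ht).symm)).2
    have pair : ∀ s t, s ≠ t → c (l, s) = 1 → c (l, t) = 1 →
        (p = (l, s) ∧ q = (l, t)) ∨ (p = (l, t) ∧ q = (l, s)) := by
      intro s t hst hs ht
      have hne : ((l, s) : ↥S₃ × Fin 4) ≠ (l, t) := fun h => hst (Prod.ext_iff.1 h).2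
      rcases one s hs with h | h <;> rcases one t ht with h' | h'
      · exact absurd (h.trans h'.symm) hne
      · exact .inl ⟨h.symm, h'.symm⟩
      · exact .inr ⟨h'.symm, h.symm⟩
      · exact absurd (h.trans h'.symm) hne
    have fin : ∀ s t u, p = (l, s) → q = (l, t) → r = (l, u) → IsSumPosition s t u →
        q.1 = p.1 ∧ r.1 = p.1 ∧ IsSumPosition p.2 q.2 r.2 := by
      rintro s t u rfl rfl rfl h
      exact ⟨rfl, rfl, h⟩
    -- `c` is negative only at `r`, which rules out the two signed relations with two entries `-1`.
    rcases hl with hl | hl | hl | hl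
    · have hr := (neg 2 (by simp [hl, relationAt])).symm
      rcases pair 0 1 (by decide) (by simp [hl, relationAt]) (by simp [hl, relationAt])
        with hp | hp
      · exact fin 0 1 2 hp.1 hp.2 hr (by decide)
      · exact fin 1 0 2 hp.1 hp.2 hr (by decide)
    · exact (two 0 1 (by decide) (by simp [hl, relationAt]) (by simp [hl, relationAt])).elim
    · exact (two 0 3 (by decide) (by simp [hl, relationAt]) (by simp [hl, relationAt])).elim
    · have hr := (neg 1 (by simp [hl, relationAt])).symm
      rcases pair 0 3 (by decide) (by simp [hl, relationAt]) (by simp [hl, relationAt])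
        with hp | hp
      · exact fin 0 3 1 hp.1 hp.2 hr (by decide)
      · exact fin 3 0 1 hp.1 hp.2 hr (by decide)
  · obtain ⟨l, s⟩ := p
    obtain ⟨l', t⟩ := q
    obtain ⟨l'', u⟩ := r
    rintro ⟨rfl, rfl, hs⟩
    simp only [IsSumPosition, Finset.mem_insert, Finset.mem_singleton, Prod.mk.injEq] at hs
    rcases hs with ⟨rfl, rfl, rfl⟩ | ⟨rfl, rfl, rfl⟩ | ⟨rfl, rfl, rfl⟩ | ⟨rfl, rfl, rfl⟩
    all_goals simp [thirdOrderFreq]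
    ring

end Resonance

/-! ### Double brackets as iterated directional derivatives -/

section Brackets

variable {n : ℕ}

theorem dirDeriv_dirDeriv_apply {V W Z : StateSpace n → StateSpace n} {x : StateSpace n}
    (hW : DifferentiableAt ℝ W x) (hZ : DifferentiableAt ℝ (fderiv ℝ Z) x) :
    dirDeriv V (dirDeriv W Z) x =
      fderiv ℝ (fderiv ℝ Z) x (V x) (W x) + fderiv ℝ Z x (fderiv ℝ W x (V x)) := by
  have : fderiv ℝ (dirDeriv W Z) x = _ := fderiv_clm_apply hZ hW
  rw [dirDeriv, this]
  simp [add_comm]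

/-- In the first two terms the second derivative of `Z` cancels by symmetry and leaves `DZ [V, W]`;
the last two give the derivative of `[V, W]` along `Z`. This is the shape in which third-order
Volterra terms occur. -/
theorem lieBracket_lieBracket_eq_dirDeriv {V W Z : StateSpace n → StateSpace n} {x : StateSpace n}
    (hV : ContDiffAt ℝ 2 V x) (hW : ContDiffAt ℝ 2 W x) (hZ : ContDiffAt ℝ 2 Z x) :
    VectorField.lieBracket ℝ (VectorField.lieBracket ℝ V W) Z x =
      dirDeriv V (dirDeriv W Z) x - dirDeriv W (dirDeriv V Z) x -
        dirDeriv Z (dirDeriv V W) x + dirDeriv Z (dirDeriv W V) x := by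
  have d1 : ∀ {F : StateSpace n → StateSpace n}, ContDiffAt ℝ 2 F x → DifferentiableAt ℝ F x :=
    fun h => h.differentiableAt (by norm_num)
  have d2 : ∀ {F : StateSpace n → StateSpace n}, ContDiffAt ℝ 2 F x →
      DifferentiableAt ℝ (fderiv ℝ F) x :=
    fun h => (h.fderiv_right (m := 1) (by norm_num)).differentiableAt (by norm_num)
  have d3 : ∀ {F G : StateSpace n → StateSpace n}, ContDiffAt ℝ 2 F x → ContDiffAt ℝ 2 G x →
      DifferentiableAt ℝ (dirDeriv F G) x := fun hF hG => (d2 hG).clm_apply (d1 hF)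
  have e : fderiv ℝ (VectorField.lieBracket ℝ V W) x =
      fderiv ℝ (dirDeriv V W) x - fderiv ℝ (dirDeriv W V) x :=
    fderiv_fun_sub (d3 hV hW) (d3 hW hV)
  have hs : IsSymmSndFDerivAt ℝ Z x := hZ.isSymmSndFDerivAt (by simp)
  rw [dirDeriv_dirDeriv_apply (d1 hW) (d2 hZ), dirDeriv_dirDeriv_apply (d1 hV) (d2 hZ),
    VectorField.lieBracket, e, hs.eq (V x) (W x)]
  simp only [VectorField.lieBracket, map_sub, dirDeriv, sub_apply]
  abel

end Brackets

/-- Separates the block of main terms, indexed by `Q`, from the negligible iterated integrals. -/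
theorem norm_sum_sub_sum_comp_le {ι Q E : Type*} [Fintype ι] [Fintype Q] [NormedAddCommGroup E]
    {i : Q → ι} (hi : Function.Injective i) {T : ι → E} {e : ℝ} (he : 0 ≤ e)
    (h : ∀ p, p ∉ range i → ‖T p‖ ≤ e) :
    ‖∑ p, T p - ∑ x, T (i x)‖ ≤ Fintype.card ι * e := by
  classical
  have h1 : ∑ x, T (i x) = ∑ p, if p ∈ range i then T p else 0 := by
    rw [← Finset.sum_filter, ← Finset.sum_image (f := T) (s := Finset.univ) (g := i)
      (fun x _ y _ h => hi h)]
    congr 1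
    ext p
    simp
  rw [h1, ← Finset.sum_sub_distrib]
  have hcard : ∑ _p : ι, e = Fintype.card ι * e := by simp
  rw [← hcard]
  refine norm_sum_le_of_le _ fun p _ => ?_
  split_ifs with hp
  · simpa using he
  · simpa using h p hp

/-! ### The feedback as a sum of waves -/

section Atoms

variable {n m : ℕ} {S₁ : Finset (Fin m)} {S₂ : Finset (Fin m × Fin m)}
  {S₃ : Finset (Fin m × Fin m × Fin m)}

/-- The harmonic components of the feedback. -/
abbrev Atom (S₁ : Finset (Fin m)) (S₂ : Finset (Fin m × Fin m))
    (S₃ : Finset (Fin m × Fin m × Fin m)) :=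
  ↥S₁ ⊕ (↥S₂ × Fin 2) ⊕ (↥S₃ × Fin 4)

/-- The field that a component drives. -/
def atomField : Atom S₁ S₂ S₃ → Fin m
  | .inl i => i
  | .inr (.inl x) => ![x.1.1.1, x.1.1.2] x.2
  | .inr (.inr x) => ![x.1.1.1, x.1.1.2.1, x.1.1.2.2, x.1.1.2.2] x.2

/-- The frequency of a component. -/
def atomFreq (κ : ↥S₂ → ℤ) (κ₁ κ₂ : ↥S₃ → ℤ) : Atom S₁ S₂ S₃ → ℤ
  | .inl _ => 0
  | .inr (.inl x) => κ x.1
  | .inr (.inr x) => thirdOrderFreq κ₁ κ₂ x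

/-- The phase of a component. -/
noncomputable def atomPhase : Atom S₁ S₂ S₃ → ℝ
  | .inl _ => 0
  | .inr (.inl x) => ![0, -(Real.pi / 2)] x.2
  | .inr (.inr x) => ![0, -(Real.pi / 2), -(Real.pi / 2), -(Real.pi / 2)] x.2

/-- The order of magnitude of a component over one sampling period, as a power of `ε ^ (1/6)`. -/
def atomOrder : Atom S₁ S₂ S₃ → ℕ
  | .inl _ => 6
  | .inr (.inl _) => 3
  | .inr (.inr _) => 2

/-- The amplitude of a component. -/
noncomputable def atomCoeff (κ : ↥S₂ → ℤ) (κ₁ κ₂ : ↥S₃ → ℤ)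
    (a : EuclideanSpace ℝ (BracketIndex S₁ S₂ S₃)) : Atom S₁ S₂ S₃ → ℝ
  | .inl i => a (.inl i)
  | .inr (.inl x) => √|a (.inr (.inl x.1))| * (2 * √(Real.pi * κ x.1)) *
      ![Real.sign (a (.inr (.inl x.1))), 1] x.2
  | .inr (.inr x) => cbrt (a (.inr (.inr x.1))) *
      (2 * cbrt (2 * Real.pi ^ 2 * ((κ₁ x.1 + κ₂ x.1 : ℤ) : ℝ) * ((κ₂ x.1 - κ₁ x.1 : ℤ) : ℝ))) *
      ![1, 1, 1 / 2, 1 / 2] x.2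

/-- A component of the feedback on the rescaled sampling period, for `θ = ε ^ (1/6)`. -/
noncomputable def atomInput (κ : ↥S₂ → ℤ) (κ₁ κ₂ : ↥S₃ → ℤ)
    (a : EuclideanSpace ℝ (BracketIndex S₁ S₂ S₃)) (θ : ℝ) (p : Atom S₁ S₂ S₃) (t : ℝ) : ℝ :=
  θ ^ atomOrder p * atomCoeff κ κ₁ κ₂ a p * wave (atomFreq κ κ₁ κ₂ p) (atomPhase p) t

theorem continuous_atomInput (κ : ↥S₂ → ℤ) (κ₁ κ₂ : ↥S₃ → ℤ)
    (a : EuclideanSpace ℝ (BracketIndex S₁ S₂ S₃)) (θ : ℝ) (p : Atom S₁ S₂ S₃) :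
    Continuous (atomInput κ κ₁ κ₂ a θ p) := by
  unfold atomInput; fun_prop

/-- Integer frequencies make the period index `j` drop out, so all sampling periods look alike. -/
theorem cos_period (k : ℤ) (ε : ℝ) (hε : ε ≠ 0) (j : ℕ) (s : ℝ) :
    Real.cos (2 * Real.pi * k / ε * (ε * (j + s))) = wave k 0 s := by
  have : 2 * Real.pi * k / ε * (ε * (j + s)) =
      2 * Real.pi * k * s + 0 + ((k * j : ℤ) : ℝ) * (2 * Real.pi) := by
    push_cast; field_simp; ring
  rw [this, Real.cos_add_int_mul_two_pi, wave]

theorem sin_period (k : ℤ) (ε : ℝ) (hε : ε ≠ 0) (j : ℕ) (s : ℝ) :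
    Real.sin (2 * Real.pi * k / ε * (ε * (j + s))) = wave k (-(Real.pi / 2)) s := by
  have : 2 * Real.pi * k / ε * (ε * (j + s)) =
      2 * Real.pi * k * s + ((k * j : ℤ) : ℝ) * (2 * Real.pi) := by
    push_cast; field_simp; ring
  rw [this, Real.sin_add_int_mul_two_pi, wave, ← sub_eq_add_neg, Real.cos_sub_pi_div_two]

/-- The origin of `κ₃` and `κ₄`: the product driving the third field is two half-amplitude waves at
the sum and difference frequencies. -/
theorem wave_mul_wave (k l : ℤ) (s : ℝ) :
    wave k 0 s * wave l (-(Real.pi / 2)) s =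
      1 / 2 * wave (k + l) (-(Real.pi / 2)) s + 1 / 2 * wave (l - k) (-(Real.pi / 2)) s := by
  simp only [wave, ← sub_eq_add_neg, Real.cos_sub_pi_div_two]
  have h1 : 2 * Real.pi * ((k + l : ℤ) : ℝ) * s = 2 * Real.pi * l * s + 2 * Real.pi * k * s := by
    push_cast; ring
  have h2 : 2 * Real.pi * ((l - k : ℤ) : ℝ) * s = 2 * Real.pi * l * s - 2 * Real.pi * k * s := by
    push_cast; ring
  rw [h1, h2, Real.sin_add, Real.sin_sub, add_zero]
  ring

/-- Over a sampling period the feedback is the sum of its harmonic components. -/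
theorem mul_feedback_eq_sum_atomInput (f : Fin m → StateSpace n → StateSpace n) (κ : ↥S₂ → ℤ)
    (κ₁ κ₂ : ↥S₃ → ℤ) (γ : ℝ) {ε θ : ℝ} (hθ : 0 < θ) (hε : ε = θ ^ 6) (j : ℕ) (s : ℝ)
    (w : StateSpace n) (k : Fin m) :
    ε * feedback f S₁ S₂ S₃ κ κ₁ κ₂ γ ε (ε * (j + s)) w k =
      ∑ p, atomInput κ κ₁ κ₂ (coeffVector f S₁ S₂ S₃ γ w) θ p s * kron k (atomField p) := by
  have hε0 : ε ≠ 0 := by rw [hε]; positivity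
  -- Multiplication by the period length turns the singular prefactors into the powers of `θ`
  -- recorded in `atomOrder`.
  have e2 : ε * ε ^ (-(1 / 2 : ℝ)) = θ ^ 3 := by
    rw [hε, ← Real.rpow_natCast, ← Real.rpow_mul hθ.le, ← Real.rpow_add hθ, ← Real.rpow_natCast]
    norm_num
  have e3 : ε * ε ^ (-(2 / 3 : ℝ)) = θ ^ 2 := by
    rw [hε, ← Real.rpow_natCast, ← Real.rpow_mul hθ.le, ← Real.rpow_add hθ, ← Real.rpow_natCast]
    norm_num
  have hdiv : ∀ k : ℤ, 2 * Real.pi * k * (ε * (j + s)) / ε =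
      2 * Real.pi * k / ε * (ε * (j + s)) := fun k => by ring
  set a := coeffVector f S₁ S₂ S₃ γ w with ha
  rw [feedback]
  simp only [← ha, mul_add, ← mul_assoc, e2, e3]
  rw [Fintype.sum_sum_type, Fintype.sum_sum_type, Fintype.sum_prod_type, Fintype.sum_prod_type,
    ← add_assoc]
  congr 1
  · congr 1
    · rw [Finset.mul_sum]
      refine Finset.sum_congr rfl fun i _ => ?_
      simp [atomInput, atomOrder, atomCoeff, atomFreq, atomPhase, atomField, wave, hε, mul_assoc]
    · rw [Finset.mul_sum]
      refine Finset.sum_congr rfl fun i _ => ?_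
      rw [phiTwo, ← mul_add ε, cos_period _ _ hε0, sin_period _ _ hε0]
      simp [atomInput, atomOrder, atomCoeff, atomFreq, atomPhase, atomField]
      ring
  · rw [Finset.mul_sum]
    refine Finset.sum_congr rfl fun l _ => ?_
    rw [phiThree, ← mul_add ε, hdiv, hdiv, cos_period _ _ hε0, sin_period _ _ hε0, wave_mul_wave]
    simp [atomInput, atomOrder, atomCoeff, atomFreq, atomPhase, atomField, Fin.sum_univ_four,
      thirdOrderFreq]
    ring

theorem mul_sum_feedback_smul_eq (f : Fin m → StateSpace n → StateSpace n) (κ : ↥S₂ → ℤ)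
    (κ₁ κ₂ : ↥S₃ → ℤ) (γ : ℝ) {ε θ : ℝ} (hθ : 0 < θ) (hε : ε = θ ^ 6) (j : ℕ) (s : ℝ)
    (w y : StateSpace n) :
    ε • ∑ k, feedback f S₁ S₂ S₃ κ κ₁ κ₂ γ ε (ε * (j + s)) w k • f k y =
      ∑ p, atomInput κ κ₁ κ₂ (coeffVector f S₁ S₂ S₃ γ w) θ p s • f (atomField p) y := by
  simp only [Finset.smul_sum, smul_smul, mul_feedback_eq_sum_atomInput f κ κ₁ κ₂ γ hθ hε,
    Finset.sum_smul]
  rw [Finset.sum_comm]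
  refine Finset.sum_congr rfl fun p _ => ?_
  rw [Finset.sum_eq_single (atomField p)]
  · simp [kron]
  · intro k _ hk; simp [kron, hk]
  · simp

theorem abs_cbrt_pow_three (x : ℝ) : |cbrt x| ^ 3 = |x| := by
  rw [← abs_pow, cbrt_pow_three]

/-- The amplitudes are bounded on bounded sets of coefficient vectors. -/
theorem exists_abs_atomCoeff_le (κ : ↥S₂ → ℤ) (κ₁ κ₂ : ↥S₃ → ℤ) (A : ℝ) :
    ∃ b ≥ 0, ∀ a : EuclideanSpace ℝ (BracketIndex S₁ S₂ S₃), ‖a‖ ≤ A →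
      ∀ p, |atomCoeff κ κ₁ κ₂ a p| ≤ b := by
  rcases lt_or_ge A 0 with hA | hA
  · exact ⟨0, le_rfl, fun a ha => absurd ((norm_nonneg a).trans ha) (not_le.2 hA)⟩
  have hsqrt : ∀ x : ℝ, |x| ≤ A → √|x| ≤ 1 + A := fun x hx => by
    rw [Real.sqrt_le_left (by linarith)]; nlinarith
  have hcbrt : ∀ x : ℝ, |x| ≤ A → |cbrt x| ≤ 1 + A := fun x hx => by
    refine le_of_pow_le_pow_left₀ (n := 3) (by norm_num) (by linarith) ?_
    rw [abs_cbrt_pow_three]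
    nlinarith [pow_nonneg hA 2, pow_nonneg hA 3]
  have hsign : ∀ x : ℝ, |Real.sign x| ≤ 1 := fun x => by
    rcases Real.sign_apply_eq x with h | h | h <;> rw [h] <;> norm_num
  have key : ∀ p : Atom S₁ S₂ S₃, ∃ b ≥ 0, ∀ a : EuclideanSpace ℝ (BracketIndex S₁ S₂ S₃),
      ‖a‖ ≤ A → |atomCoeff κ κ₁ κ₂ a p| ≤ b := by
    have hcoord : ∀ a : EuclideanSpace ℝ (BracketIndex S₁ S₂ S₃), ‖a‖ ≤ A → ∀ i, |a i| ≤ A :=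
      fun a ha i => (PiLp.norm_apply_le a i).trans ha
    rintro (i | x | x)
    · exact ⟨A, hA, fun a ha => hcoord a ha _⟩
    · refine ⟨(1 + A) * (2 * √(Real.pi * κ x.1)) * 1, by positivity, fun a ha => ?_⟩
      simp only [atomCoeff, abs_mul]
      gcongr
      · rw [abs_of_nonneg (Real.sqrt_nonneg _)]; exact hsqrt _ (hcoord a ha _)
      · rw [abs_of_nonneg (by norm_num : (0 : ℝ) ≤ 2)]
      · rw [abs_of_nonneg (Real.sqrt_nonneg _)]
      · obtain ⟨j, s⟩ := x
        fin_cases s <;> simp [hsign]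
    · refine ⟨(1 + A) * |2 * cbrt (2 * Real.pi ^ 2 * ((κ₁ x.1 + κ₂ x.1 : ℤ) : ℝ) *
        ((κ₂ x.1 - κ₁ x.1 : ℤ) : ℝ))| * 1, by positivity, fun a ha => ?_⟩
      simp only [atomCoeff, abs_mul _ (![_, _, _, _] _), abs_mul (cbrt (a _)) _]
      gcongr
      · exact hcbrt _ (hcoord a ha _)
      · obtain ⟨j, s⟩ := x
        fin_cases s <;> norm_num [abs_of_nonneg]
  choose b hb0 hb using key
  exact ⟨∑ p, b p, Finset.sum_nonneg fun p _ => hb0 p, fun a ha p => (hb p a ha).trans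
    (Finset.single_le_sum (fun q _ => hb0 q) (Finset.mem_univ p))⟩

end Atoms

theorem primitive_mul_primitive_const_mul (c d : ℝ) (v w : ℝ → ℝ) (s : ℝ) :
    primitive ((fun t => c * v t) * primitive (fun t => d * w t)) s =
      c * d * primitive (v * primitive w) s := by
  have : (fun t => c * v t) * primitive (fun t => d * w t) =
      fun t => (c * d) * (v * primitive w) t := by
    funext t
    simp only [Pi.mul_apply, primitive_const_mul]
    ring
  rw [this, primitive_const_mul]

theorem primitive_mul_primitive_mul_primitive_const_mul (c d e : ℝ) (u v w : ℝ → ℝ) (s : ℝ) :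
    primitive ((fun t => c * u t) * primitive ((fun t => d * v t) *
      primitive (fun t => e * w t))) s =
      c * d * e * primitive (u * primitive (v * primitive w)) s := by
  have : (fun t => c * u t) * primitive ((fun t => d * v t) * primitive (fun t => e * w t)) =
      fun t => (c * d * e) * (u * primitive (v * primitive w)) t := by
    funext t
    simp only [Pi.mul_apply, primitive_mul_primitive_const_mul]
    ring
  rw [this, primitive_const_mul]

/-! ### Averages of the feedback over a period -/

section Averages

variable {n m : ℕ} {S₁ : Finset (Fin m)} {S₂ : Finset (Fin m × Fin m)}
  {S₃ : Finset (Fin m × Fin m × Fin m)} {κ : ↥S₂ → ℤ} {κ₁ κ₂ : ↥S₃ → ℤ}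
  {a : EuclideanSpace ℝ (BracketIndex S₁ S₂ S₃)} {θ : ℝ}

theorem NonResonant.atomFreq_pos (hκ : NonResonant κ κ₁ κ₂) (x) :
    0 < atomFreq κ κ₁ κ₂ (.inr x : Atom S₁ S₂ S₃) := by
  rcases x with x | x
  · exact hκ.pos (.inl x.1)
  · exact hκ.pos (.inr x)

theorem primitive_atomInput_one (hκ : NonResonant κ κ₁ κ₂) (x) :
    primitive (atomInput κ κ₁ κ₂ a θ (.inr x : Atom S₁ S₂ S₃)) 1 = 0 := by
  have : atomInput κ κ₁ κ₂ a θ (.inr x : Atom S₁ S₂ S₃) = fun t => _ * wave _ _ t := rfl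
  rw [this, primitive_const_mul, primitive_wave_one, if_neg (hκ.atomFreq_pos x).ne', mul_zero]

/-- First-order averages. -/
theorem sum_primitive_atomInput_smul (hκ : NonResonant κ κ₁ κ₂) (Y : Fin m → StateSpace n) :
    ∑ p, primitive (atomInput κ κ₁ κ₂ a θ p) 1 • Y (atomField p) =
      θ ^ 6 • ∑ i : ↥S₁, a (.inl i) • Y i := by
  rw [Fintype.sum_sum_type]
  simp only [primitive_atomInput_one hκ, zero_smul, Finset.sum_const_zero, add_zero,
    Finset.smul_sum, smul_smul]
  refine Finset.sum_congr rfl fun i _ => ?_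
  have : atomInput κ κ₁ κ₂ a θ (.inl i : Atom S₁ S₂ S₃) = fun t => _ * wave _ _ t := rfl
  rw [this, primitive_const_mul, primitive_wave_one]
  simp [atomFreq, atomPhase, atomOrder, atomCoeff, atomField]

theorem primitive_atomInput_mul_one (p q : Atom S₁ S₂ S₃) :
    primitive (atomInput κ κ₁ κ₂ a θ p * primitive (atomInput κ κ₁ κ₂ a θ q)) 1 =
      θ ^ (atomOrder p + atomOrder q) * (atomCoeff κ κ₁ κ₂ a p * atomCoeff κ κ₁ κ₂ a q) *
        primitive (wave (atomFreq κ κ₁ κ₂ p) (atomPhase p) *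
          primitive (wave (atomFreq κ κ₁ κ₂ q) (atomPhase q))) 1 := by
  refine (primitive_mul_primitive_const_mul _ _ _ _ 1).trans ?_
  ring

theorem primitive_atomInput_mul_mul_one (p q r : Atom S₁ S₂ S₃) :
    primitive (atomInput κ κ₁ κ₂ a θ p * primitive (atomInput κ κ₁ κ₂ a θ q *
      primitive (atomInput κ κ₁ κ₂ a θ r))) 1 =
      θ ^ (atomOrder p + atomOrder q + atomOrder r) * (atomCoeff κ κ₁ κ₂ a p *
        atomCoeff κ κ₁ κ₂ a q * atomCoeff κ κ₁ κ₂ a r) *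
        primitive (wave (atomFreq κ κ₁ κ₂ p) (atomPhase p) *
          primitive (wave (atomFreq κ κ₁ κ₂ q) (atomPhase q) *
            primitive (wave (atomFreq κ κ₁ κ₂ r) (atomPhase r)))) 1 := by
  refine (primitive_mul_primitive_mul_primitive_const_mul _ _ _ _ _ _ 1).trans ?_
  ring

theorem mul_sign_abs (x : ℝ) : |x| * Real.sign x = x := by
  rcases lt_trichotomy x 0 with h | rfl | h
  · rw [Real.sign_of_neg h, abs_of_neg h]; ring
  · simp
  · rw [Real.sign_of_pos h, abs_of_pos h]; ring

/-- Second-order averages of the components of order `ε ^ (1/2)`. -/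
theorem sum_sum_primitive_atomInput_smul (hκ : NonResonant κ κ₁ κ₂)
    (Y : Fin m → Fin m → StateSpace n) :
    ∑ x : ↥S₂ × Fin 2, ∑ y : ↥S₂ × Fin 2,
      primitive (atomInput κ κ₁ κ₂ a θ (.inr (.inl x)) *
        primitive (atomInput κ κ₁ κ₂ a θ (.inr (.inl y)))) 1 •
          Y (atomField (.inr (.inl x) : Atom S₁ S₂ S₃)) (atomField (.inr (.inl y) : Atom S₁ S₂ S₃)) =
      θ ^ 6 • ∑ j : ↥S₂, a (.inr (.inl j)) • (Y j.1.2 j.1.1 - Y j.1.1 j.1.2) := by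
  simp only [primitive_atomInput_mul_one, Fintype.sum_prod_type]
  rw [Finset.smul_sum]
  refine Finset.sum_congr rfl fun j _ => ?_
  have hpos : ∀ j, 0 < κ j := fun j => hκ.pos (.inl j)
  have hval : ∀ s j' s', primitive (wave (atomFreq κ κ₁ κ₂ (.inr (.inl (j, s)) : Atom S₁ S₂ S₃))
      (atomPhase (.inr (.inl (j, s)) : Atom S₁ S₂ S₃)) *
      primitive (wave (atomFreq κ κ₁ κ₂ (.inr (.inl (j', s')) : Atom S₁ S₂ S₃))
        (atomPhase (.inr (.inl (j', s')) : Atom S₁ S₂ S₃)))) 1 =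
      (if κ j = κ j' then Real.sin (![0, -(Real.pi / 2)] s' - ![0, -(Real.pi / 2)] s) else 0) /
        (4 * Real.pi * κ j') := fun s j' s' =>
    primitive_wave_mul_primitive_wave_one (hpos j) (hpos j') _ _
  simp only [hval]
  -- Distinct frequencies confine the sum to one index; there only the cosine-sine cross terms
  -- survive.
  have hne : ∀ j', j' ≠ j → κ j ≠ κ j' := fun j' h h' =>
    h (Sum.inl_injective (hκ.distinct (a₁ := .inl j) (a₂ := .inl j') h')).symm
  have hsum : ∀ s, ∀ F : ↥S₂ → Fin 2 → ℝ, ∀ Z : ↥S₂ → Fin 2 → StateSpace n,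
      ∑ j', ∑ s', (F j' s' * ((if κ j = κ j' then
        Real.sin (![0, -(Real.pi / 2)] s' - ![0, -(Real.pi / 2)] s) else 0) /
        (4 * Real.pi * κ j'))) • Z j' s' =
      ∑ s', (F j s' * (Real.sin (![0, -(Real.pi / 2)] s' - ![0, -(Real.pi / 2)] s) /
        (4 * Real.pi * κ j))) • Z j s' := by
    intro s F Z
    rw [Finset.sum_eq_single j]
    · simp
    · intro j' _ hj'
      simp [hne j' hj']
    · simp
  rw [Finset.sum_congr rfl fun s _ => hsum s
    (fun j' s' => θ ^ (atomOrder (.inr (.inl (j, s)) : Atom S₁ S₂ S₃) +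
      atomOrder (.inr (.inl (j', s')) : Atom S₁ S₂ S₃)) *
      (atomCoeff κ κ₁ κ₂ a (.inr (.inl (j, s))) * atomCoeff κ κ₁ κ₂ a (.inr (.inl (j', s')))))
    (fun j' s' => Y (atomField (.inr (.inl (j, s)) : Atom S₁ S₂ S₃))
      (atomField (.inr (.inl (j', s')) : Atom S₁ S₂ S₃)))]
  have hκ0 : (0 : ℝ) < κ j := by exact_mod_cast hpos j
  have h1 : √|a (.inr (.inl j))| * √|a (.inr (.inl j))| = |a (.inr (.inl j))| :=
    Real.mul_self_sqrt (abs_nonneg _)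
  have h2 : √(Real.pi * κ j) * √(Real.pi * κ j) = Real.pi * κ j :=
    Real.mul_self_sqrt (by positivity)
  -- The reason for the normalisation: `(2 * √(π κ)) ^ 2` cancels the denominator `4 π κ`, and the
  -- sign factor restores `a` from `|a|`.
  have h3 : θ ^ 6 * (√|a (.inr (.inl j))| * (2 * √(Real.pi * κ j)) *
      Real.sign (a (.inr (.inl j))) * (√|a (.inr (.inl j))| * (2 * √(Real.pi * κ j)))) /
      (4 * Real.pi * κ j) = θ ^ 6 * a (.inr (.inl j)) := by
    have : θ ^ 6 * (√|a (.inr (.inl j))| * (2 * √(Real.pi * κ j)) *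
      Real.sign (a (.inr (.inl j))) * (√|a (.inr (.inl j))| * (2 * √(Real.pi * κ j)))) =
      θ ^ 6 * ((√|a (.inr (.inl j))| * √|a (.inr (.inl j))|) * Real.sign (a (.inr (.inl j)))) *
        (4 * (√(Real.pi * κ j) * √(Real.pi * κ j))) := by ring
    rw [this, h1, h2, mul_sign_abs]
    have := Real.pi_pos
    field_simp
  rw [smul_smul, ← h3]
  simp [Fin.sum_univ_two, atomOrder, atomCoeff, atomField]
  module

/-- At every resonant position the phases obey the same relation as the frequencies, so the cosines
are `1`. Equal frequencies mean the same component, which supplies the phase hypotheses of the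
triple integral. -/
theorem primitive_wave_thirdOrderFreq (hκ : NonResonant κ κ₁ κ₂) (x y z : ↥S₃ × Fin 4) :
    primitive (wave (atomFreq κ κ₁ κ₂ (.inr (.inr x) : Atom S₁ S₂ S₃))
      (atomPhase (.inr (.inr x) : Atom S₁ S₂ S₃)) *
      primitive (wave (atomFreq κ κ₁ κ₂ (.inr (.inr y) : Atom S₁ S₂ S₃))
        (atomPhase (.inr (.inr y) : Atom S₁ S₂ S₃)) *
      primitive (wave (atomFreq κ κ₁ κ₂ (.inr (.inr z) : Atom S₁ S₂ S₃))
        (atomPhase (.inr (.inr z) : Atom S₁ S₂ S₃))))) 1 =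
      if y.1 = x.1 ∧ z.1 = x.1 then
        -(1 / (16 * Real.pi ^ 2 * thirdOrderFreq κ₁ κ₂ x * thirdOrderFreq κ₁ κ₂ z) *
          ((if IsSumPosition x.2 y.2 z.2 then 1 else 0) +
            (if IsSumPosition y.2 z.2 x.2 then 1 else 0) -
            if IsSumPosition x.2 z.2 y.2 then 1 else 0)) else 0 := by
  set ph : Fin 4 → ℝ := ![0, -(Real.pi / 2), -(Real.pi / 2), -(Real.pi / 2)] with hph
  have hpos : ∀ i, 0 < thirdOrderFreq κ₁ κ₂ i := fun i => hκ.pos (.inr i)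
  have hinj : ∀ {x y : ↥S₃ × Fin 4}, thirdOrderFreq κ₁ κ₂ x = thirdOrderFreq κ₁ κ₂ y →
      ph x.2 = ph y.2 := fun {x y} h => by
    rw [Sum.inr_injective (hκ.distinct (a₁ := .inr x) (a₂ := .inr y) h)]
  have hphase : ∀ s t u, IsSumPosition s t u → ph s + ph t - ph u = 0 := by
    intro s t u hs
    simp only [IsSumPosition, Finset.mem_insert, Finset.mem_singleton, Prod.mk.injEq] at hs
    rcases hs with ⟨rfl, rfl, rfl⟩ | ⟨rfl, rfl, rfl⟩ | ⟨rfl, rfl, rfl⟩ | ⟨rfl, rfl, rfl⟩ <;>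
      simp [hph]
  refine (primitive_wave_mul_primitive_wave_mul_primitive_wave_one (hpos x) (hpos y) (hpos z)
    (φ := ph x.2) (ψ := ph y.2) (χ := ph z.2) hinj hinj).trans ?_
  have c1 : Real.cos (ph x.2 - ph y.2 - ph z.2) = Real.cos (ph y.2 + ph z.2 - ph x.2) := by
    rw [← Real.cos_neg]; ring_nf
  have c2 : Real.cos (ph x.2 - ph y.2 + ph z.2) = Real.cos (ph x.2 + ph z.2 - ph y.2) := by
    ring_nf
  have hif : ∀ x y z : ↥S₃ × Fin 4, (if thirdOrderFreq κ₁ κ₂ x + thirdOrderFreq κ₁ κ₂ y =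
      thirdOrderFreq κ₁ κ₂ z then Real.cos (ph x.2 + ph y.2 - ph z.2) else 0) =
      if y.1 = x.1 ∧ z.1 = x.1 then (if IsSumPosition x.2 y.2 z.2 then 1 else 0) else 0 := by
    intro x y z
    by_cases h : IsSumPosition x.2 y.2 z.2
    · simp [hκ.add_eq_iff, h, hphase _ _ _ h]
    · simp [hκ.add_eq_iff, h]
  rw [c1, c2, hif, hif, hif]
  have e1 : (z.1 = y.1 ∧ x.1 = y.1) = (y.1 = x.1 ∧ z.1 = x.1) := by
    refine propext ⟨fun h => ⟨h.2.symm, h.1.trans h.2.symm⟩, fun h => ⟨h.2.trans h.1.symm, h.1.symm⟩⟩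
  have e2 : (z.1 = x.1 ∧ y.1 = x.1) = (y.1 = x.1 ∧ z.1 = x.1) := propext and_comm
  simp only [e1, e2]
  split_ifs <;> simp

/-- Third-order averages of the components of order `ε ^ (1/3)`. -/
theorem sum_sum_sum_primitive_atomInput_smul (hκ : NonResonant κ κ₁ κ₂)
    (Y : Fin m → Fin m → Fin m → StateSpace n) :
    ∑ x : ↥S₃ × Fin 4, ∑ y : ↥S₃ × Fin 4, ∑ z : ↥S₃ × Fin 4,
      primitive (atomInput κ κ₁ κ₂ a θ (.inr (.inr x)) *
        primitive (atomInput κ κ₁ κ₂ a θ (.inr (.inr y)) *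
          primitive (atomInput κ κ₁ κ₂ a θ (.inr (.inr z))))) 1 •
          Y (atomField (.inr (.inr x) : Atom S₁ S₂ S₃)) (atomField (.inr (.inr y) : Atom S₁ S₂ S₃))
            (atomField (.inr (.inr z) : Atom S₁ S₂ S₃)) =
      θ ^ 6 • ∑ l : ↥S₃, a (.inr (.inr l)) • (Y l.1.2.2 l.1.2.1 l.1.1 - Y l.1.2.2 l.1.1 l.1.2.1 -
        Y l.1.2.1 l.1.1 l.1.2.2 + Y l.1.1 l.1.2.1 l.1.2.2) := by
  simp only [primitive_atomInput_mul_mul_one, primitive_wave_thirdOrderFreq hκ,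
    Fintype.sum_prod_type]
  rw [Finset.smul_sum]
  refine Finset.sum_congr rfl fun l _ => ?_
  have hsum : ∀ F : ↥S₃ → Fin 4 → ↥S₃ → Fin 4 → ℝ,
      ∀ Z : ↥S₃ → Fin 4 → ↥S₃ → Fin 4 → StateSpace n,
      ∑ l', ∑ t, ∑ l'', ∑ u, (if l' = l ∧ l'' = l then F l' t l'' u else 0) • Z l' t l'' u =
      ∑ t, ∑ u, F l t l u • Z l t l u := by
    intro F Z
    rw [Finset.sum_eq_single l]
    · refine Finset.sum_congr rfl fun t _ => ?_
      rw [Finset.sum_eq_single l]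
      · simp
      · intro l'' _ h; simp [h]
      · simp
    · intro l' _ h; simp [h]
    · simp
  have h1 : (0 : ℝ) < κ₁ l := by exact_mod_cast hκ.pos (.inr (l, 0))
  have h2 : (0 : ℝ) < κ₂ l := by exact_mod_cast hκ.pos (.inr (l, 1))
  have h4 : (0 : ℝ) < κ₂ l - κ₁ l := by exact_mod_cast hκ.pos (.inr (l, 3))
  simp only [mul_ite, mul_zero]
  rw [Finset.sum_congr rfl fun s _ => hsum _ _]
  set c := cbrt (a (.inr (.inr l))) with hc
  set d := cbrt (2 * Real.pi ^ 2 * ((κ₁ l + κ₂ l : ℤ) : ℝ) * ((κ₂ l - κ₁ l : ℤ) : ℝ)) with hd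
  have hc3 : c ^ 3 = a (.inr (.inr l)) := cbrt_pow_three _
  have hd3 : d ^ 3 = 2 * Real.pi ^ 2 * (κ₁ l + κ₂ l) * (κ₂ l - κ₁ l) := by
    rw [hd, cbrt_pow_three]; push_cast; ring
  rw [← hc3]
  have hcoeff : ∀ s, atomCoeff κ κ₁ κ₂ a (.inr (.inr (l, s)) : Atom S₁ S₂ S₃) =
    c * (2 * d) * ![1, 1, 1 / 2, 1 / 2] s := fun s => rfl
  simp only [hcoeff]
  simp [Fin.sum_univ_four, IsSumPosition, atomOrder, atomField, thirdOrderFreq]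
  -- Each resonant triple consists of positions `0`, `1` and one of the two halved waves, so every
  -- amplitude product is `4 c³ d³`. With this `d³` the sums of reciprocal frequencies collapse to
  -- the coefficients `±1` and `0` of the double bracket.
  have r1 : c * (2 * d) * (c * (2 * d)) * (c * (2 * d) * 2⁻¹) =
      4 * c ^ 3 * (2 * Real.pi ^ 2 * (κ₁ l + κ₂ l) * (κ₂ l - κ₁ l)) := by rw [← hd3]; ring
  have r2 : c * (2 * d) * 2⁻¹ * (c * (2 * d)) * (c * (2 * d)) =
      4 * c ^ 3 * (2 * Real.pi ^ 2 * (κ₁ l + κ₂ l) * (κ₂ l - κ₁ l)) := by rw [← hd3]; ring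
  rw [r1, r2]
  generalize hp : (κ₁ l : ℝ) = p at *
  generalize hq : (κ₂ l : ℝ) = q at *
  have hpq := h4.ne'
  have hpi := Real.pi_ne_zero
  match_scalars <;> field_simp <;> ring

variable {b : ℝ}

theorem abs_primitive_atomInput_mul_le (hθ : 0 ≤ θ) (hb : ∀ p, |atomCoeff κ κ₁ κ₂ a p| ≤ b)
    (p q : Atom S₁ S₂ S₃) :
    |primitive (atomInput κ κ₁ κ₂ a θ p * primitive (atomInput κ κ₁ κ₂ a θ q)) 1| ≤
      θ ^ (atomOrder p + atomOrder q) * (b * b) := by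
  have hb0 : 0 ≤ b := (abs_nonneg _).trans (hb p)
  have h1 := abs_primitive_le (by norm_num) (abs_mul_primitive_le zero_le_one zero_le_one
    (fun t _ => abs_wave_le (atomFreq κ κ₁ κ₂ p) (atomPhase p) t)
    (fun t _ => abs_wave_le (atomFreq κ κ₁ κ₂ q) (atomPhase q) t)) 1 (by simp)
  rw [primitive_atomInput_mul_one, abs_mul, abs_mul, abs_mul, abs_of_nonneg (by positivity)]
  refine (mul_le_of_le_one_right (by positivity) (h1.trans (by norm_num))).trans ?_
  gcongr
  exacts [hb p, hb q]

theorem abs_primitive_atomInput_mul_mul_le (hθ : 0 ≤ θ)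
    (hb : ∀ p, |atomCoeff κ κ₁ κ₂ a p| ≤ b) (p q r : Atom S₁ S₂ S₃) :
    |primitive (atomInput κ κ₁ κ₂ a θ p * primitive (atomInput κ κ₁ κ₂ a θ q *
      primitive (atomInput κ κ₁ κ₂ a θ r))) 1| ≤
      θ ^ (atomOrder p + atomOrder q + atomOrder r) * (b * b * b) := by
  have hb0 : 0 ≤ b := (abs_nonneg _).trans (hb p)
  have h1 := abs_primitive_le (by norm_num) (abs_mul_primitive_le zero_le_one (by norm_num)
    (fun t _ => abs_wave_le (atomFreq κ κ₁ κ₂ p) (atomPhase p) t)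
    (abs_mul_primitive_le zero_le_one zero_le_one
      (fun t _ => abs_wave_le (atomFreq κ κ₁ κ₂ q) (atomPhase q) t)
      (fun t _ => abs_wave_le (atomFreq κ κ₁ κ₂ r) (atomPhase r) t))) 1 (by simp)
  rw [primitive_atomInput_mul_mul_one, abs_mul, abs_mul, abs_mul, abs_mul,
    abs_of_nonneg (by positivity)]
  refine (mul_le_of_le_one_right (by positivity) (h1.trans (by norm_num))).trans ?_
  gcongr
  exacts [hb p, hb q, hb r]

/-- Only equal frequency with different phase could contribute. This removes pairs of size `θ ^ 4`
and `θ ^ 5`, which would otherwise dominate the main term `θ ^ 6`. -/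
theorem primitive_atomInput_mul_one_eq_zero (hκ : NonResonant κ κ₁ κ₂) {x y}
    (h : atomFreq κ κ₁ κ₂ (.inr x : Atom S₁ S₂ S₃) =
      atomFreq κ κ₁ κ₂ (.inr y : Atom S₁ S₂ S₃) →
      atomPhase (.inr x : Atom S₁ S₂ S₃) = atomPhase (.inr y : Atom S₁ S₂ S₃)) :
    primitive (atomInput κ κ₁ κ₂ a θ (.inr x : Atom S₁ S₂ S₃) *
      primitive (atomInput κ κ₁ κ₂ a θ (.inr y : Atom S₁ S₂ S₃))) 1 = 0 := by
  rw [primitive_atomInput_mul_one,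
    primitive_wave_mul_primitive_wave_one (hκ.atomFreq_pos x) (hκ.atomFreq_pos y)]
  split_ifs with h'
  · rw [h h', sub_self, Real.sin_zero]; simp
  · simp

/-- Over a sampling period the iterated integrals of the feedback reproduce the bracket
directions, up to higher order. -/
theorem norm_sum_primitive_atomInput_sub_le (hκ : NonResonant κ κ₁ κ₂) (hθ : 0 ≤ θ)
    (hθ1 : θ ≤ 1) (hb : ∀ p, |atomCoeff κ κ₁ κ₂ a p| ≤ b) (hb0 : 0 ≤ b) {B : ℝ} (hB : 0 ≤ B)
    (Y₁ : Fin m → StateSpace n) (Y₂ : Fin m → Fin m → StateSpace n)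
    (Y₃ : Fin m → Fin m → Fin m → StateSpace n)
    (hY₂ : ∀ i j, ‖Y₂ i j‖ ≤ B) (hY₃ : ∀ i j k, ‖Y₃ i j k‖ ≤ B) :
    ‖(∑ p : Atom S₁ S₂ S₃, primitive (atomInput κ κ₁ κ₂ a θ p) 1 • Y₁ (atomField p) +
      ∑ p : Atom S₁ S₂ S₃, ∑ q : Atom S₁ S₂ S₃, primitive (atomInput κ κ₁ κ₂ a θ p *
        primitive (atomInput κ κ₁ κ₂ a θ q)) 1 • Y₂ (atomField p) (atomField q) +
      ∑ p : Atom S₁ S₂ S₃, ∑ q : Atom S₁ S₂ S₃, ∑ r : Atom S₁ S₂ S₃,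
        primitive (atomInput κ κ₁ κ₂ a θ p * primitive (atomInput κ κ₁ κ₂ a θ q *
          primitive (atomInput κ κ₁ κ₂ a θ r))) 1 •
            Y₃ (atomField p) (atomField q) (atomField r)) -
      θ ^ 6 • (∑ i : ↥S₁, a (.inl i) • Y₁ i +
        ∑ j : ↥S₂, a (.inr (.inl j)) • (Y₂ j.1.2 j.1.1 - Y₂ j.1.1 j.1.2) +
        ∑ l : ↥S₃, a (.inr (.inr l)) • (Y₃ l.1.2.2 l.1.2.1 l.1.1 - Y₃ l.1.2.2 l.1.1 l.1.2.1 -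
        Y₃ l.1.2.1 l.1.1 l.1.2.2 + Y₃ l.1.1 l.1.2.1 l.1.2.2))‖ ≤
      ((Fintype.card (Atom S₁ S₂ S₃ × Atom S₁ S₂ S₃)) * (b * b * B) +
        (Fintype.card (Atom S₁ S₂ S₃ × Atom S₁ S₂ S₃ × Atom S₁ S₂ S₃)) * (b * b * b * B)) *
          θ ^ 7 := by
  have hpow : ∀ {k : ℕ}, 7 ≤ k → θ ^ k ≤ θ ^ 7 := fun hk => pow_le_pow_of_le_one hθ hθ1 hk
  have hfreq₃ : ∀ {x y : ↥S₃ × Fin 4}, thirdOrderFreq κ₁ κ₂ x = thirdOrderFreq κ₁ κ₂ y → x = y :=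
    fun {x y} h => Sum.inr_injective (hκ.distinct (a₁ := .inr x) (a₂ := .inr y) h)
  have hfreq₂₃ : ∀ {j : ↥S₂} {y : ↥S₃ × Fin 4}, κ j = thirdOrderFreq κ₁ κ₂ y → False :=
    fun {j y} h => Sum.inl_ne_inr (hκ.distinct (a₁ := .inl j) (a₂ := .inr y) h)
  have second := norm_sum_sub_sum_comp_le
    (i := fun x : (↥S₂ × Fin 2) × (↥S₂ × Fin 2) =>
      ((.inr (.inl x.1), .inr (.inl x.2)) : Atom S₁ S₂ S₃ × Atom S₁ S₂ S₃))
    (by rintro ⟨x, y⟩ ⟨x', y'⟩ h; simpa using h)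
    (T := fun p => primitive (atomInput κ κ₁ κ₂ a θ p.1 *
        primitive (atomInput κ κ₁ κ₂ a θ p.2)) 1 • Y₂ (atomField p.1) (atomField p.2))
    (e := b * b * B * θ ^ 7) (by positivity) (by
      have small : ∀ p q : Atom S₁ S₂ S₃, 7 ≤ atomOrder p + atomOrder q →
          ‖primitive (atomInput κ κ₁ κ₂ a θ p * primitive (atomInput κ κ₁ κ₂ a θ q)) 1 •
            Y₂ (atomField p) (atomField q)‖ ≤ b * b * B * θ ^ 7 := by
        intro p q hpq
        rw [norm_smul, Real.norm_eq_abs]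
        calc _ ≤ θ ^ (atomOrder p + atomOrder q) * (b * b) * B :=
              mul_le_mul (abs_primitive_atomInput_mul_le hθ hb p q) (hY₂ _ _) (norm_nonneg _)
                (by positivity)
          _ ≤ θ ^ 7 * (b * b) * B := 
              mul_le_mul_of_nonneg_right
                (mul_le_mul_of_nonneg_right (hpow hpq) (by positivity)) hB
          _ = _ := by ring
      have zero : ∀ p q : Atom S₁ S₂ S₃, primitive (atomInput κ κ₁ κ₂ a θ p *
          primitive (atomInput κ κ₁ κ₂ a θ q)) 1 = 0 →
          ‖primitive (atomInput κ κ₁ κ₂ a θ p * primitive (atomInput κ κ₁ κ₂ a θ q)) 1 •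
            Y₂ (atomField p) (atomField q)‖ ≤ b * b * B * θ ^ 7 := by
        intro p q h
        rw [h, zero_smul, norm_zero]
        positivity
      -- The orders are 6, 3 and 2. A pair with an `S₁` component has order at least 8, and `3 + 3`
      -- is the main block. Orders 5 and 4 vanish exactly, since components of equal frequency there
      -- coincide.
      rintro ⟨p | p | p, q | q | q⟩ hp
      · exact small _ _ (by simp [atomOrder])
      · exact small _ _ (by simp [atomOrder])
      · exact small _ _ (by simp [atomOrder])
      · exact small _ _ (by simp [atomOrder])
      · exact absurd ⟨(p, q), rfl⟩ hp
      · exact zero _ _ (primitive_atomInput_mul_one_eq_zero hκ fun h => (hfreq₂₃ h).elim)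
      · exact small _ _ (by simp [atomOrder])
      · exact zero _ _ (primitive_atomInput_mul_one_eq_zero hκ fun h => (hfreq₂₃ h.symm).elim)
      · exact zero _ _ (primitive_atomInput_mul_one_eq_zero hκ fun h => by rw [hfreq₃ h]))
  have third := norm_sum_sub_sum_comp_le
    (i := fun x : (↥S₃ × Fin 4) × (↥S₃ × Fin 4) × (↥S₃ × Fin 4) =>
      ((.inr (.inr x.1), .inr (.inr x.2.1), .inr (.inr x.2.2)) :
        Atom S₁ S₂ S₃ × Atom S₁ S₂ S₃ × Atom S₁ S₂ S₃))
    (by rintro ⟨x, y, z⟩ ⟨x', y', z'⟩ h; simpa using h)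
    (T := fun p => primitive (atomInput κ κ₁ κ₂ a θ p.1 *
        primitive (atomInput κ κ₁ κ₂ a θ p.2.1 * primitive (atomInput κ κ₁ κ₂ a θ p.2.2))) 1 •
          Y₃ (atomField p.1) (atomField p.2.1) (atomField p.2.2))
    (e := b * b * b * B * θ ^ 7) (by positivity) (by
      have small : ∀ p q r : Atom S₁ S₂ S₃, 7 ≤ atomOrder p + atomOrder q + atomOrder r →
          ‖primitive (atomInput κ κ₁ κ₂ a θ p * primitive (atomInput κ κ₁ κ₂ a θ q *
            primitive (atomInput κ κ₁ κ₂ a θ r))) 1 •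
            Y₃ (atomField p) (atomField q) (atomField r)‖ ≤ b * b * b * B * θ ^ 7 := by
        intro p q r hpq
        rw [norm_smul, Real.norm_eq_abs]
        calc _ ≤ θ ^ (atomOrder p + atomOrder q + atomOrder r) * (b * b * b) * B :=
              mul_le_mul (abs_primitive_atomInput_mul_mul_le hθ hb p q r) (hY₃ _ _ _)
                (norm_nonneg _) (by positivity)
          _ ≤ θ ^ 7 * (b * b * b) * B := 
              mul_le_mul_of_nonneg_right
                (mul_le_mul_of_nonneg_right (hpow hpq) (by positivity)) hB
          _ = _ := by ring
      -- The main block is `2 + 2 + 2`; every other triple already has order at least 7.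
      rintro ⟨p, q, r⟩ hp
      refine small p q r ?_
      rcases p with p | p | p <;> rcases q with q | q | q <;> rcases r with r | r | r <;>
        simp only [atomOrder] <;> try omega
      exact absurd ⟨(p, q, r), rfl⟩ hp)
  have main₂ := sum_sum_primitive_atomInput_smul (a := a) (θ := θ) hκ Y₂
  have main₃ := sum_sum_sum_primitive_atomInput_smul (a := a) (θ := θ) hκ Y₃
  simp only [Fintype.sum_prod_type] at second third main₂ main₃
  rw [main₂] at second
  rw [main₃] at third
  rw [sum_primitive_atomInput_smul hκ]
  refine le_trans (le_of_eq ?_) ((norm_add_le _ _).trans ((add_le_add second third).trans_eq ?_))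
  · congr 1
    simp only [smul_add]
    abel
  · ring

/-- The combinations of directional derivatives left by averaging are the columns of `𝓕`. -/
theorem sum_bracketField_eq {f : Fin m → StateSpace n → StateSpace n} {w : StateSpace n}
    (hf : ∀ i, ContDiffAt ℝ 2 (f i) w) :
    ∑ i : ↥S₁, a (.inl i) • f i w +
        ∑ j : ↥S₂, a (.inr (.inl j)) •
          (dirDeriv (f j.1.1) (f j.1.2) w - dirDeriv (f j.1.2) (f j.1.1) w) +
        ∑ l : ↥S₃, a (.inr (.inr l)) •
          (dirDeriv (f l.1.1) (dirDeriv (f l.1.2.1) (f l.1.2.2)) w -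
            dirDeriv (f l.1.2.1) (dirDeriv (f l.1.1) (f l.1.2.2)) w -
            dirDeriv (f l.1.2.2) (dirDeriv (f l.1.1) (f l.1.2.1)) w +
            dirDeriv (f l.1.2.2) (dirDeriv (f l.1.2.1) (f l.1.1)) w) =
      bracketMap f S₁ S₂ S₃ w a := by
  rw [bracketMap, sum_apply, Fintype.sum_sum_type, Fintype.sum_sum_type, ← add_assoc]
  congr 1
  refine Finset.sum_congr rfl fun l _ => ?_
  simp only [ContinuousLinearMap.smulRight_apply, EuclideanSpace.coe_proj, bracketField]
  rw [lieBracket_lieBracket_eq_dirDeriv (hf _) (hf _) (hf _)]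

end Averages

/-! ### Contraction over one sampling period -/

/-- The purpose of the choice of `a`: for positive gain the averaged motion points straight at the
origin. -/
theorem BracketRankCondition.bracketMap_coeffVector {n m : ℕ} {D : Set (StateSpace n)}
    {f : Fin m → StateSpace n → StateSpace n} {S₁ : Finset (Fin m)}
    {S₂ : Finset (Fin m × Fin m)} {S₃ : Finset (Fin m × Fin m × Fin m)}
    (h : BracketRankCondition D f S₁ S₂ S₃) (γ : ℝ) {x : StateSpace n} (hx : x ∈ D) :
    bracketMap f S₁ S₂ S₃ x (coeffVector f S₁ S₂ S₃ γ x) = -(γ • x) := by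
  obtain ⟨e, he⟩ := h.isInvertible hx
  rw [coeffVector, map_neg, map_smul, ← he, ContinuousLinearMap.inverse_equiv]
  simp

theorem exists_bound_contDiffOn {n : ℕ} {ι : Type*} [Fintype ι] {D K : Set (StateSpace n)}
    (hD : IsOpen D) (hK : IsCompact K) (hKD : K ⊆ D) {φ : ι → StateSpace n → StateSpace n}
    (hφ : ∀ i, ContDiffOn ℝ 1 (φ i) D) :
    ∃ B ≥ 0, ∀ i, ∀ y ∈ K, DifferentiableAt ℝ (φ i) y ∧ ‖φ i y‖ ≤ B ∧ ‖fderiv ℝ (φ i) y‖ ≤ B := by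
  have key : ∀ i, ∃ B ≥ 0, ∀ y ∈ K, ‖φ i y‖ ≤ B ∧ ‖fderiv ℝ (φ i) y‖ ≤ B := by
    intro i
    obtain ⟨B₁, h₁⟩ := hK.exists_bound_of_continuousOn ((hφ i).continuousOn.mono hKD)
    obtain ⟨B₂, h₂⟩ := hK.exists_bound_of_continuousOn
      (((hφ i).continuousOn_fderiv_of_isOpen hD le_rfl).mono hKD)
    exact ⟨max 0 (max B₁ B₂), le_max_left _ _, fun y hy =>
      ⟨(h₁ y hy).trans ((le_max_left _ _).trans (le_max_right _ _)),
        (h₂ y hy).trans ((le_max_right _ _).trans (le_max_right _ _))⟩⟩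
  choose B hB0 hB using key
  have hle : ∀ i, B i ≤ ∑ i, B i := fun i =>
    Finset.single_le_sum (fun q _ => hB0 q) (Finset.mem_univ i)
  exact ⟨∑ i, B i, Finset.sum_nonneg fun p _ => hB0 p, fun i y hy =>
    ⟨((hφ i).contDiffAt (hD.mem_nhds (hKD hy))).differentiableAt (by norm_num),
      ((hB i y hy).1).trans (hle i), ((hB i y hy).2).trans (hle i)⟩⟩

theorem ContDiffOn.dirDeriv {n : ℕ} {D : Set (StateSpace n)} (hD : IsOpen D) {k l : WithTop ℕ∞}
    {X φ : StateSpace n → StateSpace n} (hX : ContDiffOn ℝ k X D) (hφ : ContDiffOn ℝ l φ D)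
    (hkl : k + 1 ≤ l) : ContDiffOn ℝ k (dirDeriv X φ) D :=
  (hφ.fderiv_of_isOpen hD hkl).clm_apply hX

section Step

variable {n m : ℕ} {D : Set (StateSpace n)} {f : Fin m → StateSpace n → StateSpace n}
  {S₁ : Finset (Fin m)} {S₂ : Finset (Fin m × Fin m)} {S₃ : Finset (Fin m × Fin m × Fin m)}
  {α R : ℝ}

theorem norm_coeffVector_le (hα : 0 ≤ α)
    (hinv : ∀ x ∈ D, ‖(bracketMap f S₁ S₂ S₃ x).inverse‖ ≤ α)
    (hRD : Metric.closedBall 0 R ⊆ D) (γ : ℝ) {w : StateSpace n} (hw : w ∈ Metric.closedBall 0 R) :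
    ‖coeffVector f S₁ S₂ S₃ γ w‖ ≤ |γ| * (α * R) := by
  rw [coeffVector, norm_neg, norm_smul, Real.norm_eq_abs]
  have h1 := ((bracketMap f S₁ S₂ S₃ w).inverse).le_opNorm w
  have h2 : ‖w‖ ≤ R := by simpa using hw
  gcongr
  exact h1.trans (mul_le_mul (hinv w (hRD hw)) h2 (norm_nonneg _) hα)

theorem abs_atomInput_le {κ : ↥S₂ → ℤ} {κ₁ κ₂ : ↥S₃ → ℤ}
    {a : EuclideanSpace ℝ (BracketIndex S₁ S₂ S₃)} {θ b : ℝ} (hθ : 0 ≤ θ) (hθ1 : θ ≤ 1)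
    (hb : ∀ p, |atomCoeff κ κ₁ κ₂ a p| ≤ b) (p : Atom S₁ S₂ S₃) (t : ℝ) :
    |atomInput κ κ₁ κ₂ a θ p t| ≤ θ ^ 2 * b := by
  have hb0 : 0 ≤ b := (abs_nonneg _).trans (hb p)
  rw [atomInput, abs_mul, abs_mul, abs_of_nonneg (pow_nonneg hθ _)]
  refine (mul_le_of_le_one_right (by positivity) (abs_wave_le _ _ _)).trans ?_
  refine mul_le_mul (pow_le_pow_of_le_one hθ hθ1 ?_) (hb p) (abs_nonneg _) (by positivity)
  rcases p with p | p | p <;> simp [atomOrder]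

/-- The displacement under the feedback over a sampling period is of order `ε ^ (1/3)`. -/
theorem exists_norm_sum_atomInput_le (hD : IsOpen D) (hf : ∀ i, ContDiffOn ℝ 3 (f i) D)
    (hα : 0 ≤ α) (hinv : ∀ x ∈ D, ‖(bracketMap f S₁ S₂ S₃ x).inverse‖ ≤ α)
    (κ : ↥S₂ → ℤ) (κ₁ κ₂ : ↥S₃ → ℤ) (hRD : Metric.closedBall 0 R ⊆ D) (γ : ℝ) :
    ∃ C ≥ 0, ∀ θ, 0 ≤ θ → θ ≤ 1 → ∀ w ∈ Metric.closedBall 0 R, ∀ y ∈ Metric.closedBall 0 R, ∀ s,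
      ‖∑ p, atomInput κ κ₁ κ₂ (coeffVector f S₁ S₂ S₃ γ w) θ p s • f (atomField p) y‖ ≤
        C * θ ^ 2 := by
  obtain ⟨b, hb0, hb⟩ := exists_abs_atomCoeff_le (S₁ := S₁) κ κ₁ κ₂ (|γ| * (α * R))
  obtain ⟨B, hB0, hB⟩ := exists_bound_contDiffOn hD (isCompact_closedBall 0 R) hRD
    fun i => (hf i).of_le (by norm_num)
  refine ⟨Fintype.card (Atom S₁ S₂ S₃) * (b * B), by positivity, fun θ h0 h1 w hw y hy s => ?_⟩
  have : ∑ _p : Atom S₁ S₂ S₃, θ ^ 2 * b * B =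
      Fintype.card (Atom S₁ S₂ S₃) * (b * B) * θ ^ 2 := by simp; ring
  rw [← this]
  refine norm_sum_le_of_le _ fun p _ => ?_
  rw [norm_smul, Real.norm_eq_abs]
  exact mul_le_mul (abs_atomInput_le h0 h1
    (hb _ (norm_coeffVector_le hα hinv hRD γ hw)) p s) (hB _ y hy).2.1 (norm_nonneg _)
    (by positivity)

/-- One sampling period contracts the state, up to the drift and higher-order terms. -/
theorem exists_norm_step_sub_le (hD : IsOpen D) (hf : ∀ i, ContDiffOn ℝ 3 (f i) D)
    (hrank : BracketRankCondition D f S₁ S₂ S₃) (hα : 0 ≤ α)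
    (hinv : ∀ x ∈ D, ‖(bracketMap f S₁ S₂ S₃ x).inverse‖ ≤ α)
    {κ : ↥S₂ → ℤ} {κ₁ κ₂ : ↥S₃ → ℤ} (hκ : NonResonant κ κ₁ κ₂)
    (hRD : Metric.closedBall 0 R ⊆ D) (γ : ℝ) {M : ℝ} (hM : 0 ≤ M) :
    ∃ C ≥ 0, ∀ θ, 0 ≤ θ → θ ≤ 1 → ∀ z G : ℝ → StateSpace n,
      (∀ s ∈ Icc (0 : ℝ) 1, z s ∈ Metric.closedBall 0 R) → ContinuousOn z (Icc 0 1) →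
      (∀ s ∈ Icc (0 : ℝ) 1, ‖G s‖ ≤ θ ^ 6 * M) →
      IntervalIntegrable (fun r => G r + ∑ p, atomInput κ κ₁ κ₂
        (coeffVector f S₁ S₂ S₃ γ (z 0)) θ p r • f (atomField p) (z r)) volume 0 1 →
      (∀ s ∈ Icc (0 : ℝ) 1, z s = z 0 + ∫ r in (0 : ℝ)..s, (G r + ∑ p, atomInput κ κ₁ κ₂
        (coeffVector f S₁ S₂ S₃ γ (z 0)) θ p r • f (atomField p) (z r))) →
      ‖z 1 - (1 - γ * θ ^ 6) • z 0‖ ≤ θ ^ 6 * M + C * θ ^ 7 := by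
  obtain ⟨b, hb0, hb⟩ := exists_abs_atomCoeff_le (S₁ := S₁) κ κ₁ κ₂ (|γ| * (α * R))
  have hcK := isCompact_closedBall (0 : StateSpace n) R
  -- Each directional derivative costs one order of smoothness, so `C³` leaves the third-level
  -- fields `C¹`, as the expansion needs.
  have hf2 : ∀ p : Fin m × Fin m, ContDiffOn ℝ 2 (dirDeriv (f p.2) (f p.1)) D := fun p =>
    ContDiffOn.dirDeriv hD ((hf _).of_le (by norm_num)) (hf _) (by norm_num)
  have hf3 : ∀ p : Fin m × Fin m × Fin m,
      ContDiffOn ℝ 1 (dirDeriv (f p.2.2) (dirDeriv (f p.2.1) (f p.1))) D := fun p =>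
    ContDiffOn.dirDeriv hD ((hf _).of_le (by norm_num)) (hf2 (p.1, p.2.1)) (by norm_num)
  obtain ⟨B₁, hB₁0, hB₁⟩ := exists_bound_contDiffOn hD hcK hRD fun i => (hf i).of_le (by norm_num)
  obtain ⟨B₂, hB₂0, hB₂⟩ := exists_bound_contDiffOn hD hcK hRD
    fun i => (hf2 i).of_le (by norm_num)
  obtain ⟨B₃, hB₃0, hB₃⟩ := exists_bound_contDiffOn hD hcK hRD hf3
  set B := B₁ + B₂ + B₃ with hB
  have hB0 : 0 ≤ B := by positivity
  have le₁ : B₁ ≤ B := by linarith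
  have le₂ : B₂ ≤ B := by linarith
  have le₃ : B₃ ≤ B := by linarith
  set N : ℝ := (Fintype.card (Atom S₁ S₂ S₃) : ℝ) with hN
  -- `C₁` bounds the averaging error and `C₂` the Volterra remainder beyond `θ ^ 6 * M`. With inputs
  -- of size `θ ^ 2 * b`, both the drift corrections and the fourth-order term carry at least `θ ^
  -- 8`.
  set C₁ : ℝ := (Fintype.card (Atom S₁ S₂ S₃ × Atom S₁ S₂ S₃)) * (b * b * B) +
        (Fintype.card (Atom S₁ S₂ S₃ × Atom S₁ S₂ S₃ × Atom S₁ S₂ S₃)) * (b * b * b * B) with hC₁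
  set C₂ : ℝ := N * b * B * M + N ^ 2 * b ^ 2 * B * M + N ^ 3 * b ^ 3 * B * M +
    N ^ 4 * b ^ 4 * B ^ 2 with hC₂
  refine ⟨C₁ + C₂, by positivity, fun θ h0 h1 z G hzK hzc hG hint hz => ?_⟩
  have hw := hzK 0 (by simp)
  have hwD := hRD hw
  have hb' := hb _ (norm_coeffVector_le hα hinv hRD γ hw)
  have volterra := norm_sub_volterra_le (X := fun p => f (atomField p))
    (convex_closedBall (0 : StateSpace n) R)
    (fun p => continuous_atomInput κ κ₁ κ₂ (coeffVector f S₁ S₂ S₃ γ (z 0)) θ p)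
    (fun p r _ => abs_atomInput_le h0 h1 hb' p r) (by positivity) hG hzK hzc hint hz hB0
    (fun p y hy => ((hB₁ _ y hy).2.1).trans le₁) (fun p y hy => (hB₁ _ y hy).1)
    (fun p y hy => ((hB₁ _ y hy).2.2).trans le₁)
    (fun p q y hy => (hB₂ (atomField p, atomField q) y hy).1)
    (fun p q y hy => ((hB₂ (atomField p, atomField q) y hy).2.2).trans le₂)
    (fun p q r y hy => (hB₃ (atomField p, atomField q, atomField r) y hy).1)
    (fun p q r y hy => ((hB₃ (atomField p, atomField q, atomField r) y hy).2.2).trans le₃)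
  have average := norm_sum_primitive_atomInput_sub_le hκ h0 h1 hb' hb0 hB0 (fun i => f i (z 0))
    (fun i j => dirDeriv (f j) (f i) (z 0))
    (fun i j k => dirDeriv (f k) (dirDeriv (f j) (f i)) (z 0))
    (fun i j => ((hB₂ (i, j) _ hw).2.1).trans le₂)
    (fun i j k => ((hB₃ (i, j, k) _ hw).2.1).trans le₃)
  rw [sum_bracketField_eq fun i =>
    ((hf i).contDiffAt (hD.mem_nhds hwD)).of_le (by norm_num),
    hrank.bracketMap_coeffVector γ hwD] at average
  refine le_trans (le_of_eq ?_) ((norm_add_le _ _).trans ((add_le_add volterra average).trans ?_))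
  · congr 1
    module
  · rw [← hC₁, ← hN]
    have hp : ∀ k : ℕ, θ ^ k ≤ 1 := fun k => pow_le_one₀ h0 h1
    have e : θ ^ 6 * M + N * (θ ^ 2 * b * (B * (θ ^ 6 * M) + N * (θ ^ 2 * b * (B * (θ ^ 6 * M) +
        N * (θ ^ 2 * b * (B * (θ ^ 6 * M + N * (θ ^ 2 * b * B)))))))) =
        θ ^ 6 * M + θ ^ 7 * (N * b * B * M * θ ^ 1 + N ^ 2 * b ^ 2 * B * M * θ ^ 3 +
          N ^ 3 * b ^ 3 * B * M * θ ^ 5 + N ^ 4 * b ^ 4 * B ^ 2 * θ ^ 1) := by ring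
    have hle : N * b * B * M * θ ^ 1 + N ^ 2 * b ^ 2 * B * M * θ ^ 3 +
          N ^ 3 * b ^ 3 * B * M * θ ^ 5 + N ^ 4 * b ^ 4 * B ^ 2 * θ ^ 1 ≤ C₂ := by
      rw [hC₂]
      refine add_le_add (add_le_add (add_le_add ?_ ?_) ?_) ?_ <;>
        exact mul_le_of_le_one_right (by positivity) (hp _)
    rw [e]
    nlinarith [mul_le_mul_of_nonneg_left hle (pow_nonneg h0 7)]

end Step

/-! ### Sampled systems: invariance, continuation, uniqueness -/

section Sampled

variable {n : ℕ}

/-- The last sampling time before `t`. -/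
noncomputable def sampleTime (ε t : ℝ) : ℝ := ε * ⌊t / ε⌋₊

theorem sampleTime_eq {ε t : ℝ} (hε : 0 < ε) {j : ℕ} (ht : t ∈ Ico (ε * j) (ε * (j + 1))) :
    sampleTime ε t = ε * j := by
  have : ⌊t / ε⌋₊ = j := by
    rw [Nat.floor_eq_iff (div_nonneg ((by positivity : 0 ≤ ε * j).trans ht.1) hε.le),
      le_div_iff₀ hε, div_lt_iff₀ hε]
    exact ⟨by linarith [ht.1], by linarith [ht.2]⟩
  rw [sampleTime, this]

theorem mem_Ico_floor {ε t : ℝ} (hε : 0 < ε) (ht : 0 ≤ t) :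
    t ∈ Ico (ε * ⌊t / ε⌋₊) (ε * (⌊t / ε⌋₊ + 1)) := by
  have h1 := Nat.floor_le (div_nonneg ht hε.le)
  have h2 := Nat.lt_floor_add_one (t / ε)
  rw [le_div_iff₀ hε] at h1
  rw [div_lt_iff₀ hε] at h2
  exact ⟨by linarith, by linarith⟩

theorem sampleTime_mem_Icc {ε t : ℝ} (hε : 0 < ε) (ht : 0 ≤ t) : sampleTime ε t ∈ Icc 0 t :=
  ⟨by unfold sampleTime; positivity, (mem_Ico_floor hε ht).1⟩

/-- The right-hand side along `x` of the sampled system `ẋ = F(t, x(t_j), x)`. -/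
noncomputable def sampledRhs (F : ℝ → StateSpace n → StateSpace n → StateSpace n) (ε : ℝ)
    (x : ℝ → StateSpace n) (t : ℝ) : StateSpace n :=
  F t (x (sampleTime ε t)) (x t)

/-- Solutions of the sampled system on `[0, T]` in integral form. -/
structure IsIntegralSolution (D : Set (StateSpace n))
    (F : ℝ → StateSpace n → StateSpace n → StateSpace n) (ε : ℝ) (x₀ : StateSpace n) (T : ℝ)
    (x : ℝ → StateSpace n) : Prop where
  init : x 0 = x₀
  mem : ∀ t ∈ Icc 0 T, x t ∈ D
  integrable : IntervalIntegrable (sampledRhs F ε x) volume 0 T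
  eq_integral : ∀ t ∈ Icc 0 T, x t = x₀ + ∫ r in (0 : ℝ)..t, sampledRhs F ε x r

variable {D : Set (StateSpace n)} {F : ℝ → StateSpace n → StateSpace n → StateSpace n}
  {ε : ℝ} {x₀ : StateSpace n} {T : ℝ} {x y : ℝ → StateSpace n}

theorem sampledRhs_congr (hε : 0 < ε) (h : EqOn x y (Icc 0 T)) :
    EqOn (sampledRhs F ε x) (sampledRhs F ε y) (Icc 0 T) := by
  intro t ht
  have hs := sampleTime_mem_Icc hε ht.1
  rw [sampledRhs, sampledRhs, h ht, h ⟨hs.1, hs.2.trans ht.2⟩]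

theorem sampledRhs_congr_Ico (hε : 0 < ε) (h : EqOn x y (Ico 0 T)) :
    EqOn (sampledRhs F ε x) (sampledRhs F ε y) (Ico 0 T) := by
  intro t ht
  have hs := sampleTime_mem_Icc hε ht.1
  rw [sampledRhs, sampledRhs, h ht, h ⟨hs.1, hs.2.trans_lt ht.2⟩]

namespace IsIntegralSolution

theorem congr (hx : IsIntegralSolution D F ε x₀ T x) (hε : 0 < ε) (hT : 0 ≤ T)
    (h : EqOn x y (Icc 0 T)) : IsIntegralSolution D F ε x₀ T y := by
  have hr := sampledRhs_congr (F := F) hε h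
  refine ⟨?_, fun t ht => h ht ▸ hx.mem t ht, ?_, fun t ht => ?_⟩
  · rw [← h ⟨le_rfl, hT⟩, hx.init]
  · exact hx.integrable.congr (by
      rw [uIoc_of_le hT]; exact hr.mono Ioc_subset_Icc_self)
  · rw [← h ht, hx.eq_integral t ht]
    congr 1
    refine intervalIntegral.integral_congr fun r hr' => hr ?_
    rw [uIcc_of_le ht.1] at hr'
    exact ⟨hr'.1, hr'.2.trans ht.2⟩

theorem mono (hx : IsIntegralSolution D F ε x₀ T x) {T' : ℝ} (hT' : 0 ≤ T') (h : T' ≤ T) :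
    IsIntegralSolution D F ε x₀ T' x :=
  ⟨hx.init, fun t ht => hx.mem t ⟨ht.1, ht.2.trans h⟩,
    hx.integrable.mono_set (by
      rw [uIcc_of_le hT', uIcc_of_le (hT'.trans h)]; exact Icc_subset_Icc_right h),
    fun t ht => hx.eq_integral t ⟨ht.1, ht.2.trans h⟩⟩

theorem intervalIntegrable (hx : IsIntegralSolution D F ε x₀ T x) {s t : ℝ} (hs : s ∈ Icc 0 T)
    (ht : t ∈ Icc 0 T) : IntervalIntegrable (sampledRhs F ε x) volume s t :=
  hx.integrable.mono_set (by
    rw [uIcc_of_le (hs.1.trans hs.2)]; exact uIcc_subset_Icc hs ht)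

theorem eq_add_integral (hx : IsIntegralSolution D F ε x₀ T x) {s t : ℝ} (hs : s ∈ Icc 0 T)
    (ht : t ∈ Icc 0 T) : x t = x s + ∫ r in s..t, sampledRhs F ε x r := by
  have h0 : (0 : ℝ) ∈ Icc 0 T := ⟨le_rfl, hs.1.trans hs.2⟩
  rw [hx.eq_integral t ht, hx.eq_integral s hs, add_assoc,
    intervalIntegral.integral_add_adjacent_intervals (hx.intervalIntegrable h0 hs)
      (hx.intervalIntegrable hs ht)]

theorem continuousOn (hx : IsIntegralSolution D F ε x₀ T x) (hT : 0 ≤ T) :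
    ContinuousOn x (Icc 0 T) := by
  refine ContinuousOn.congr (f := fun t => x₀ + ∫ r in (0 : ℝ)..t, sampledRhs F ε x r) ?_
    hx.eq_integral
  have := intervalIntegral.continuousOn_primitive_interval' (b₁ := 0) (b₂ := T)
    hx.integrable left_mem_uIcc
  rw [uIcc_of_le hT] at this
  exact continuousOn_const.add this

/-- On a sampling interval the solution solves an equation with frozen sample. -/
theorem eq_integral_step (hx : IsIntegralSolution D F ε x₀ T x) (hε : 0 < ε) {j : ℕ} {t : ℝ}
    (ht : t ∈ Icc (ε * j) (ε * (j + 1))) (htT : t ≤ T) :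
    IntervalIntegrable (fun r => F r (x (ε * j)) (x r)) volume (ε * j) t ∧
      x t = x (ε * j) + ∫ r in (ε * j)..t, F r (x (ε * j)) (x r) := by
  have h0 : 0 ≤ ε * j := by positivity
  have hs : ε * j ∈ Icc 0 T := ⟨h0, ht.1.trans htT⟩
  have ht' : t ∈ Icc 0 T := ⟨h0.trans ht.1, htT⟩
  have hae : ∀ᵐ r, r ∈ uIoc (ε * j) t →
      sampledRhs F ε x r = F r (x (ε * j)) (x r) := by
    filter_upwards [compl_mem_ae_iff.2 (measure_singleton t)] with r hr hmem
    rw [uIoc_of_le ht.1] at hmem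
    rw [sampledRhs, sampleTime_eq hε ⟨hmem.1.le, (lt_of_le_of_ne hmem.2 hr).trans_le ht.2⟩]
  refine ⟨(hx.intervalIntegrable hs ht').congr_ae ?_, ?_⟩
  · rwa [Filter.EventuallyEq, ae_restrict_iff' measurableSet_uIoc]
  · rw [hx.eq_add_integral hs ht', intervalIntegral.integral_congr_ae hae]

end IsIntegralSolution

/-- The sampled system is well behaved: bounded speed `c` near the sample, and a sampling period
contracts towards the ball of radius `e`. -/
structure SampledRegime (D : Set (StateSpace n))
    (F : ℝ → StateSpace n → StateSpace n → StateSpace n) (ε δ R c q e : ℝ) : Prop where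
  ε_pos : 0 < ε
  δ_pos : 0 < δ
  subset : Metric.closedBall 0 R ⊆ D
  c_nonneg : 0 ≤ c
  reach : c * ε < R - δ
  q_nonneg : 0 ≤ q
  q_le_one : q ≤ 1
  e_le : e ≤ δ
  speed : ∀ t ≥ 0, ∀ w ∈ Metric.closedBall 0 δ, ∀ y ∈ Metric.closedBall 0 R, ‖F t w y‖ ≤ c
  cont : ∀ t ≥ 0, ∀ w ∈ Metric.closedBall 0 δ, ContinuousOn (F t w) (Metric.closedBall 0 R)
  meas : ∀ w ∈ Metric.closedBall 0 δ, ∀ z : ℝ → StateSpace n, Continuous z →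
    (∀ t, z t ∈ Metric.closedBall 0 R) →
    AEStronglyMeasurable (fun t => F t w (z t)) (volume.restrict (Ici 0))
  contract : ∀ j : ℕ, ∀ z : ℝ → StateSpace n, z (ε * j) ∈ Metric.closedBall 0 δ →
    ContinuousOn z (Icc (ε * j) (ε * (j + 1))) →
    (∀ t ∈ Icc (ε * j) (ε * (j + 1)), z t ∈ Metric.closedBall 0 R) →
    IntervalIntegrable (fun r => F r (z (ε * j)) (z r)) volume (ε * j) (ε * (j + 1)) →
    (∀ t ∈ Icc (ε * j) (ε * (j + 1)),
      z t = z (ε * j) + ∫ r in (ε * j)..t, F r (z (ε * j)) (z r)) →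
    ‖z (ε * (j + 1))‖ ≤ q * ‖z (ε * j)‖ + (1 - q) * e

namespace SampledRegime

variable {δ R c q e : ℝ}

theorem lt (H : SampledRegime D F ε δ R c q e) : δ < R := by
  have := H.reach
  have := mul_nonneg H.c_nonneg H.ε_pos.le
  linarith

theorem mem_closedBall_of_norm_sub_le (H : SampledRegime D F ε δ R c q e) {w y : StateSpace n}
    (hw : w ∈ Metric.closedBall 0 δ) (h : ‖y - w‖ ≤ c * ε) : y ∈ Metric.closedBall 0 R := by
  rw [mem_closedBall_zero_iff] at *
  have h1 : ‖y‖ ≤ ‖y - w‖ + ‖w‖ := by simpa using norm_add_le (y - w) w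
  have := H.reach
  linarith

/-- The speed is controlled only in the `R`-ball, but from the `δ`-ball the margin `R - δ` cannot be
crossed within one period. -/
theorem norm_sub_le (H : SampledRegime D F ε δ R c q e) (hx : IsIntegralSolution D F ε x₀ T x)
    {j : ℕ} (hj : x (ε * j) ∈ Metric.closedBall 0 δ) {t : ℝ}
    (ht : t ∈ Icc (ε * j) (ε * (j + 1))) (htT : t ≤ T) : ‖x t - x (ε * j)‖ ≤ c * ε := by
  have h0 : 0 ≤ ε * j := mul_nonneg H.ε_pos.le (Nat.cast_nonneg j)
  have hlen : t - ε * j ≤ ε := by linarith [ht.2]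
  have key := norm_sub_le_of_speed_le (z := x) (F := fun r => F r (x (ε * j)) (x r))
    (a := ε * j) (b := t) (c := c) (η := R - δ)
    (fun s hs => (hx.eq_integral_step H.ε_pos ⟨hs.1, hs.2.trans ht.2⟩ (hs.2.trans htT)).2)
    ((hx.continuousOn ((h0.trans ht.1).trans htT)).mono
      fun s hs => ⟨h0.trans hs.1, hs.2.trans htT⟩) H.c_nonneg
    ((mul_le_mul_of_nonneg_left hlen H.c_nonneg).trans_lt H.reach)
    (fun r hr hlt => H.speed r (h0.trans hr.1) _ hj _ (by
      rw [mem_closedBall_zero_iff] at *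
      have h1 : ‖x r‖ ≤ ‖x r - x (ε * j)‖ + ‖x (ε * j)‖ := by
        simpa using norm_add_le (x r - x (ε * j)) (x (ε * j))
      linarith))
  exact (key t ⟨ht.1, le_rfl⟩).trans (mul_le_mul_of_nonneg_left hlen H.c_nonneg)

/-- The states at the sampling times decay exponentially to the ball of radius `e`. -/
theorem norm_sample_le (H : SampledRegime D F ε δ R c q e)
    (hx : IsIntegralSolution D F ε x₀ T x) (hx₀ : x₀ ∈ Metric.closedBall 0 δ) (j : ℕ)
    (hj : ε * j ≤ T) :
    ‖x (ε * j)‖ ≤ q ^ j * ‖x₀‖ + (1 - q ^ j) * e ∧ x (ε * j) ∈ Metric.closedBall 0 δ := by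
  -- A convex combination of `‖x₀‖` and `e`, both at most `δ`: the decay estimate itself keeps the
  -- samples where the next contraction applies.
  have hball : ∀ j : ℕ, q ^ j * ‖x₀‖ + (1 - q ^ j) * e ≤ δ := by
    intro j
    have h0 : 0 ≤ q ^ j := pow_nonneg H.q_nonneg j
    have h1 : q ^ j ≤ 1 := pow_le_one₀ H.q_nonneg H.q_le_one
    rw [mem_closedBall_zero_iff] at hx₀
    have h2 := mul_le_mul_of_nonneg_left hx₀ h0
    have h3 := mul_le_mul_of_nonneg_left H.e_le (sub_nonneg.2 h1)
    linarith
  suffices h : ‖x (ε * j)‖ ≤ q ^ j * ‖x₀‖ + (1 - q ^ j) * e from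
    ⟨h, by rw [mem_closedBall_zero_iff]; exact h.trans (hball j)⟩
  induction j with
  | zero => simp [hx.init]
  | succ j ih =>
    push_cast at hj ⊢
    have hle : ε * (j : ℝ) ≤ ε * (j + 1) := by nlinarith [H.ε_pos]
    have ih' := ih (hle.trans hj)
    have hmem : x (ε * j) ∈ Metric.closedBall 0 δ := by
      rw [mem_closedBall_zero_iff]; exact ih'.trans (hball j)
    have h0 : 0 ≤ ε * j := mul_nonneg H.ε_pos.le (Nat.cast_nonneg j)
    have := H.contract j x hmem
      ((hx.continuousOn ((h0.trans hle).trans hj)).mono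
        fun s hs => ⟨h0.trans hs.1, hs.2.trans hj⟩)
      (fun t ht => H.mem_closedBall_of_norm_sub_le hmem
        (H.norm_sub_le hx hmem ht (ht.2.trans hj)))
      (hx.eq_integral_step H.ε_pos ⟨hle, le_rfl⟩ hj).1
      (fun t ht => (hx.eq_integral_step H.ε_pos ht (ht.2.trans hj)).2)
    have h2 := mul_le_mul_of_nonneg_left ih' H.q_nonneg
    calc _ ≤ _ := this
      _ ≤ q * (q ^ j * ‖x₀‖ + (1 - q ^ j) * e) + (1 - q) * e := by linarith
      _ = _ := by ring

theorem floor_step (H : SampledRegime D F ε δ R c q e)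
    (hx : IsIntegralSolution D F ε x₀ T x) (hx₀ : x₀ ∈ Metric.closedBall 0 δ) {t : ℝ}
    (ht : t ∈ Icc 0 T) :
    x (ε * ⌊t / ε⌋₊) ∈ Metric.closedBall 0 δ ∧ ‖x t - x (ε * ⌊t / ε⌋₊)‖ ≤ c * ε ∧
      ‖x (ε * ⌊t / ε⌋₊)‖ ≤ q ^ ⌊t / ε⌋₊ * ‖x₀‖ + (1 - q ^ ⌊t / ε⌋₊) * e := by
  have hm := mem_Ico_floor H.ε_pos ht.1
  obtain ⟨h1, h2⟩ := H.norm_sample_le hx hx₀ ⌊t / ε⌋₊ (hm.1.trans ht.2)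
  exact ⟨h2, H.norm_sub_le hx h2 ⟨hm.1, hm.2.le⟩ ht.2, h1⟩

theorem mem_closedBall (H : SampledRegime D F ε δ R c q e)
    (hx : IsIntegralSolution D F ε x₀ T x) (hx₀ : x₀ ∈ Metric.closedBall 0 δ) {t : ℝ}
    (ht : t ∈ Icc 0 T) : x t ∈ Metric.closedBall 0 R := by
  obtain ⟨h1, h2, _⟩ := H.floor_step hx hx₀ ht
  exact H.mem_closedBall_of_norm_sub_le h1 h2

theorem norm_sampledRhs_le (H : SampledRegime D F ε δ R c q e)
    (hx : IsIntegralSolution D F ε x₀ T x) (hx₀ : x₀ ∈ Metric.closedBall 0 δ) {t : ℝ}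
    (ht : t ∈ Icc 0 T) : ‖sampledRhs F ε x t‖ ≤ c :=
  H.speed t ht.1 _ (H.floor_step hx hx₀ ht).1 _ (H.mem_closedBall hx hx₀ ht)

end SampledRegime

/-- The radial retraction onto the closed ball of radius `R`. -/
theorem exists_retraction {R : ℝ} (hR : 0 < R) :
    ∃ P : StateSpace n → StateSpace n, Continuous P ∧ (∀ y, P y ∈ Metric.closedBall 0 R) ∧
      ∀ y ∈ Metric.closedBall 0 R, P y = y := by
  refine ⟨fun y => (R / max R ‖y‖) • y, ?_, fun y => ?_, fun y hy => ?_⟩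
  · refine Continuous.smul (continuous_const.div (continuous_const.max continuous_norm)
      fun y => ?_) continuous_id
    exact (hR.trans_le (le_max_left _ _)).ne'
  · have hpos : 0 < max R ‖y‖ := hR.trans_le (le_max_left _ _)
    rw [mem_closedBall_zero_iff, norm_smul, Real.norm_eq_abs, abs_of_pos (by positivity),
      div_mul_eq_mul_div, div_le_iff₀ hpos]
    exact mul_le_mul_of_nonneg_left (le_max_right _ _) hR.le
  · rw [mem_closedBall_zero_iff] at hy
    simp only [max_eq_left hy, div_self hR.ne', one_smul]

namespace SampledRegime

variable {δ R c q e : ℝ}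

/-- A solution on `[0, T]` extends to the end of the current sampling interval. -/
theorem exists_extension_step (H : SampledRegime D F ε δ R c q e) (hT : 0 ≤ T)
    (hx : IsIntegralSolution D F ε x₀ T x) (hx₀ : x₀ ∈ Metric.closedBall 0 δ) :
    ∃ y, IsIntegralSolution D F ε x₀ (ε * (⌊T / ε⌋₊ + 1)) y ∧ EqOn x y (Icc 0 T) := by
  set j := ⌊T / ε⌋₊ with hj
  have hm := mem_Ico_floor H.ε_pos hT
  rw [← hj] at hm
  set T' := ε * ((j : ℝ) + 1) with hT'
  have hTT' : T < T' := hm.2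
  have hs0 : 0 ≤ ε * (j : ℝ) := mul_nonneg H.ε_pos.le (Nat.cast_nonneg j)
  have hw : x (ε * j) ∈ Metric.closedBall 0 δ := (H.floor_step hx hx₀ ⟨hT, le_rfl⟩).1
  set w := x (ε * j) with hwdef
  -- Retracting the argument makes the field bounded and continuous on the whole space. The solution
  -- turns out to stay in the `R`-ball, where `P` is the identity.
  obtain ⟨P, hPc, hPm, hPid⟩ := exists_retraction (n := n) (H.δ_pos.trans H.lt)
  obtain ⟨z, hzc, hzT, hzi, hz⟩ := exists_integral_solution (F := fun t y => F t w (P y))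
    hTT'.le H.c_nonneg (fun t ht y => H.speed t (hT.trans ht.1) w hw _ (hPm y))
    (fun t ht => (H.cont t (hT.trans ht.1) w hw).comp_continuous hPc hPm)
    (fun u hu => (H.meas w hw (fun t => P (u t)) (hPc.comp hu) fun t => hPm _).mono_measure
      (Measure.restrict_mono (fun t ht => hT.trans ht.1) le_rfl)) (x T)
  set y : ℝ → StateSpace n := fun t => if t ≤ T then x t else z t with hy
  have hyx : EqOn x y (Icc 0 T) := fun t ht => by simp [hy, ht.2]
  have hyz : EqOn z y (Icc T T') := fun t ht => by
    rcases ht.1.eq_or_lt with h | h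
    · subst h; simp [hy, hzT]
    · simp [hy, not_le.2 h]
  have hysample : y (ε * j) = w := (hyx ⟨hs0, hm.1⟩).symm
  have hyT : y T = x T := (hyx ⟨hT, le_rfl⟩).symm
  -- the integrand on the whole sampling interval
  set Φ : ℝ → StateSpace n := fun r => F r w (P (y r)) with hΦ
  have hballx : ∀ t ∈ Icc 0 T, x t ∈ Metric.closedBall 0 R := fun t ht =>
    H.mem_closedBall hx hx₀ ht
  have hΦ1 : ∀ r ∈ Icc (ε * (j : ℝ)) T, Φ r = F r w (x r) := fun r hr => by
    have hr' : r ∈ Icc 0 T := ⟨hs0.trans hr.1, hr.2⟩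
    simp only [hΦ, ← hyx hr', hPid _ (hballx r hr')]
  have hΦ2 : ∀ r ∈ Icc T T', Φ r = F r w (P (z r)) := fun r hr => by
    simp only [hΦ, ← hyz hr]
  have hΦi1 : IntervalIntegrable Φ volume (ε * j) T :=
    (hx.eq_integral_step H.ε_pos ⟨hm.1, hm.2.le⟩ le_rfl).1.congr fun r hr => by
      rw [uIoc_of_le hm.1] at hr
      exact (hΦ1 r ⟨hr.1.le, hr.2⟩).symm
  have hΦi2 : IntervalIntegrable Φ volume T T' := hzi.congr fun r hr => by
    rw [uIoc_of_le hTT'.le] at hr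
    exact (hΦ2 r ⟨hr.1.le, hr.2⟩).symm
  have hΦi2' : ∀ t ∈ Icc T T', IntervalIntegrable Φ volume T t := fun t ht =>
    hΦi2.mono_set (by
      rw [uIcc_of_le ht.1, uIcc_of_le hTT'.le]; exact Icc_subset_Icc_right ht.2)
  have hyeq2 : ∀ t ∈ Icc T T', y t = x T + ∫ r in T..t, Φ r := fun t ht => by
    rw [← hyz ht, hz t ht]
    congr 1
    refine intervalIntegral.integral_congr fun r hr => ?_
    rw [uIcc_of_le ht.1] at hr
    exact (hΦ2 r ⟨hr.1, hr.2.trans ht.2⟩).symm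
  have hxeq1 : ∀ t ∈ Icc (ε * (j : ℝ)) T, x t = w + ∫ r in (ε * j)..t, Φ r := fun t ht => by
    rw [(hx.eq_integral_step H.ε_pos ⟨ht.1, ht.2.trans hm.2.le⟩ ht.2).2]
    congr 1
    refine intervalIntegral.integral_congr fun r hr => ?_
    rw [uIcc_of_le ht.1] at hr
    exact (hΦ1 r ⟨hr.1, hr.2.trans ht.2⟩).symm
  have hyeq : ∀ t ∈ Icc (ε * (j : ℝ)) T', y t = y (ε * j) + ∫ r in (ε * j)..t, Φ r := by
    intro t ht
    rw [hysample]
    rcases le_total t T with h | h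
    · rw [← hyx ⟨hs0.trans ht.1, h⟩, hxeq1 t ⟨ht.1, h⟩]
    · rw [hyeq2 t ⟨h, ht.2⟩, hxeq1 T ⟨hm.1, le_rfl⟩, add_assoc,
        intervalIntegral.integral_add_adjacent_intervals hΦi1 (hΦi2' t ⟨h, ht.2⟩)]
  have hΦi : IntervalIntegrable Φ volume (ε * j) T' := hΦi1.trans hΦi2
  have hyc : ContinuousOn y (Icc (ε * j) T') := by
    refine ContinuousOn.congr (f := fun t => y (ε * j) + ∫ r in (ε * (j : ℝ))..t, Φ r) ?_ hyeq
    have := intervalIntegral.continuousOn_primitive_interval' hΦi left_mem_uIcc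
    rw [uIcc_of_le (hm.1.trans hTT'.le)] at this
    exact continuousOn_const.add this
  have hlen : T' - ε * j = ε := by rw [hT']; ring
  have hyball : ∀ t ∈ Icc (ε * (j : ℝ)) T', y t ∈ Metric.closedBall 0 R := by
    intro t ht
    have key := norm_sub_le_of_speed_le (η := R - δ) hyeq hyc H.c_nonneg
      (by rw [hlen]; exact H.reach)
      (fun r hr _ => H.speed r (hs0.trans hr.1) w hw _ (hPm _)) t ht
    rw [hysample] at key
    refine H.mem_closedBall_of_norm_sub_le hw (key.trans ?_)
    exact mul_le_mul_of_nonneg_left (by linarith [ht.2]) H.c_nonneg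
  have hrhs : ∀ r ∈ Ico T T', Φ r = sampledRhs F ε y r := fun r hr => by
    rw [sampledRhs, sampleTime_eq H.ε_pos ⟨hm.1.trans hr.1, hr.2⟩, hysample]
    simp only [hΦ, hPid _ (hyball r ⟨hm.1.trans hr.1, hr.2.le⟩)]
  have hae : ∀ t ∈ Icc T T', ∀ᵐ r, r ∈ uIoc T t → Φ r = sampledRhs F ε y r := by
    intro t ht
    filter_upwards [compl_mem_ae_iff.2 (measure_singleton t)] with r hr hmem
    rw [uIoc_of_le ht.1] at hmem
    exact hrhs r ⟨hmem.1.le, (lt_of_le_of_ne hmem.2 hr).trans_le ht.2⟩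
  have hyT0 := hx.congr H.ε_pos hT hyx
  have hint2 : ∀ t ∈ Icc T T', IntervalIntegrable (sampledRhs F ε y) volume T t := fun t ht =>
    (hΦi2' t ht).congr_ae (by
      rw [Filter.EventuallyEq, ae_restrict_iff' measurableSet_uIoc]; exact hae t ht)
  refine ⟨y, ⟨hyT0.init, fun t ht => ?_, hyT0.integrable.trans (hint2 T' ⟨hTT'.le, le_rfl⟩),
    fun t ht => ?_⟩, hyx⟩
  · rcases le_total t T with h | h
    · exact hyT0.mem t ⟨ht.1, h⟩
    · exact H.subset (hyball t ⟨hm.1.trans h, ht.2⟩)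
  · rcases le_total t T with h | h
    · exact hyT0.eq_integral t ⟨ht.1, h⟩
    · rw [hyeq2 t ⟨h, ht.2⟩, ← hyT, hyT0.eq_integral T ⟨hT, le_rfl⟩, add_assoc,
        intervalIntegral.integral_congr_ae (hae t ⟨h, ht.2⟩),
        intervalIntegral.integral_add_adjacent_intervals hyT0.integrable (hint2 t ⟨h, ht.2⟩)]

/-- A solution on `[0, T]` extends to `[0, ∞)`. -/
theorem exists_extension (H : SampledRegime D F ε δ R c q e) (hT : 0 ≤ T)
    (hx : IsIntegralSolution D F ε x₀ T x) (hx₀ : x₀ ∈ Metric.closedBall 0 δ) :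
    ∃ y, (∀ T', 0 ≤ T' → IsIntegralSolution D F ε x₀ T' y) ∧ EqOn x y (Icc 0 T) := by
  have hstep : ∀ p : {p : ℝ × (ℝ → StateSpace n) // 0 ≤ p.1 ∧
      IsIntegralSolution D F ε x₀ p.1 p.2}, ∃ p' : {p : ℝ × (ℝ → StateSpace n) // 0 ≤ p.1 ∧
      IsIntegralSolution D F ε x₀ p.1 p.2}, p'.1.1 = ε * (⌊p.1.1 / ε⌋₊ + 1) ∧
        EqOn p.1.2 p'.1.2 (Icc 0 p.1.1) := by
    intro p
    obtain ⟨y, hy, hxy⟩ := H.exists_extension_step p.2.1 p.2.2 hx₀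
    exact ⟨⟨(_, y), by have := H.ε_pos; positivity, hy⟩, rfl, hxy⟩
  choose next hnext hnexteq using hstep
  set u : ℕ → {p : ℝ × (ℝ → StateSpace n) // 0 ≤ p.1 ∧ IsIntegralSolution D F ε x₀ p.1 p.2} :=
    fun k => next^[k] ⟨(T, x), hT, hx⟩ with hu
  have hu1 : ∀ k, u (k + 1) = next (u k) := fun k => Function.iterate_succ_apply' _ _ _
  have hge : ∀ k : ℕ, ε * k ≤ (u k).1.1 := by
    intro k
    induction k with
    | zero => simpa using (u 0).2.1
    | succ k ih =>
      rw [hu1, hnext]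
      have h1 : k ≤ ⌊(u k).1.1 / ε⌋₊ := by
        rw [Nat.le_floor_iff (div_nonneg (u k).2.1 H.ε_pos.le), le_div_iff₀ H.ε_pos]
        linarith
      have h2 : (k : ℝ) ≤ ⌊(u k).1.1 / ε⌋₊ := by exact_mod_cast h1
      push_cast
      exact mul_le_mul_of_nonneg_left (by linarith) H.ε_pos.le
  have hmono : Monotone fun k => (u k).1.1 := monotone_nat_of_le_succ fun k => by
    rw [hu1, hnext]; exact (mem_Ico_floor H.ε_pos (u k).2.1).2.le
  have heq : ∀ k l, k ≤ l → EqOn (u k).1.2 (u l).1.2 (Icc 0 (u k).1.1) := by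
    intro k l hkl
    induction l, hkl using Nat.le_induction with
    | base => exact fun t _ => rfl
    | succ l hl ih =>
      intro t ht
      rw [ih ht, hu1]
      exact hnexteq _ ⟨ht.1, ht.2.trans (hmono hl)⟩
  -- The extensions agree on common domains, so any stage reaching past `t` may define `y t`; by
  -- `hge` stage `⌈t / ε⌉₊` does.
  set y : ℝ → StateSpace n := fun t => (u ⌈t / ε⌉₊).1.2 t with hy
  have hceil : ∀ t : ℝ, t ≤ (u ⌈t / ε⌉₊).1.1 := fun t => by
    have h := Nat.le_ceil (t / ε)
    rw [div_le_iff₀ H.ε_pos] at h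
    exact (h.trans_eq (mul_comm _ _)).trans (hge _)
  have hyk : ∀ k : ℕ, EqOn (u k).1.2 y (Icc 0 (u k).1.1) := by
    intro k t ht
    rcases le_total k ⌈t / ε⌉₊ with h | h
    · exact heq _ _ h ht
    · exact (heq _ _ h ⟨ht.1, hceil t⟩).symm
  refine ⟨y, fun T' hT' => ?_, hyk 0⟩
  exact ((u ⌈T' / ε⌉₊).2.2.congr H.ε_pos (u _).2.1 (hyk _)).mono hT' (hceil T')

/-- A solution on `[0, T)` extends to `[0, ∞)`. -/
theorem exists_extension_of_Ico (H : SampledRegime D F ε δ R c q e) (hT : 0 < T)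
    (hx : ∀ s ∈ Ico 0 T, IsIntegralSolution D F ε x₀ s x) (hx₀ : x₀ ∈ Metric.closedBall 0 δ) :
    ∃ y, (∀ T', 0 ≤ T' → IsIntegralSolution D F ε x₀ T' y) ∧ EqOn x y (Ico 0 T) := by
  have hbd : ∀ t ∈ Ico 0 T, ‖sampledRhs F ε x t‖ ≤ c := fun t ht =>
    H.norm_sampledRhs_le (hx t ht) hx₀ ⟨ht.1, le_rfl⟩
  have hint : IntervalIntegrable (sampledRhs F ε x) volume 0 T := by
    rw [intervalIntegrable_iff_integrableOn_Ioo_of_le hT.le]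
    obtain ⟨b, -, hb, hbT⟩ := exists_seq_strictMono_tendsto' hT
    have hU : Ioo 0 T ⊆ ⋃ k, Ioc 0 (b k) := by
      intro t ht
      obtain ⟨k, hk⟩ := (hbT.eventually (lt_mem_nhds ht.2)).exists
      exact mem_iUnion.2 ⟨k, ht.1, hk.le⟩
    refine IntegrableOn.of_bound (C := c) (by simp) ?_ ?_
    · have hm : AEStronglyMeasurable (sampledRhs F ε x) (volume.restrict (⋃ k, Ioc 0 (b k))) := by
        refine AEStronglyMeasurable.iUnion fun k => ?_
        have := (hx (b k) ⟨(hb k).1.le, (hb k).2⟩).integrable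
        rw [intervalIntegrable_iff_integrableOn_Ioc_of_le (hb k).1.le] at this
        exact this.aestronglyMeasurable
      exact hm.mono_set hU
    · rw [ae_restrict_iff' measurableSet_Ioo]
      exact Filter.Eventually.of_forall fun t ht => hbd t ⟨ht.1.le, ht.2⟩
  -- Bounded speed makes this integral converge, and closedness of the `R`-ball keeps the endpoint
  -- in `D`. The given value `x T` is arbitrary and gets replaced.
  set xT : StateSpace n := x₀ + ∫ r in (0 : ℝ)..T, sampledRhs F ε x r with hxT
  set y : ℝ → StateSpace n := fun t => if t < T then x t else xT with hy
  have hyx : EqOn x y (Ico 0 T) := fun t ht => by simp [hy, ht.2]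
  have hyT : y T = xT := by simp [hy]
  have hae : ∀ t ∈ Icc 0 T, ∀ᵐ r, r ∈ uIoc 0 t → sampledRhs F ε x r = sampledRhs F ε y r := by
    intro t ht
    filter_upwards [compl_mem_ae_iff.2 (measure_singleton t)] with r hr hmem
    rw [uIoc_of_le ht.1] at hmem
    exact sampledRhs_congr_Ico H.ε_pos hyx
      ⟨hmem.1.le, (lt_of_le_of_ne hmem.2 hr).trans_le ht.2⟩
  have hyeq : ∀ t ∈ Icc 0 T, y t = x₀ + ∫ r in (0 : ℝ)..t, sampledRhs F ε x r := by
    intro t ht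
    rcases ht.2.eq_or_lt with h | h
    · rw [h, hyT]
    · rw [← hyx ⟨ht.1, h⟩]; exact (hx t ⟨ht.1, h⟩).eq_integral t ⟨ht.1, le_rfl⟩
  have hyc : ContinuousOn y (Icc 0 T) := by
    refine ContinuousOn.congr (f := fun t => x₀ + ∫ r in (0 : ℝ)..t, sampledRhs F ε x r) ?_ hyeq
    have := intervalIntegral.continuousOn_primitive_interval' hint left_mem_uIcc
    rw [uIcc_of_le hT.le] at this
    exact continuousOn_const.add this
  have hTball : xT ∈ Metric.closedBall 0 R := by
    rw [← hyT]
    have h1 : Filter.Tendsto y (nhdsWithin T (Ico 0 T)) (nhds (y T)) :=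
      (hyc T ⟨hT.le, le_rfl⟩).mono_left (nhdsWithin_mono _ Ico_subset_Icc_self)
    have hne : (nhdsWithin T (Ico 0 T)).NeBot := by
      rw [← mem_closure_iff_nhdsWithin_neBot, closure_Ico hT.ne]
      exact ⟨hT.le, le_rfl⟩
    refine Metric.isClosed_closedBall.mem_of_tendsto h1 ?_
    filter_upwards [self_mem_nhdsWithin] with t ht
    rw [← hyx ht]
    exact H.mem_closedBall (hx t ht) hx₀ ⟨ht.1, le_rfl⟩
  have hsol : IsIntegralSolution D F ε x₀ T y := by
    refine ⟨?_, fun t ht => ?_, ?_, fun t ht => ?_⟩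
    · rw [← hyx ⟨le_rfl, hT⟩]; exact (hx 0 ⟨le_rfl, hT⟩).init
    · rcases ht.2.eq_or_lt with h | h
      · rw [h, hyT]; exact H.subset hTball
      · rw [← hyx ⟨ht.1, h⟩]; exact (hx t ⟨ht.1, h⟩).mem t ⟨ht.1, le_rfl⟩
    · refine hint.congr_ae ?_
      rw [Filter.EventuallyEq, ae_restrict_iff' measurableSet_uIoc]
      exact hae T ⟨hT.le, le_rfl⟩
    · rw [hyeq t ht, intervalIntegral.integral_congr_ae (hae t ht)]
  obtain ⟨v, hv, hyv⟩ := H.exists_extension hT.le hsol hx₀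
  exact ⟨v, hv, fun t ht => (hyx ht).trans (hyv ⟨ht.1, ht.2.le⟩)⟩

/-- Uniqueness when the right-hand side is Lipschitz in the state. -/
theorem eqOn_of_lipschitz (H : SampledRegime D F ε δ R c q e) {L : ℝ}
    (hL : ∀ t ≥ 0, ∀ w ∈ Metric.closedBall 0 δ, ∀ u ∈ Metric.closedBall 0 R,
      ∀ v ∈ Metric.closedBall 0 R, ‖F t w u - F t w v‖ ≤ L * ‖u - v‖)
    (hx : ∀ T, 0 ≤ T → IsIntegralSolution D F ε x₀ T x)
    (hy : ∀ T, 0 ≤ T → IsIntegralSolution D F ε x₀ T y)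
    (hx₀ : x₀ ∈ Metric.closedBall 0 δ) : EqOn x y (Ici 0) := by
  have hε := H.ε_pos
  have key : ∀ j : ℕ, EqOn x y (Icc 0 (ε * j)) := by
    intro j
    induction j with
    | zero =>
      intro t ht
      have : t = 0 := le_antisymm (by simpa using ht.2) ht.1
      rw [this, (hx 0 le_rfl).init, (hy 0 le_rfl).init]
    | succ j ih =>
      push_cast
      have h0 : 0 ≤ ε * (j : ℝ) := by positivity
      have hle : ε * (j : ℝ) ≤ ε * (j + 1) := by nlinarith
      set b := ε * ((j : ℝ) + 1) with hb
      have hb0 : 0 ≤ b := h0.trans hle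
      have hxb := hx b hb0
      have hyb := hy b hb0
      have hw := (H.norm_sample_le hxb hx₀ j hle).2
      -- Equal samples mean that both curves solve the same equation on this period, so no Lipschitz
      -- dependence on the sample is needed.
      have hxy : x (ε * j) = y (ε * j) := ih ⟨h0, le_rfl⟩
      have hsub : Icc (ε * (j : ℝ)) b ⊆ Icc 0 b := Icc_subset_Icc_left h0
      set u : ℝ → ℝ := fun t => ‖x t - y t‖ with hu
      have huc : ContinuousOn u (Icc (ε * j) b) :=
        (((hxb.continuousOn hb0).sub (hyb.continuousOn hb0)).mono hsub).norm
      have hui : IntervalIntegrable u volume (ε * j) b :=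
        ContinuousOn.intervalIntegrable (by rwa [uIcc_of_le hle])
      have huint : ∀ t ∈ Icc (ε * (j : ℝ)) b, u t ≤ L * ∫ r in (ε * (j : ℝ))..t, u r := by
        intro t ht
        obtain ⟨i1, e1⟩ := hxb.eq_integral_step hε ht ht.2
        obtain ⟨i2, e2⟩ := hyb.eq_integral_step hε ht ht.2
        simp only [hu]
        rw [e1, e2, hxy, add_sub_add_left_eq_sub, ← intervalIntegral.integral_sub (hxy ▸ i1) i2,
          ← intervalIntegral.integral_const_mul]
        refine intervalIntegral.norm_integral_le_of_norm_le ht.1 ?_ ?_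
        · refine Filter.Eventually.of_forall fun r hr => ?_
          have hr' : r ∈ Icc 0 b := ⟨h0.trans hr.1.le, hr.2.trans ht.2⟩
          exact hL r hr'.1 _ (hxy ▸ hw) _ (H.mem_closedBall hxb hx₀ hr') _
            (H.mem_closedBall hyb hx₀ hr')
        · exact (hui.mono_set (by
            rw [uIcc_of_le ht.1, uIcc_of_le hle]; exact Icc_subset_Icc_right ht.2)).const_mul L
      -- Grönwall is applied to the primitive of `u`, whose right derivative `u` is at most `L`
      -- times it; `u` itself need not be differentiable.
      have hU0 : ∀ t ∈ Icc (ε * (j : ℝ)) b, ∫ r in (ε * (j : ℝ))..t, u r = 0 := by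
        intro t ht
        have hd : ∀ s ∈ Ico (ε * (j : ℝ)) b, HasDerivWithinAt
            (fun s => ∫ r in (ε * (j : ℝ))..s, u r) (u s) (Ici s) s := by
          intro s hs
          have hs' : s ∈ Icc (ε * (j : ℝ)) b := ⟨hs.1, hs.2.le⟩
          refine intervalIntegral.integral_hasDerivWithinAt_right (hui.mono_set ?_) ?_
            (t := Ioi s) ?_
          · rw [uIcc_of_le hs.1, uIcc_of_le hle]; exact Icc_subset_Icc_right hs.2.le
          · exact (huc.mono (fun r hr => ⟨hs.1.trans hr.1.le, hr.2.le⟩)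
              |>.stronglyMeasurableAtFilter_nhdsWithin measurableSet_Ioo s).filter_mono (by
                rw [nhdsWithin_Ioo_eq_nhdsGT hs.2])
          · refine ((huc s hs').mono (fun r hr => ⟨hs.1.trans hr.1.le, hr.2.le⟩) :
              ContinuousWithinAt u (Ioo s b) s).mono_of_mem_nhdsWithin ?_
            exact Ioo_mem_nhdsGT hs.2
        have hUc : ContinuousOn (fun s => ∫ r in (ε * (j : ℝ))..s, u r) (Icc (ε * j) b) := by
          have := intervalIntegral.continuousOn_primitive_interval' hui left_mem_uIcc
          rwa [uIcc_of_le hle] at this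
        have hgr := norm_le_gronwallBound_of_norm_deriv_right_le (δ := 0) (K := L) (ε := 0)
          hUc hd (by simp) (fun s hs => by
            have hs' : s ∈ Icc (ε * (j : ℝ)) b := ⟨hs.1, hs.2.le⟩
            have hpos : 0 ≤ ∫ r in (ε * (j : ℝ))..s, u r :=
              intervalIntegral.integral_nonneg hs.1 fun r _ => norm_nonneg _
            rw [Real.norm_of_nonneg (norm_nonneg _), Real.norm_of_nonneg hpos, add_zero]
            exact huint s hs') t ht
        simpa [gronwallBound_ε0_δ0] using hgr
      intro t ht
      rcases le_total t (ε * j) with h | h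
      · exact ih ⟨ht.1, h⟩
      · have h1 := huint t ⟨h, ht.2⟩
        rw [hU0 t ⟨h, ht.2⟩, mul_zero] at h1
        exact sub_eq_zero.1 (norm_le_zero_iff.1 h1)
  intro t ht
  have h := Nat.le_ceil (t / ε)
  rw [div_le_iff₀ hε] at h
  exact key ⌈t / ε⌉₊ ⟨ht, by linarith⟩

end SampledRegime

end Sampled

/-! ### Choice of constants and conclusion -/

section Closing

variable {n m : ℕ} {D : Set (StateSpace n)} {g : ℝ → StateSpace n → StateSpace n}
  {f : Fin m → StateSpace n → StateSpace n}

/-- The field of the system when the state in the feedback is the sample `w`. -/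
def sampledField (g : ℝ → StateSpace n → StateSpace n) (f : Fin m → StateSpace n → StateSpace n)
    (h : ℝ → StateSpace n → Fin m → ℝ) (t : ℝ) (w y : StateSpace n) : StateSpace n :=
  g t y + ∑ i, h t w i • f i y

variable {h : ℝ → StateSpace n → Fin m → ℝ} {ε T : ℝ} {x₀ : StateSpace n} {x : ℝ → StateSpace n}

theorem IsPiSolutionOn.ae_hasDerivAt {I : Set ℝ} (hx : IsPiSolutionOn D g f h ε x₀ I x)
    (hε : 0 < ε) (hI : I ⊆ Ici 0) :
    ∀ᵐ t, t ∈ I → HasDerivAt x (sampledRhs (sampledField g f h) ε x t) t := by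
  filter_upwards [ae_all_iff.2 hx.ode] with t ht hmem
  have hm := mem_Ico_floor hε (hI hmem)
  rw [sampledRhs, sampleTime_eq hε hm]
  exact ht _ hmem hm

theorem IsPiSolutionOn.isIntegralSolution {I : Set ℝ} (hx : IsPiSolutionOn D g f h ε x₀ I x)
    (hε : 0 < ε) (hI : I ⊆ Ici 0) (hT : 0 ≤ T) (hTI : Icc 0 T ⊆ I) :
    IsIntegralSolution D (sampledField g f h) ε x₀ T x := by
  have key : ∀ t ∈ Icc 0 T,
      IntervalIntegrable (sampledRhs (sampledField g f h) ε x) volume 0 t ∧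
      ∫ r in (0 : ℝ)..t, sampledRhs (sampledField g f h) ε x r = x t - x 0 := by
    intro t ht
    refine (hx.absCont 0 (hTI ⟨le_rfl, hT⟩) t
      (hTI ht)).intervalIntegrable_and_integral_eq_sub ?_
    filter_upwards [hx.ae_hasDerivAt hε hI] with s hs hmem
    rw [uIcc_of_le ht.1] at hmem
    exact hs (hTI ⟨hmem.1, hmem.2.trans ht.2⟩)
  refine ⟨hx.init, fun t ht => hx.mem t (hTI ht), (key T ⟨hT, le_rfl⟩).1, fun t ht => ?_⟩
  rw [(key t ht).2, hx.init, add_sub_cancel]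

/-- Bounded speed gives Lipschitz, hence absolutely continuous, curves; Lebesgue differentiation
recovers the equation almost everywhere. -/
theorem SampledRegime.isPiSolutionOn {δ R c q e : ℝ}
    (H : SampledRegime D (sampledField g f h) ε δ R c q e)
    (hx : ∀ T, 0 ≤ T → IsIntegralSolution D (sampledField g f h) ε x₀ T x)
    (hx₀ : x₀ ∈ Metric.closedBall 0 δ) : IsPiSolutionOn D g f h ε x₀ (Ici 0) x := by
  have heq : ∀ T : ℝ, 0 ≤ T → ∀ t ∈ Icc 0 T,
      x t = x 0 + ∫ r in (0 : ℝ)..t, sampledRhs (sampledField g f h) ε x r := fun T hT t ht => by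
    rw [(hx T hT).init]; exact (hx T hT).eq_integral t ht
  refine ⟨(hx 0 le_rfl).init, fun t ht => (hx t ht).mem t ⟨ht, le_rfl⟩, fun a ha b hb => ?_,
    fun j => ?_⟩
  · have hT : 0 ≤ max a b := le_max_of_le_left ha
    refine (lipschitzOnWith_of_eq_integral (a := 0) (b := max a b) H.c_nonneg
      (fun r hr => H.norm_sampledRhs_le (hx _ hT) hx₀ hr) (hx _ hT).integrable
      (heq _ hT)).mono ?_ |>.absolutelyContinuousOnInterval
    exact uIcc_subset_Icc ⟨ha, le_max_left _ _⟩ ⟨hb, le_max_right _ _⟩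
  · have hT : 0 ≤ ε * ((j : ℝ) + 1) := by have := H.ε_pos; positivity
    filter_upwards [ae_hasDerivAt_of_eq_integral (hx _ hT).integrable (heq _ hT)] with t ht h0 hj
    have := ht ⟨h0, hj.2.le⟩
    rwa [sampledRhs, sampleTime_eq H.ε_pos hj] at this

variable {S₁ : Finset (Fin m)} {S₂ : Finset (Fin m × Fin m)} {S₃ : Finset (Fin m × Fin m × Fin m)}
  {κ : ↥S₂ → ℤ} {κ₁ κ₂ : ↥S₃ → ℤ} {α R δ M γ : ℝ}

theorem continuous_feedback (w : StateSpace n) (i : Fin m) :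
    Continuous fun t => feedback f S₁ S₂ S₃ κ κ₁ κ₂ γ ε t w i := by
  unfold feedback phiTwo phiThree
  fun_prop

/-- With a high gain and a small sampling period, the sampled system contracts to a small ball. -/
theorem exists_sampledRegime (hD : IsOpen D) (hf : ∀ i, ContDiffOn ℝ 3 (f i) D)
    (hg : CaratheodoryDrift D g) (hrank : BracketRankCondition D f S₁ S₂ S₃) (hα : 0 ≤ α)
    (hinv : ∀ x ∈ D, ‖(bracketMap f S₁ S₂ S₃ x).inverse‖ ≤ α) (hκ : NonResonant κ κ₁ κ₂)
    (hδ : 0 < δ) (hδR : δ < R) (hRD : Metric.closedBall 0 R ⊆ D) (hM : 0 ≤ M)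
    (hgM : ∀ t ≥ 0, ∀ y ∈ Metric.closedBall 0 R, ‖g t y‖ ≤ M) (hγ : 0 < γ)
    (hγδ : (M + 1) / γ ≤ δ) {η : ℝ} (hη : 0 < η) :
    ∃ εbar > 0, ∀ ε ∈ Ioc 0 εbar, ∃ c, c * ε ≤ η ∧ SampledRegime D
      (sampledField g f (feedback f S₁ S₂ S₃ κ κ₁ κ₂ γ ε)) ε δ R c (1 - γ * ε) ((M + 1) / γ) := by
  obtain ⟨C₁, hC₁0, hC₁⟩ := exists_norm_sum_atomInput_le hD hf hα hinv κ κ₁ κ₂ hRD γ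
  obtain ⟨C₂, hC₂0, hC₂⟩ := exists_norm_step_sub_le hD hf hrank hα hinv hκ hRD γ hM
  -- Half the margin `R - δ` yields the strict inequality in `reach`.
  set η' := min η ((R - δ) / 2) with hη'
  have hη'0 : 0 < η' := lt_min hη (by linarith)
  -- The four bounds ensure `θ ≤ 1`, `c * ε ≤ η'`, `C₂ * θ ^ 7 ≤ ε` and `γ * ε ≤ 1`.
  set θbar := min (min 1 (η' / (M + C₁ + 1))) (min (1 / (C₂ + 1)) (1 / (γ + 1))) with hθbar
  have hθbar0 : 0 < θbar := by positivity
  refine ⟨θbar ^ 6, by positivity, fun ε hε => ?_⟩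
  set θ := ε ^ (1 / 6 : ℝ) with hθ
  have hε0 : 0 < ε := hε.1
  have hθ0 : 0 < θ := Real.rpow_pos_of_pos hε0 _
  have hθ6 : ε = θ ^ 6 := by
    rw [hθ, ← Real.rpow_natCast, ← Real.rpow_mul hε0.le]; norm_num
  have hθle : θ ≤ θbar := le_of_pow_le_pow_left₀ (n := 6) (by norm_num) hθbar0.le (hθ6 ▸ hε.2)
  have hθ1 : θ ≤ 1 := hθle.trans ((min_le_left _ _).trans (min_le_left _ _))
  have hθη : θ * (M + C₁ + 1) ≤ η' := by
    rw [← le_div_iff₀ (by positivity)]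
    exact hθle.trans ((min_le_left _ _).trans (min_le_right _ _))
  have hθC₂ : θ * (C₂ + 1) ≤ 1 := by
    rw [← le_div_iff₀ (by positivity)]
    exact hθle.trans ((min_le_right _ _).trans (min_le_left _ _))
  have hθγ : θ * (γ + 1) ≤ 1 := by
    rw [← le_div_iff₀ (by positivity)]
    exact hθle.trans ((min_le_right _ _).trans (min_le_right _ _))
  have hθ6θ : θ ^ 6 ≤ θ := pow_le_of_le_one hθ0.le hθ1 (by norm_num)
  have hθ2θ : θ ^ 2 ≤ θ := pow_le_of_le_one hθ0.le hθ1 (by norm_num)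
  have hγε : γ * ε ≤ 1 := by
    rw [hθ6]; nlinarith [mul_le_mul_of_nonneg_left hθ6θ hγ.le]
  -- The speed may blow up as `ε → 0`, but the displacement `c * ε = M * ε + C₁ * θ ^ 2` tends to
  -- zero.
  set c := M + C₁ * θ ^ 2 / ε with hc
  have hcε : c * ε ≤ η' := by
    have : c * ε = M * θ ^ 6 + C₁ * θ ^ 2 := by rw [hc, ← hθ6]; field_simp
    rw [this]
    nlinarith [mul_le_mul_of_nonneg_left hθ6θ hM, mul_le_mul_of_nonneg_left hθ2θ hC₁0]
  have hsub : Metric.closedBall (0 : StateSpace n) δ ⊆ Metric.closedBall 0 R :=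
    Metric.closedBall_subset_closedBall hδR.le
  refine ⟨c, hcε.trans (min_le_left _ _), hε0, hδ, hRD, by positivity, ?_, by linarith,
    by nlinarith, hγδ, ?_, ?_, ?_, ?_⟩
  · have := min_le_right η ((R - δ) / 2)
    linarith
  · intro t ht w hw y hy
    refine (norm_add_le _ _).trans (add_le_add (hgM t ht y hy) ?_)
    -- The decomposition holds for every real `s`, so period `0` with `s = t / ε` covers all times.
    have h1 := mul_sum_feedback_smul_eq (S₁ := S₁) f κ κ₁ κ₂ γ hθ0 hθ6 0 (t / ε) w y
    have h2 : ε * (((0 : ℕ) : ℝ) + t / ε) = t := by push_cast; field_simp; ring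
    rw [h2] at h1
    have h3 := hC₁ θ hθ0.le hθ1 w (hsub hw) y hy (t / ε)
    rw [← h1, norm_smul, Real.norm_of_nonneg hε0.le] at h3
    rw [le_div_iff₀ hε0]
    linarith
  · intro t ht w hw
    exact ((hg.continuous_state t ht).mono hRD).add (continuousOn_finsetSum _ fun i _ =>
      ((hf i).continuousOn.mono hRD).const_smul
        (feedback f S₁ S₂ S₃ κ κ₁ κ₂ γ ε t w i))
  · intro w hw z hz hzR
    refine (hg.aestronglyMeasurable_comp hz fun t => hRD (hzR t)).add
      (Continuous.aestronglyMeasurable ?_)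
    exact continuous_finsetSum _ fun i _ => (continuous_feedback w i).smul
      ((hf i).continuousOn.comp_continuous hz fun t => hRD (hzR t))
  · intro j z hzj hzc hzR hzi hz
    set w := z (ε * j) with hw
    have hlin : ∀ s : ℝ, ε * ((j : ℝ) + s) = ε * s + ε * j := fun s => by ring
    have hj0 : 0 ≤ ε * (j : ℝ) := by positivity
    have hmaps : ∀ s ∈ Icc (0 : ℝ) 1, ε * ((j : ℝ) + s) ∈ Icc (ε * (j : ℝ)) (ε * (j + 1)) :=
      fun s hs => ⟨by nlinarith [hs.1], by nlinarith [hs.2]⟩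
    have h00 : ε * ((j : ℝ) + 0) = ε * j := by ring
    have hfield : ∀ s, ε • g (ε * (j + s)) (z (ε * (j + s))) + ∑ p, atomInput κ κ₁ κ₂
        (coeffVector f S₁ S₂ S₃ γ (z (ε * ((j : ℝ) + 0)))) θ p s • f (atomField p)
          (z (ε * (j + s))) =
        ε • sampledField g f (feedback f S₁ S₂ S₃ κ κ₁ κ₂ γ ε) (ε * s + ε * j) w
          (z (ε * s + ε * j)) := fun s => by
      rw [sampledField, smul_add, ← hlin, mul_sum_feedback_smul_eq (S₁ := S₁) f κ κ₁ κ₂ γ hθ0 hθ6, h00, hw]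
    -- Time is rescaled to `[0, 1]`, which multiplies the drift by `ε = θ ^ 6`.
    have step := hC₂ θ hθ0.le hθ1 (fun s => z (ε * (j + s)))
      (fun s => ε • g (ε * (j + s)) (z (ε * (j + s)))) (fun s hs => hzR _ (hmaps s hs))
      (hzc.comp (by fun_prop) hmaps)
      (fun s hs => by
        rw [norm_smul, Real.norm_of_nonneg hε0.le, ← hθ6]
        exact mul_le_mul_of_nonneg_left (hgM _ (hj0.trans (hmaps s hs).1) _
          (hzR _ (hmaps s hs))) hε0.le)
      (by
        simp only [hfield]
        refine IntervalIntegrable.smul ?_ ε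
        have h1 := (hzi.comp_add_right (ε * j)).comp_mul_left (c := ε)
        refine h1.mono_set ?_
        have e1 : (ε * (j : ℝ) - ε * j) / ε = 0 := by simp
        have e2 : (ε * ((j : ℝ) + 1) - ε * j) / ε = 1 := by field_simp; ring
        rw [e1, e2])
      (fun s hs => by
        simp only [hfield]
        rw [intervalIntegral.integral_smul, intervalIntegral.smul_integral_comp_mul_add
          (fun r => sampledField g f (feedback f S₁ S₂ S₃ κ κ₁ κ₂ γ ε) r w (z r)), h00, ← hlin s,
          mul_zero, zero_add]
        exact hz _ (hmaps s hs))
    simp only [h00, ← hθ6] at step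
    rw [← hw] at step
    have h1 := norm_le_norm_add_norm_sub' (z (ε * ((j : ℝ) + 1))) ((1 - γ * ε) • w)
    rw [norm_smul, Real.norm_of_nonneg (by linarith)] at h1
    -- At this radius contraction balances the drift `ε * M` plus a remainder of at most `ε`.
    have h2 : (1 - (1 - γ * ε)) * ((M + 1) / γ) = ε * (M + 1) := by field_simp; ring
    have h3 : C₂ * θ ^ 7 ≤ ε := by
      have : C₂ * θ ^ 7 = (C₂ * θ) * ε := by rw [hθ6]; ring
      rw [this]
      exact mul_le_of_le_one_left hε0.le (by linarith)
    rw [h2]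
    linarith

/-- The sample `w` is frozen, so the square and cube roots in the feedback enter only as bounded
amplitudes. The constant may depend on `ε`. -/
theorem exists_lipschitz_sampledField (hD : IsOpen D) (hf : ∀ i, ContDiffOn ℝ 3 (f i) D)
    (hRD : Metric.closedBall 0 R ⊆ D) (hg : LipschitzDrift D g) (hα : 0 ≤ α)
    (hinv : ∀ x ∈ D, ‖(bracketMap f S₁ S₂ S₃ x).inverse‖ ≤ α) (hδR : δ ≤ R)
    (κ : ↥S₂ → ℤ) (κ₁ κ₂ : ↥S₃ → ℤ) (γ : ℝ) (hε : 0 < ε) :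
    ∃ L, ∀ t ≥ 0, ∀ w ∈ Metric.closedBall 0 δ, ∀ u ∈ Metric.closedBall 0 R,
      ∀ v ∈ Metric.closedBall 0 R,
      ‖sampledField g f (feedback f S₁ S₂ S₃ κ κ₁ κ₂ γ ε) t w u -
        sampledField g f (feedback f S₁ S₂ S₃ κ κ₁ κ₂ γ ε) t w v‖ ≤ L * ‖u - v‖ := by
  obtain ⟨Lg, hLg0, hLg⟩ := hg _ hRD (isCompact_closedBall 0 R)
  obtain ⟨b, hb0, hb⟩ := exists_abs_atomCoeff_le (S₁ := S₁) κ κ₁ κ₂ (|γ| * (α * R))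
  obtain ⟨B, hB0, hB⟩ := exists_bound_contDiffOn hD (isCompact_closedBall 0 R) hRD
    fun i => (hf i).of_le (by norm_num)
  set θ := ε ^ (1 / 6 : ℝ) with hθ
  have hθ0 : 0 < θ := Real.rpow_pos_of_pos hε _
  have hθ6 : ε = θ ^ 6 := by
    rw [hθ, ← Real.rpow_natCast, ← Real.rpow_mul hε.le]; norm_num
  set C := ∑ p : Atom S₁ S₂ S₃, θ ^ atomOrder p * b * B with hC
  refine ⟨Lg + C / ε, fun t ht w hw u hu v hv => ?_⟩
  have hwR := Metric.closedBall_subset_closedBall hδR hw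
  have h1 : ∀ y, ε • ∑ k, feedback f S₁ S₂ S₃ κ κ₁ κ₂ γ ε t w k • f k y =
      ∑ p, atomInput κ κ₁ κ₂ (coeffVector f S₁ S₂ S₃ γ w) θ p (t / ε) • f (atomField p) y :=
      fun y => by
    have h1 := mul_sum_feedback_smul_eq (S₁ := S₁) f κ κ₁ κ₂ γ hθ0 hθ6 0 (t / ε) w y
    have h2 : ε * (((0 : ℕ) : ℝ) + t / ε) = t := by push_cast; field_simp; ring
    rwa [h2] at h1
  have h2 : ε * ‖∑ k, feedback f S₁ S₂ S₃ κ κ₁ κ₂ γ ε t w k • f k u -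
      ∑ k, feedback f S₁ S₂ S₃ κ κ₁ κ₂ γ ε t w k • f k v‖ ≤ C * ‖u - v‖ := by
    rw [← Real.norm_of_nonneg hε.le, ← norm_smul, Real.norm_of_nonneg hε.le, smul_sub, h1, h1,
      ← Finset.sum_sub_distrib, hC, Finset.sum_mul]
    refine norm_sum_le_of_le _ fun p _ => ?_
    rw [← smul_sub, norm_smul, Real.norm_eq_abs, mul_assoc]
    refine mul_le_mul ?_ ((convex_closedBall (0 : StateSpace n) R).norm_image_sub_le_of_norm_fderiv_le
      (fun y hy => (hB _ y hy).1) (fun y hy => (hB _ y hy).2.2) hv hu) (norm_nonneg _)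
      (by positivity)
    rw [atomInput, abs_mul, abs_mul, abs_of_nonneg (by positivity : 0 ≤ θ ^ atomOrder p)]
    refine (mul_le_of_le_one_right (by positivity) (abs_wave_le _ _ _)).trans ?_
    exact mul_le_mul_of_nonneg_left (hb _ (norm_coeffVector_le hα hinv hRD γ hwR) p)
      (by positivity)
  have h3 : sampledField g f (feedback f S₁ S₂ S₃ κ κ₁ κ₂ γ ε) t w u -
        sampledField g f (feedback f S₁ S₂ S₃ κ κ₁ κ₂ γ ε) t w v = (g t u - g t v) +
      (∑ k, feedback f S₁ S₂ S₃ κ κ₁ κ₂ γ ε t w k • f k u -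
      ∑ k, feedback f S₁ S₂ S₃ κ κ₁ κ₂ γ ε t w k • f k v) := by
    simp only [sampledField]; abel
  rw [h3, add_mul]
  refine (norm_add_le _ _).trans (add_le_add (hLg t ht u hu v hv) ?_)
  rw [div_mul_eq_mul_div, le_div_iff₀ hε]
  linarith

/-- The power is at most the exponential at the last sampling time; from there to `t` less than one
period passes, over which the exponential drops by at most `γ * ε`. -/
theorem pow_one_sub_le_exp_add {γ ε t : ℝ} (hγ : 0 ≤ γ) (hε : 0 < ε) (hγε : γ * ε ≤ 1)
    (ht : 0 ≤ t) : (1 - γ * ε) ^ ⌊t / ε⌋₊ ≤ Real.exp (-γ * t) + γ * ε := by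
  have hm := mem_Ico_floor hε ht
  set j := ⌊t / ε⌋₊
  have h1 : (1 - γ * ε) ^ j ≤ Real.exp (-(γ * (ε * j))) := by
    have := pow_le_pow_left₀ (by linarith) (Real.one_sub_le_exp_neg (γ * ε)) j
    rw [← Real.exp_nat_mul] at this
    refine this.trans_eq ?_
    congr 1; ring
  have h2 : Real.exp (-(γ * (ε * j))) ≤ 1 := Real.exp_le_one_iff.2 (by
    have : 0 ≤ γ * (ε * j) := by positivity
    linarith)
  set d := γ * (t - ε * j) with hd
  have hd0 : 0 ≤ d := mul_nonneg hγ (by linarith [hm.1])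
  have hdε : d ≤ γ * ε := mul_le_mul_of_nonneg_left (by linarith [hm.2]) hγ
  have h3 : Real.exp (-γ * t) = Real.exp (-(γ * (ε * j))) * Real.exp (-d) := by
    rw [← Real.exp_add]; congr 1; rw [hd]; ring
  have h4 := Real.one_sub_le_exp_neg d
  have h5 := mul_le_mul_of_nonneg_left h4 (Real.exp_pos (-(γ * (ε * j)))).le
  have h6 := mul_le_mul_of_nonneg_right h2 hd0
  linarith

end Closing

theorem theorem1 {n m : ℕ} (D : Set (StateSpace n)) (hD : IsOpen D)
    (f : Fin m → StateSpace n → StateSpace n) (hf : ∀ i, ContDiffOn ℝ 3 (f i) D)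
    (g : ℝ → StateSpace n → StateSpace n) (hg : CaratheodoryDrift D g)
    (S₁ : Finset (Fin m)) (S₂ : Finset (Fin m × Fin m)) (S₃ : Finset (Fin m × Fin m × Fin m))
    (hrank : BracketRankCondition D f S₁ S₂ S₃) (hbdd : BoundedDrift D g)
    (α : ℝ) (hα : 0 < α) (hinv : ∀ x ∈ D, ‖(bracketMap f S₁ S₂ S₃ x).inverse‖ ≤ α)
    (κ : ↥S₂ → ℤ) (κ₁ κ₂ : ↥S₃ → ℤ) (hκ : NonResonant κ κ₁ κ₂)
    (δ ρ : ℝ) (hδ : 0 < δ) (hρ : 0 < ρ) (hδD : Metric.closedBall 0 δ ⊆ D) :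
    ∃ γ > 0, ∃ εbar > 0, ∃ lam > 0, ∃ t₁ > 0, ∀ ε ∈ Set.Ioc 0 εbar, ∀ x₀ ∈ Metric.ball 0 δ,
      let Sol := IsPiSolutionOn D g f (feedback f S₁ S₂ S₃ κ κ₁ κ₂ γ ε) ε x₀
      -- a solution exists on `[0, ∞)`
      (∃ x, Sol (Set.Ici 0) x) ∧
      -- every solution given on `[0, T)` extends to one on `[0, ∞)`
      (∀ T > 0, ∀ x, Sol (Set.Ico 0 T) x → ∃ y, Sol (Set.Ici 0) y ∧ Set.EqOn x y (Set.Ico 0 T)) ∧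
      -- it is unique if the drift is locally Lipschitz in the state
      (LipschitzDrift D g →
        ∀ x y, Sol (Set.Ici 0) x → Sol (Set.Ici 0) y → Set.EqOn x y (Set.Ici 0)) ∧
      -- the exponential estimate, and the eventual bound
      (∀ x, Sol (Set.Ici 0) x →
        (∀ t ∈ Set.Ico 0 t₁, ‖x t‖ ≤ ‖x₀‖ * Real.exp (-lam * t) + ρ) ∧
        (∀ t ∈ Set.Ici t₁, ‖x t‖ ≤ ρ)) := by
  obtain ⟨R, hδR, hRD⟩ : ∃ R, δ < R ∧ Metric.closedBall (0 : StateSpace n) R ⊆ D := by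
    obtain ⟨r, hr, hsub⟩ := (isCompact_closedBall (0 : StateSpace n) δ).exists_cthickening_subset_open
      hD hδD
    rw [cthickening_closedBall hr.le hδ.le] at hsub
    exact ⟨r + δ, by linarith, hsub⟩
  obtain ⟨τ, hτ, M, hM, hgM⟩ := hbdd _ hRD (isCompact_closedBall 0 R)
  -- `M` does not depend on `t₀`, so taking `t = t₀` gives a bound for all times.
  replace hgM : ∀ t ≥ 0, ∀ y ∈ Metric.closedBall 0 R, ‖g t y‖ ≤ M := fun t ht y hy =>
    hgM t ht t ⟨le_rfl, by linarith⟩ y hy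
  -- Quarters of `ρ` go to the limiting radius `e`, the motion `c * ε` between samples, the
  -- discretisation error `γ * ε * δ`, and the decayed initial state after `t₁`.
  set e := min δ (ρ / 4) with he
  have he0 : 0 < e := lt_min hδ (by linarith)
  set γ := (M + 1) / e with hγdef
  have hγ : 0 < γ := by positivity
  have heγ : (M + 1) / γ = e := by rw [hγdef]; field_simp
  have heδ : e ≤ δ := min_le_left _ _
  have heρ : e ≤ ρ / 4 := min_le_right _ _
  obtain ⟨ε₁, hε₁, H⟩ := exists_sampledRegime hD hf hg hrank hα.le hinv hκ hδ hδR hRD hM hgM hγ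
    (heγ ▸ heδ) (η := ρ / 4) (by linarith)
  -- The decay rate is the gain. Since `γ * t₁ = 4 * δ / ρ`, the inequality `s * exp (-s) ≤ 1`
  -- yields `δ * exp (-γ * t) ≤ ρ / 4` from `t₁` on.
  refine ⟨γ, hγ, min ε₁ (ρ / (4 * δ * γ)), by positivity, γ, hγ, 4 * δ / ρ / γ, by positivity,
    fun ε hε x₀ hx₀ => ?_⟩
  intro Sol
  replace hx₀ : x₀ ∈ Metric.closedBall 0 δ := Metric.ball_subset_closedBall hx₀
  have hε0 : 0 < ε := hε.1
  obtain ⟨c, hcε, Hc⟩ := H ε ⟨hε0, hε.2.trans (min_le_left _ _)⟩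
  rw [heγ] at Hc
  have hint : ∀ x, Sol (Ici 0) x → ∀ T, 0 ≤ T → IsIntegralSolution D
      (sampledField g f (feedback f S₁ S₂ S₃ κ κ₁ κ₂ γ ε)) ε x₀ T x := fun x hx T hT =>
    hx.isIntegralSolution hε0 le_rfl hT Icc_subset_Ici_self
  refine ⟨?_, fun T hT x hx => ?_, fun hL x y hx hy => ?_, fun x hx => ?_⟩
  -- Existence is continuation from the degenerate interval `[0, 0]`.
  · have h0 : IsIntegralSolution D (sampledField g f (feedback f S₁ S₂ S₃ κ κ₁ κ₂ γ ε)) ε x₀ 0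
        fun _ => x₀ :=
      ⟨rfl, fun _ _ => hδD hx₀, IntervalIntegrable.refl, fun t ht => by
        rw [le_antisymm ht.2 ht.1, intervalIntegral.integral_same, add_zero]⟩
    obtain ⟨y, hy, _⟩ := Hc.exists_extension le_rfl h0 hx₀
    exact ⟨y, Hc.isPiSolutionOn hy hx₀⟩
  · obtain ⟨y, hy, hxy⟩ := Hc.exists_extension_of_Ico hT (fun s hs =>
      hx.isIntegralSolution hε0 Ico_subset_Ici_self hs.1 (Icc_subset_Ico_right hs.2)) hx₀
    exact ⟨y, Hc.isPiSolutionOn hy hx₀, hxy⟩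
  · obtain ⟨L, hLip⟩ := exists_lipschitz_sampledField hD hf hRD hL hα.le hinv hδR.le κ κ₁ κ₂ γ hε0
    exact Hc.eqOn_of_lipschitz hLip (hint x hx) (hint y hy) hx₀
  · have hγε : γ * ε ≤ 1 := by linarith [Hc.q_nonneg]
    have hγεδ : γ * ε * δ ≤ ρ / 4 := by
      have := hε.2.trans (min_le_right _ _)
      rw [le_div_iff₀ (by positivity)] at this
      linarith
    rw [mem_closedBall_zero_iff] at hx₀
    have key : ∀ t ≥ 0, ‖x t‖ ≤ ‖x₀‖ * Real.exp (-γ * t) + 3 * ρ / 4 := by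
      intro t ht
      obtain ⟨-, h1, h2⟩ := Hc.floor_step (hint x hx t ht) (mem_closedBall_zero_iff.2 hx₀)
        ⟨ht, le_rfl⟩
      have h3 := pow_one_sub_le_exp_add hγ.le hε0 hγε ht
      have h4 : 0 ≤ (1 - γ * ε) ^ ⌊t / ε⌋₊ := pow_nonneg Hc.q_nonneg _
      have h5 := norm_le_norm_add_norm_sub' (x t) (x (ε * ⌊t / ε⌋₊))
      have h6 := mul_le_mul_of_nonneg_right h3 (norm_nonneg x₀)
      have h7 := mul_le_mul_of_nonneg_left hx₀ (by positivity : 0 ≤ γ * ε)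
      have h8 := mul_nonneg h4 he0.le
      linarith
    refine ⟨fun t ht => (key t ht.1).trans (by linarith), fun t ht => ?_⟩
    have ht0 : 0 ≤ t := le_trans (by positivity) (mem_Ici.1 ht)
    refine (key t ht0).trans ?_
    have hδt : 4 * δ / ρ ≤ γ * t := by
      have := mem_Ici.1 ht
      rw [div_le_iff₀ hγ] at this
      linarith
    have hδt' : δ ≤ ρ / 4 * (γ * t) := by
      rw [div_le_iff₀ hρ] at hδt
      linarith
    have h1 : γ * t * Real.exp (-γ * t) ≤ 1 := by
      rw [neg_mul, Real.exp_neg, ← div_eq_mul_inv, div_le_one (Real.exp_pos _)]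
      linarith [Real.add_one_le_exp (γ * t)]
    have h2 := mul_le_mul_of_nonneg_right (hx₀.trans hδt') (Real.exp_pos (-γ * t)).le
    have h3 := mul_le_mul_of_nonneg_left h1 (by positivity : 0 ≤ ρ / 4)
    linarith
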